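/- Let $(N,g)$ be a smooth Riemannian manifold of dimension $n=2m$ with Levi-Civita connection $\nabla$. Let $\pi:\mathcal Z\to N$ be its twistor space, i.e. the smooth bundle whose fibre over $p\in N$ consists of all complex structures $j$ on $T_pN$ (endomorphisms with $j^2=-\mathrm{Id}$) that are orthogonal with respect to $g_p$. For $z=(p,j)\in\mathcal Z$ write $T_z\mathcal Z=\mathcal H_z\oplus\mathcal V_z$, where $\mathcal V_z$ is the tangent space of the fibre, identified with the space of $g_p$-skew-symmetric endomorphisms of $T_pN$ that anti-commute with $j$, and $\mathcal H_z$ is the horizontal space determined by $\nabla$. For $t>0$ let $h_t$ be the Riemannian metric on $\mathcal Z$ for which $\mathcal H_z\perp\mathcal V_z$, $h_t=\pi^*g$ on $\mathcal H_z$, and $h_t(A,B)=-\frac{t}{n}\,\mathrm{Trace}(A\circ B)$ for $A,B\in\mathcal V_z$. Let $J$ be an almost complex structure on $N$ such that $(N,g,J)$ is Kähler: $J$ is smooth, $J^2=-\mathrm{Id}$, $J$ is $g$-orthogonal, $J$ is integrable (its Nijenhuis tensor vanishes), and the form $\omega(X,Y)=g(JX,Y)$ is closed. Then, for every $t>0$,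 the map $J:(N,g)\to(\mathcal Z,h_t)$, $p\mapsto (p,J_p)$, is a totally geodesic isometric embedding. That is, it is a smooth embedding, $J^*h_t=g$, and its second fundamental form $$\widetilde\nabla J_*(X,Y)=\widetilde D_X(J_*Y)-J_*(\nabla_XY)$$ vanishes for all vector fields $X,Y$, where $\widetilde D$ is the connection on $J^*T\mathcal Z$ induced by the Levi-Civita connection of $h_t$. -/

import Mathlib

open scoped Manifold ContDiff Topology RealInnerProductSpace

noncomputable section

namespace Twistor


/-! ### Linear algebra: orthogonal complex structures on `ℝ^{2m}` -/

/-- The Euclidean space `ℝ^{2m} = ℝ^m ⊕ ℝ^m`. -/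
def Std (m : ℕ) : Type := EuclideanSpace ℝ (Fin m ⊕ Fin m)

instance (m : ℕ) : NormedAddCommGroup (Std m) :=
  inferInstanceAs (NormedAddCommGroup (EuclideanSpace ℝ (Fin m ⊕ Fin m)))

instance (m : ℕ) : InnerProductSpace ℝ (Std m) :=
  inferInstanceAs (InnerProductSpace ℝ (EuclideanSpace ℝ (Fin m ⊕ Fin m)))

instance (m : ℕ) : FiniteDimensional ℝ (Std m) :=
  inferInstanceAs (FiniteDimensional ℝ (EuclideanSpace ℝ (Fin m ⊕ Fin m)))

/-- The coordinates of a vector of `ℝ^m ⊕ ℝ^m`. -/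
def Std.equiv (m : ℕ) : Std m ≃ₗᵢ[ℝ] EuclideanSpace ℝ (Fin m ⊕ Fin m) :=
  LinearIsometryEquiv.refl ℝ (EuclideanSpace ℝ (Fin m ⊕ Fin m))

/-- The standard complex structure `(a, b) ↦ (-b, a)` of `ℝ^m ⊕ ℝ^m`. -/
def stdJ (m : ℕ) : Std m →L[ℝ] Std m :=
  LinearMap.toContinuousLinearMap
    { toFun := fun v => (Std.equiv m).symm (WithLp.toLp 2
        (Sum.elim (fun k => - Std.equiv m v (Sum.inr k)) (fun k => Std.equiv m v (Sum.inl k))))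
      map_add' := by
        intro u v
        apply (Std.equiv m).injective
        ext k; rcases k with k | k <;> simp; ring
      map_smul' := by
        intro c v
        apply (Std.equiv m).injective
        ext k; rcases k with k | k <;> simp }

theorem stdJ_inl {m : ℕ} (v : Std m) (k : Fin m) :
    Std.equiv m (stdJ m v) (Sum.inl k) = - Std.equiv m v (Sum.inr k) := rfl

theorem stdJ_inr {m : ℕ} (v : Std m) (k : Fin m) :
    Std.equiv m (stdJ m v) (Sum.inr k) = Std.equiv m v (Sum.inl k) := rfl

theorem stdJ_mul_self (m : ℕ) : stdJ m * stdJ m = -1 := by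
  ext v
  apply (Std.equiv m).injective
  ext k
  rcases k with k | k <;> simp [stdJ_inl, stdJ_inr]

theorem inner_stdJ {m : ℕ} (u v : Std m) : ⟪stdJ m u, stdJ m v⟫ = ⟪u, v⟫ := by
  rw [← (Std.equiv m).inner_map_map (stdJ m u), ← (Std.equiv m).inner_map_map u v]
  simp only [PiLp.inner_apply, Fintype.sum_sum_type, stdJ_inl, stdJ_inr]
  simp [add_comm]

/-- The tangent space at `stdJ m` of the manifold of orthogonal complex structures of `ℝ^{2m}`:
skew-symmetric endomorphisms anti-commuting with `stdJ m`. -/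
def tangentF (m : ℕ) : Submodule ℝ (Std m →L[ℝ] Std m) where
  carrier := {Q | (∀ u v, ⟪Q u, v⟫ = -⟪u, Q v⟫) ∧ Q * stdJ m = -(stdJ m * Q)}
  add_mem' := by
    rintro A B ⟨hA, hA'⟩ ⟨hB, hB'⟩
    refine ⟨fun u v => ?_, ?_⟩
    · simp only [add_apply, inner_add_left, inner_add_right, hA, hB]; ring
    · rw [add_mul, hA', hB', mul_add]; abel
  zero_mem' := by simp
  smul_mem' := by
    rintro c A ⟨hA, hA'⟩
    refine ⟨fun u v => ?_, ?_⟩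
    · simp only [smul_apply, inner_smul_left, inner_smul_right, hA]; simp
    · rw [smul_mul_assoc, hA', mul_smul_comm, smul_neg]

/-- The vector space `tangentF m`, as the model space of the fibres of the twistor space. -/
def FModel (m : ℕ) : Type := tangentF m

instance (m : ℕ) : NormedAddCommGroup (FModel m) :=
  inferInstanceAs (NormedAddCommGroup (tangentF m))

instance (m : ℕ) : NormedSpace ℝ (FModel m) := inferInstanceAs (NormedSpace ℝ (tangentF m))

instance (m : ℕ) : FiniteDimensional ℝ (FModel m) :=
  inferInstanceAs (FiniteDimensional ℝ (tangentF m))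

/-- The inclusion of `tangentF m` in the space of endomorphisms. -/
def inclF (m : ℕ) : FModel m →L[ℝ] (Std m →L[ℝ] Std m) := (tangentF m).subtypeL

/-- A linear projection of the endomorphisms of `ℝ^{2m}` onto `tangentF m`. -/
def projF (m : ℕ) : (Std m →L[ℝ] Std m) →L[ℝ] FModel m :=
  (Submodule.ClosedComplemented.of_finiteDimensional (tangentF m)).choose

theorem inclF_mem {m : ℕ} (Q : FModel m) : inclF m Q ∈ tangentF m := Q.2

theorem projF_inclF {m : ℕ} (Q : FModel m) : projF m (inclF m Q) = Q :=
  (Submodule.ClosedComplemented.of_finiteDimensional (tangentF m)).choose_spec Q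

theorem inclF_projF {m : ℕ} {Q : Std m →L[ℝ] Std m} (hQ : Q ∈ tangentF m) :
    inclF m (projF m Q) = Q :=
  congrArg (inclF m) (projF_inclF (m := m) (⟨Q, hQ⟩ : tangentF m))

/-- Orthogonal complex structures of `ℝ^{2m}`. -/
def IsOrthoCplx {m : ℕ} (K : Std m →L[ℝ] Std m) : Prop :=
  K * K = -1 ∧ ∀ u v, ⟪K u, K v⟫ = ⟪u, v⟫

/-- The Cayley transform, `Q ↦ J₀ (1 + Q) (1 - Q)⁻¹` for `J₀ = stdJ m`; it maps `tangentF m`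
bijectively onto the orthogonal complex structures `K` for which `1 - J₀ K` is invertible. -/
def cayley {m : ℕ} (Q : Std m →L[ℝ] Std m) : Std m →L[ℝ] Std m :=
  stdJ m * ((1 + Q) * Ring.inverse (1 - Q))

/-- The inverse of the Cayley transform, `K ↦ (A - 1) (A + 1)⁻¹` with `A = J₀⁻¹ K = - J₀ K`. -/
def cayleyInv {m : ℕ} (K : Std m →L[ℝ] Std m) : Std m →L[ℝ] Std m :=
  (-(stdJ m * K) - 1) * Ring.inverse (1 - stdJ m * K)

theorem ringInverse_eq {R : Type*} [Ring R] {a b : R} (h1 : a * b = 1) (h2 : b * a = 1) :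
    Ring.inverse a = b :=
  Ring.inverse_unit ⟨a, b, h1, h2⟩

theorem isUnit_of_forall_ne {m : ℕ} {A : Std m →L[ℝ] Std m} (h : ∀ v, A v = 0 → v = 0) :
    IsUnit A := by
  rw [ContinuousLinearMap.isUnit_iff_bijective]
  have hi : Function.Injective A := (injective_iff_map_eq_zero A).2 h
  exact ⟨hi, (LinearMap.injective_iff_surjective (f := (A : Std m →ₗ[ℝ] Std m))).1 hi⟩

theorem isUnit_one_sub {m : ℕ} {Q : Std m →L[ℝ] Std m} (h : ∀ u v, ⟪Q u, v⟫ = -⟪u, Q v⟫) :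
    IsUnit (1 - Q) := by
  refine isUnit_of_forall_ne fun v hv => ?_
  have h1 : v = Q v := by simpa [sub_eq_zero] using hv
  have h2 := h v v
  rw [← h1] at h2
  have : ⟪v, v⟫ = 0 := by linarith
  exact inner_self_eq_zero.1 this

theorem IsOrthoCplx.skew {m : ℕ} {K : Std m →L[ℝ] Std m} (hK : IsOrthoCplx K) (u v : Std m) :
    ⟪K u, v⟫ = -⟪u, K v⟫ := by
  have h := hK.2 u (K v)
  have h2 : K (K v) = -v := by
    have := congrArg (fun A : Std m →L[ℝ] Std m => A v) hK.1
    simpa using this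
  rw [h2, inner_neg_right] at h
  linarith

theorem isOrthoCplx_stdJ (m : ℕ) : IsOrthoCplx (stdJ m) := ⟨stdJ_mul_self m, inner_stdJ⟩

theorem isOrthoCplx_cayley {m : ℕ} {Q : Std m →L[ℝ] Std m} (hQ : Q ∈ tangentF m) :
    IsOrthoCplx (cayley Q) := by
  obtain ⟨h1, h2⟩ := hQ
  have hJ := stdJ_mul_self m
  have u1 := isUnit_one_sub h1
  have h1' : ∀ u v, ⟪(-Q) u, v⟫ = -⟪u, (-Q) v⟫ := by
    intro u v; simp [h1]
  have u2 : IsUnit (1 + Q) := by simpa using isUnit_one_sub h1'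
  have e1 : (1 - Q) * Ring.inverse (1 - Q) = 1 := Ring.mul_inverse_cancel _ u1
  have e2 : Ring.inverse (1 - Q) * (1 - Q) = 1 := Ring.inverse_mul_cancel _ u1
  have e3 : (1 + Q) * Ring.inverse (1 + Q) = 1 := Ring.mul_inverse_cancel _ u2
  have e4 : Ring.inverse (1 + Q) * (1 + Q) = 1 := Ring.inverse_mul_cancel _ u2
  have c1 : (1 + Q) * stdJ m = stdJ m * (1 - Q) := by
    rw [add_mul, h2, mul_sub]; simp [sub_eq_add_neg]
  have c2 : (1 - Q) * stdJ m = stdJ m * (1 + Q) := by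
    rw [sub_mul, h2, mul_add]; simp
  -- `(1 - Q)⁻¹ J₀ = J₀ (1 + Q)⁻¹`
  have c3 : Ring.inverse (1 - Q) * stdJ m = stdJ m * Ring.inverse (1 + Q) := by
    calc Ring.inverse (1 - Q) * stdJ m
        = Ring.inverse (1 - Q) * (stdJ m * ((1 + Q) * Ring.inverse (1 + Q))) := by
          rw [e3, mul_one]
      _ = Ring.inverse (1 - Q) * ((stdJ m * (1 + Q)) * Ring.inverse (1 + Q)) := by
          simp only [mul_assoc]
      _ = (Ring.inverse (1 - Q) * (1 - Q)) * stdJ m * Ring.inverse (1 + Q) := by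
          rw [← c2]; simp only [mul_assoc]
      _ = _ := by rw [e2, one_mul]
  have c4 : (1 - Q) * (1 + Q) = (1 + Q) * (1 - Q) := by noncomm_ring
  refine ⟨?_, fun u v => ?_⟩
  · have : cayley Q * cayley Q = stdJ m * ((1 + Q) * (Ring.inverse (1 - Q) * stdJ m)
        * ((1 + Q) * Ring.inverse (1 - Q))) := by
      simp only [cayley, mul_assoc]
    rw [this, c3]
    calc stdJ m * ((1 + Q) * (stdJ m * Ring.inverse (1 + Q)) * ((1 + Q) * Ring.inverse (1 - Q)))
        = stdJ m * (((1 + Q) * stdJ m) * (Ring.inverse (1 + Q) * (1 + Q))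
            * Ring.inverse (1 - Q)) := by simp only [mul_assoc]
      _ = (stdJ m * stdJ m) * ((1 - Q) * Ring.inverse (1 - Q)) := by
          rw [e4, mul_one, c1]; simp only [mul_assoc]
      _ = -1 := by rw [e1, hJ, mul_one]
  · have key : ∀ a b, ⟪(1 + Q) a, (1 + Q) b⟫ = ⟪(1 - Q) a, (1 - Q) b⟫ := by
      intro a b
      simp only [add_apply, sub_apply,
        one_apply_eq_self, inner_add_left, inner_add_right, inner_sub_left,
        inner_sub_right, h1 a b]
      ring
    have e1' : ∀ w, (1 - Q) (Ring.inverse (1 - Q) w) = w := fun w => by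
      have := congrArg (fun A : Std m →L[ℝ] Std m => A w) e1
      simpa using this
    change ⟪stdJ m ((1 + Q) (Ring.inverse (1 - Q) u)), stdJ m ((1 + Q) (Ring.inverse (1 - Q) v))⟫
      = ⟪u, v⟫
    rw [inner_stdJ, key, e1', e1']

theorem isUnit_cayley {m : ℕ} {Q : Std m →L[ℝ] Std m} (hQ : Q ∈ tangentF m) :
    IsUnit (1 - stdJ m * cayley Q) ∧ cayleyInv (cayley Q) = Q := by
  have u1 := isUnit_one_sub hQ.1
  have hJ := stdJ_mul_self m
  have e1 : (1 - Q) * Ring.inverse (1 - Q) = 1 := Ring.mul_inverse_cancel _ u1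
  have e2 : Ring.inverse (1 - Q) * (1 - Q) = 1 := Ring.inverse_mul_cancel _ u1
  have a1 : stdJ m * cayley Q = -((1 + Q) * Ring.inverse (1 - Q)) := by
    rw [cayley, ← mul_assoc, hJ, neg_one_mul]
  have a2 : 1 - stdJ m * cayley Q = (2 : ℝ) • Ring.inverse (1 - Q) := by
    rw [a1, sub_neg_eq_add]
    nth_rewrite 1 [← e1]
    rw [← add_mul, two_smul, ← two_mul (Ring.inverse (1 - Q))]
    congr 1
    rw [← one_add_one_eq_two]; abel
  have a3 : -(stdJ m * cayley Q) - 1 = (2 : ℝ) • (Q * Ring.inverse (1 - Q)) := by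
    rw [a1, neg_neg]
    calc (1 + Q) * Ring.inverse (1 - Q) - 1
        = (1 + Q) * Ring.inverse (1 - Q) - (1 - Q) * Ring.inverse (1 - Q) := by rw [e1]
      _ = _ := by
        rw [← sub_mul, ← smul_mul_assoc]
        congr 1
        rw [two_smul]; abel
  have v1 : (1 - stdJ m * cayley Q) * ((1 / 2 : ℝ) • (1 - Q)) = 1 := by
    rw [a2, smul_mul_smul_comm, e2]; norm_num
  have v2 : ((1 / 2 : ℝ) • (1 - Q)) * (1 - stdJ m * cayley Q) = 1 := by
    rw [a2, smul_mul_smul_comm, e1]; norm_num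
  have hu : IsUnit (1 - stdJ m * cayley Q) := ⟨⟨_, _, v1, v2⟩, rfl⟩
  refine ⟨hu, ?_⟩
  have hinv : Ring.inverse (1 - stdJ m * cayley Q) = (1 / 2 : ℝ) • (1 - Q) :=
    ringInverse_eq v1 v2
  rw [cayleyInv, hinv, a3, smul_mul_smul_comm, mul_assoc, e2]
  norm_num

theorem cayleyInv_mem {m : ℕ} {K : Std m →L[ℝ] Std m} (hK : IsOrthoCplx K)
    (hu : IsUnit (1 - stdJ m * K)) :
    cayleyInv K ∈ tangentF m ∧ cayley (cayleyInv K) = K := by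
  have hJ := stdJ_mul_self m
  set A := -(stdJ m * K) with hA
  have hA1 : 1 - stdJ m * K = A + 1 := by rw [hA]; abel
  rw [hA1] at hu
  set R := Ring.inverse (A + 1) with hR
  have e1 : (A + 1) * R = 1 := Ring.mul_inverse_cancel _ hu
  have e2 : R * (A + 1) = 1 := Ring.inverse_mul_cancel _ hu
  have hQ : cayleyInv K = (A - 1) * R := by rw [cayleyInv, ← hA, hA1]
  -- `A⁻¹ = -(K J₀)`
  set B := -(K * stdJ m) with hB
  have AB : A * B = 1 := by
    rw [hA, hB, neg_mul_neg]
    calc stdJ m * K * (K * stdJ m) = stdJ m * (K * K) * stdJ m := by simp only [mul_assoc]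
      _ = 1 := by rw [hK.1]; simp [hJ]
  have BA : B * A = 1 := by
    rw [hA, hB, neg_mul_neg]
    calc K * stdJ m * (stdJ m * K) = K * (stdJ m * stdJ m) * K := by simp only [mul_assoc]
      _ = 1 := by rw [hJ]; simp [hK.1]
  have AJ : A * stdJ m = stdJ m * B := by
    rw [hA, hB]; simp [mul_assoc]
  have JA : stdJ m * A = K := by
    rw [hA, mul_neg, ← mul_assoc, hJ]; simp
  have comm : (A - 1) * R = R * (A - 1) := by
    calc (A - 1) * R = (R * (A + 1)) * ((A - 1) * R) := by rw [e2, one_mul]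
      _ = R * (((A + 1) * (A - 1)) * R) := by simp only [mul_assoc]
      _ = R * (((A - 1) * (A + 1)) * R) := by
          congr 2; noncomm_ring
      _ = R * (A - 1) * ((A + 1) * R) := by simp only [mul_assoc]
      _ = _ := by rw [e1, mul_one]
  -- `1 - Q = 2 R`, `1 + Q = 2 A R`
  have q1 : 1 - (A - 1) * R = (2 : ℝ) • R := by
    nth_rewrite 1 [← e1]
    rw [← sub_mul, two_smul, ← two_mul R]
    congr 1
    rw [← one_add_one_eq_two]; abel
  have q2 : 1 + (A - 1) * R = (2 : ℝ) • (A * R) := by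
    nth_rewrite 1 [← e1]
    rw [← add_mul, ← smul_mul_assoc]
    congr 1
    rw [two_smul]; abel
  have orthA : ∀ u v, ⟪A u, A v⟫ = ⟪u, v⟫ := by
    intro u v
    have : ∀ w, A w = - stdJ m (K w) := fun w => rfl
    rw [this, this, inner_neg_neg, inner_stdJ, hK.2]
  refine ⟨⟨fun u v => ?_, ?_⟩, ?_⟩
  · rw [hQ]
    have hv : ∀ w, (A + 1) (R w) = w := fun w => by
      have := congrArg (fun A : Std m →L[ℝ] Std m => A w) e1
      simpa using this
    have key : ∀ a b, ⟪(A - 1) a, (A + 1) b⟫ = -⟪(A + 1) a, (A - 1) b⟫ := by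
      intro a b
      simp only [add_apply, sub_apply,
        one_apply_eq_self, inner_add_left, inner_add_right, inner_sub_left,
        inner_sub_right, orthA a b]
      ring
    have := key (R u) (R v)
    rw [hv, hv] at this
    exact this
  · rw [hQ]
    -- `Q J₀ = -J₀ Q`
    have b1 : (A + 1) * stdJ m = stdJ m * (B * (A + 1)) := by
      rw [add_mul, AJ, one_mul, mul_add, mul_one, BA, mul_add, mul_one]; abel
    have b2 : (A - 1) * stdJ m = -(stdJ m * (B * (A - 1))) := by
      rw [sub_mul, AJ, one_mul, mul_sub, mul_one, BA, mul_sub, mul_one]; abel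
    have b3 : R * stdJ m = stdJ m * (A * R) := by
      have : (A + 1) * (stdJ m * (A * R)) = stdJ m := by
        rw [← mul_assoc, b1]
        calc stdJ m * (B * (A + 1)) * (A * R)
            = stdJ m * (B * (((A + 1) * A) * R)) := by simp only [mul_assoc]
          _ = stdJ m * (B * ((A * (A + 1)) * R)) := by
              congr 3; noncomm_ring
          _ = stdJ m * ((B * A) * ((A + 1) * R)) := by simp only [mul_assoc]
          _ = stdJ m := by rw [BA, e1, one_mul, mul_one]
      calc R * stdJ m = R * ((A + 1) * (stdJ m * (A * R))) := by rw [this]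
        _ = (R * (A + 1)) * (stdJ m * (A * R)) := by simp only [mul_assoc]
        _ = _ := by rw [e2, one_mul]
    calc (A - 1) * R * stdJ m = ((A - 1) * stdJ m) * (A * R) := by
          rw [mul_assoc, b3]; simp only [mul_assoc]
      _ = -(stdJ m * ((B * ((A - 1) * A)) * R)) := by
          rw [b2]; simp only [neg_mul, mul_assoc]
      _ = -(stdJ m * ((B * (A * (A - 1))) * R)) := by
          congr 4; noncomm_ring
      _ = -(stdJ m * ((A - 1) * R)) := by rw [← mul_assoc B, BA, one_mul]
  · rw [hQ, cayley, q1, q2]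
    have hR2 : Ring.inverse ((2 : ℝ) • R) = (1 / 2 : ℝ) • (A + 1) := by
      have h1 : ((2 : ℝ) • R) * ((1 / 2 : ℝ) • (A + 1)) = 1 := by
        rw [smul_mul_smul_comm, e2]; norm_num
      have h2 : ((1 / 2 : ℝ) • (A + 1)) * ((2 : ℝ) • R) = 1 := by
        rw [smul_mul_smul_comm, e1]; norm_num
      exact ringInverse_eq h1 h2
    rw [hR2, smul_mul_smul_comm, mul_assoc, e2]
    norm_num
    exact JA



/-- Symmetric endomorphisms. -/
def symEnd (V : Type*) [NormedAddCommGroup V] [InnerProductSpace ℝ V] :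
    Submodule ℝ (V →L[ℝ] V) where
  carrier := {S | ∀ u v, ⟪S u, v⟫ = ⟪u, S v⟫}
  add_mem' := by
    intro A B hA hB u v
    simp only [add_apply, inner_add_left, inner_add_right, hA u v, hB u v]
  zero_mem' := by intro u v; simp
  smul_mem' := by
    intro c A hA u v
    simp only [smul_apply, inner_smul_left, inner_smul_right, hA u v]; simp

/-- The inverse function theorem for squaring, near the identity, in a subspace closed under
squaring. -/
theorem exists_sqrt_aux {A W : Type*} [NormedRing A] [NormedAlgebra ℝ A]
    [NormedAddCommGroup W] [NormedSpace ℝ W] [CompleteSpace W] (j : W →L[ℝ] A) (pr : A →L[ℝ] W)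
    (hpr : ∀ w, pr (j w) = w) (hsq : ∀ w, j (pr (j w * j w)) = j w * j w) (i : W) (hi1 : j i = 1) :
    ∃ (r : A → W) (U : Set A), IsOpen U ∧ 1 ∈ U ∧ r 1 = i ∧ ContDiffOn ℝ ω (fun P => j (r P)) U ∧
      ∀ P ∈ U, j (r P) * j (r P) = j (pr P) := by
  let f : W → W := fun S => pr (j S * j S)
  have hf : ContDiff ℝ ω f := pr.contDiff.comp (j.contDiff.mul j.contDiff)
  have hfd : HasFDerivAt f
      ((ContinuousLinearEquiv.smulLeft (Units.mk0 (2 : ℝ) two_ne_zero) : W ≃L[ℝ] W) : W →L[ℝ] W)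
      i := by
    have hs : HasFDerivAt (fun S : W => j S) j i := j.hasFDerivAt
    have := pr.hasFDerivAt.comp i (hs.mul' hs)
    refine this.congr_fderiv ?_
    ext1 H
    have h2 : ((2 : ℝ) • H) = H + H := two_smul _ _
    simp [hi1, hpr]
    exact h2.symm
  have hω : (ω : WithTop ℕ∞) ≠ 0 := by simp
  have hi : f i = i := by
    change pr (j i * j i) = i
    rw [hi1, mul_one, ← hi1, hpr]
  let q := hf.contDiffAt.localInverse (a := i) hfd hω
  have hq : ContDiffAt ℝ ω q i := by
    have := hf.contDiffAt.to_localInverse hfd hω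
    rwa [hi] at this
  have hq1 : q i = i := by
    have := hf.contDiffAt.localInverse_apply_image hfd hω
    rwa [hi] at this
  have hq2 : ∀ᶠ P in 𝓝 i, f (q P) = P := by
    have := (hf.contDiffAt.hasStrictFDerivAt' hfd hω).eventually_right_inverse
    rwa [hi] at this
  have hpr1 : pr 1 = i := by rw [← hi1, hpr]
  have ev : ∀ᶠ P in 𝓝 (1 : A), f (q (pr P)) = pr P ∧ ContDiffAt ℝ ω q (pr P) := by
    have ht : Filter.Tendsto pr (𝓝 1) (𝓝 i) := by
      rw [← hpr1]; exact pr.continuous.continuousAt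
    exact ht.eventually (hq2.and (hq.eventually (by simp)))
  obtain ⟨U, hU, hUo, hU1⟩ := eventually_nhds_iff.1 ev
  refine ⟨fun P => q (pr P), U, hUo, hU1, ?_, ?_, ?_⟩
  · change q (pr 1) = i
    rw [hpr1, hq1]
  · intro P hP
    exact (j.contDiff.contDiffAt.comp P
      ((hU P hP).2.comp P pr.contDiff.contDiffAt)).contDiffWithinAt
  · intro P hP
    rw [← hsq]
    exact congrArg j (hU P hP).1

/-- Near the identity, symmetric endomorphisms have a symmetric square root depending analytically
on the endomorphism. -/
theorem exists_sqrt (V : Type*) [NormedAddCommGroup V] [InnerProductSpace ℝ V]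
    [FiniteDimensional ℝ V] :
    ∃ (r : (V →L[ℝ] V) → (V →L[ℝ] V)) (U : Set (V →L[ℝ] V)), IsOpen U ∧ 1 ∈ U ∧ r 1 = 1 ∧
      ContDiffOn ℝ ω r U ∧
      ∀ P ∈ U, P ∈ symEnd V → r P ∈ symEnd V ∧ r P * r P = P := by
  obtain ⟨pr, hpr⟩ := Submodule.ClosedComplemented.of_finiteDimensional (symEnd V)
  have h1 : (1 : V →L[ℝ] V) ∈ symEnd V := by intro u v; simp
  have hcs : CompleteSpace (symEnd V) := FiniteDimensional.complete ℝ _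
  have hsq : ∀ w : symEnd V, (symEnd V).subtypeL (pr ((symEnd V).subtypeL w * (symEnd V).subtypeL w))
      = (symEnd V).subtypeL w * (symEnd V).subtypeL w := by
    intro S
    have : (S : V →L[ℝ] V) * S ∈ symEnd V := by
      intro u v
      change ⟪S.1 (S.1 u), v⟫ = ⟪u, S.1 (S.1 v)⟫
      rw [S.2, S.2]
    exact congrArg Subtype.val (hpr ⟨_, this⟩)
  obtain ⟨r, U, hU, hU1, hr1, hr, hrs⟩ :=
    exists_sqrt_aux (A := V →L[ℝ] V) (W := symEnd V) (symEnd V).subtypeL pr hpr hsq ⟨1, h1⟩ rfl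
  refine ⟨fun P => (symEnd V).subtypeL (r P), U, hU, hU1, ?_, hr, ?_⟩
  · exact congrArg Subtype.val hr1
  · intro P hP hPs
    refine ⟨(r P).2, (hrs P hP).trans ?_⟩
    exact congrArg Subtype.val (hpr ⟨P, hPs⟩)

/-- Adapted orthonormal bases. -/
theorem exists_unitary {V : Type*} [AddCommGroup V] [Module ℝ V] [FiniteDimensional ℝ V]
    (b : V →ₗ[ℝ] V →ₗ[ℝ] ℝ) (hs : ∀ u v, b u v = b v u) (hp : ∀ v, v ≠ 0 → 0 < b v v)
    (J : V →ₗ[ℝ] V) (hJ : ∀ v, J (J v) = -v) (hJb : ∀ u v, b (J u) (J v) = b u v)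
    (k : ℕ) (hk : 2 * k ≤ Module.finrank ℝ V) :
    ∃ e : Fin k → V, ∀ i j, b (e i) (e j) = (if i = j then 1 else 0) ∧ b (e i) (J (e j)) = 0 := by
  induction k with
  | zero => exact ⟨fun i => i.elim0, fun i => i.elim0⟩
  | succ k ih =>
    obtain ⟨e, he⟩ := ih (by omega)
    have hskew : ∀ u v, b (J u) v = - b u (J v) := by
      intro u v
      have h := hJb u (J v)
      rw [hJ, map_neg] at h
      linarith
    let T : V →ₗ[ℝ] (Fin k → ℝ) × (Fin k → ℝ) :=
      LinearMap.prod (LinearMap.pi fun i => b (e i)) (LinearMap.pi fun i => b (J (e i)))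
    have hT : LinearMap.ker T ≠ ⊥ := by
      apply LinearMap.ker_ne_bot_of_finrank_lt
      simp; omega
    obtain ⟨w, hw, hw0⟩ := (Submodule.ne_bot_iff _).1 hT
    have hwT : T w = 0 := hw
    have w1 : ∀ i, b (e i) w = 0 := fun i => congrFun (congrArg Prod.fst hwT) i
    have w2 : ∀ i, b (J (e i)) w = 0 := fun i => congrFun (congrArg Prod.snd hwT) i
    have hpos := hp w hw0
    set c : ℝ := (Real.sqrt (b w w))⁻¹ with hc
    have hcc : c * c * b w w = 1 := by
      have : Real.sqrt (b w w) * Real.sqrt (b w w) = b w w := Real.mul_self_sqrt hpos.le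
      have h0 : Real.sqrt (b w w) ≠ 0 := (Real.sqrt_pos.2 hpos).ne'
      rw [hc]
      field_simp
      nlinarith
    have wJ : b w (J w) = 0 := by
      have h := hskew w w
      rw [hs] at h
      linarith
    refine ⟨Fin.snoc e (c • w), fun i j => ?_⟩
    refine Fin.lastCases ?_ (fun i => ?_) i <;> refine Fin.lastCases ?_ (fun j => ?_) j
    · simp only [Fin.snoc_last, map_smul, LinearMap.smul_apply, smul_eq_mul, wJ]
      constructor
      · simp; linarith
      · simp
    · simp only [Fin.snoc_last, Fin.snoc_castSucc, map_smul, LinearMap.smul_apply, smul_eq_mul]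
      rw [hs w, hs w, w1, w2]
      have : Fin.last k ≠ j.castSucc := (Fin.castSucc_lt_last j).ne'
      simp [this]
    · simp only [Fin.snoc_last, Fin.snoc_castSucc, map_smul, smul_eq_mul]
      have h2 : b (e i) (J w) = 0 := by
        have := hskew (e i) w
        rw [w2] at this; linarith
      have : i.castSucc ≠ Fin.last k := (Fin.castSucc_lt_last i).ne
      simp [this, w1, h2]
    · simp only [Fin.snoc_castSucc]
      have := he i j
      simpa [Fin.castSucc_inj] using this


/-! ### The twistor space -/

/-- The tangent space `T_x N` of a manifold without boundary modelled on `E`. -/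
abbrev Tan (E : Type*) [NormedAddCommGroup E] [NormedSpace ℝ E] {N : Type*} [TopologicalSpace N]
    [ChartedSpace E N] (x : N) : Type _ := TangentSpace 𝓘(ℝ, E) x

/-- Smooth Riemannian metrics on a manifold modelled on `E`. -/
abbrev RMetric (E : Type*) [NormedAddCommGroup E] [NormedSpace ℝ E] (N : Type*)
    [TopologicalSpace N] [ChartedSpace E N] [IsManifold 𝓘(ℝ, E) ∞ N] : Type _ :=
  Bundle.ContMDiffRiemannianMetric 𝓘(ℝ, E) ∞ E (fun x : N => TangentSpace 𝓘(ℝ, E) x)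

section

variable {E : Type*} [NormedAddCommGroup E] [NormedSpace ℝ E]
  {N : Type*} [TopologicalSpace N] [ChartedSpace E N] [IsManifold 𝓘(ℝ, E) ∞ N]

/-- Half the dimension of `E`. -/
abbrev halfDim (E : Type*) [NormedAddCommGroup E] [NormedSpace ℝ E] : ℕ := Module.finrank ℝ E / 2

/-- The twistor space of a Riemannian manifold `(N, g)`: pairs of a point `p` of `N` and a complex
structure on `T_p N` that is orthogonal for `g_p`. -/
structure TwistorSpace (g : RMetric E N) where
  /-- the projection to `N` -/
  base : N
  /-- the complex structure on the tangent space at `base` -/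
  str : Tan E base →L[ℝ] Tan E base
  sq : ∀ v, str (str v) = -v
  orth : ∀ u v, g.inner base (str u) (str v) = g.inner base u v

/-- A smooth orthonormal frame `ℝ^{2m} ≃ T_x N` over an open subset `dom` of the domain of
the chart at `center` (the values outside `dom` play no role). -/
structure OrthoFrame (g : RMetric E N) where
  center : N
  dom : Set N
  isOpen_dom : IsOpen dom
  dom_subset : dom ⊆ (chartAt E center).source
  frame : ∀ x : N, Std (halfDim E) ≃L[ℝ] Tan E x
  smooth : ∀ v, ContMDiffOn 𝓘(ℝ, E) (𝓘(ℝ, E).prod 𝓘(ℝ, E)) ∞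
    (fun x => (⟨x, frame x v⟩ : TangentBundle 𝓘(ℝ, E) N)) dom
  isometry : ∀ x ∈ dom, ∀ u v, g.inner x (frame x u) (frame x v) = ⟪u, v⟫

variable {g : RMetric E N}

@[ext]
theorem TwistorSpace.ext' {z w : TwistorSpace g} (h : z.base = w.base)
    (h' : HEq z.str w.str) : z = w := by
  cases z; cases w; cases h; cases h'; rfl

namespace OrthoFrame

/-- An endomorphism of `T_x N` read in the frame. -/
def read (F : OrthoFrame g) (x : N) (A : Tan E x →L[ℝ] Tan E x) :
    Std (halfDim E) →L[ℝ] Std (halfDim E) :=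
  ((F.frame x).symm : Tan E x →L[ℝ] Std (halfDim E)) ∘L A ∘L
    (F.frame x : Std (halfDim E) →L[ℝ] Tan E x)

/-- The endomorphism of `T_x N` with a given expression in the frame. -/
def write (F : OrthoFrame g) (x : N) (K : Std (halfDim E) →L[ℝ] Std (halfDim E)) :
    Tan E x →L[ℝ] Tan E x :=
  (F.frame x : Std (halfDim E) →L[ℝ] Tan E x) ∘L K ∘L
    ((F.frame x).symm : Tan E x →L[ℝ] Std (halfDim E))

theorem read_apply (F : OrthoFrame g) (x : N) (A : Tan E x →L[ℝ] Tan E x)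
    (v : Std (halfDim E)) : F.read x A v = (F.frame x).symm (A (F.frame x v)) := rfl

theorem write_apply (F : OrthoFrame g) (x : N) (K : Std (halfDim E) →L[ℝ] Std (halfDim E))
    (v : Tan E x) : F.write x K v = F.frame x (K ((F.frame x).symm v)) := rfl

theorem read_write (F : OrthoFrame g) (x : N) (K : Std (halfDim E) →L[ℝ] Std (halfDim E)) :
    F.read x (F.write x K) = K := by
  ext v; simp [read_apply, write_apply]

theorem write_read (F : OrthoFrame g) (x : N) (A : Tan E x →L[ℝ] Tan E x) :
    F.write x (F.read x A) = A := by
  ext v; simp [read_apply, write_apply]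

theorem isOrthoCplx_read (F : OrthoFrame g) (z : TwistorSpace g) (hz : z.base ∈ F.dom) :
    IsOrthoCplx (F.read z.base z.str) := by
  refine ⟨?_, fun u v => ?_⟩
  · ext v
    change F.read z.base z.str (F.read z.base z.str v) = -v
    simp [read_apply, z.sq]
  · rw [← F.isometry _ hz, read_apply, read_apply, ContinuousLinearEquiv.apply_symm_apply,
      ContinuousLinearEquiv.apply_symm_apply, z.orth, F.isometry _ hz]

/-- The point of the twistor space over `x ∈ F.dom` given by an orthogonal complex structure
of `ℝ^{2m}` and the frame. -/
def mkPoint (F : OrthoFrame g) (x : N) (hx : x ∈ F.dom)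
    (K : Std (halfDim E) →L[ℝ] Std (halfDim E)) (hK : IsOrthoCplx K) : TwistorSpace g where
  base := x
  str := F.write x K
  sq := fun v => by
    have h : ∀ w, K (K w) = -w := fun w => by
      have := congrArg (fun A : Std (halfDim E) →L[ℝ] Std (halfDim E) => A w) hK.1
      simpa using this
    simp [write_apply, h]
  orth := fun u v => by
    rw [write_apply, write_apply, F.isometry _ hx, hK.2, ← F.isometry _ hx]
    simp

theorem mkPoint_read (F : OrthoFrame g) (z : TwistorSpace g) (hz : z.base ∈ F.dom)
    (K : Std (halfDim E) →L[ℝ] Std (halfDim E)) (hK : IsOrthoCplx K)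
    (h : K = F.read z.base z.str) : F.mkPoint z.base hz K hK = z := by
  subst h
  obtain ⟨p, J, h1, h2⟩ := z
  simp only [mkPoint, write_read]

end OrthoFrame

namespace OrthoFrame

open Classical in
/-- The chart of the twistor space given by a local orthonormal frame: the coordinates of `(x, J)`
are those of `x` in the chart of `N` at `F.center` and the inverse Cayley transform of the matrix
of `J` in the frame. (The point `z₀` only serves as a value of the inverse outside the target.) -/
def chart (F : OrthoFrame g) (z₀ : TwistorSpace g) :
    PartialEquiv (TwistorSpace g) (E × FModel (halfDim E)) where
  toFun z := (chartAt E F.center z.base, projF _ (cayleyInv (F.read z.base z.str)))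
  invFun y :=
    if h : (chartAt E F.center).symm y.1 ∈ F.dom then
      F.mkPoint _ h (cayley (inclF _ y.2)) (isOrthoCplx_cayley (inclF_mem y.2))
    else z₀
  source := {z | z.base ∈ F.dom ∧ IsUnit (1 - stdJ (halfDim E) * F.read z.base z.str)}
  target := {y | y.1 ∈ (chartAt E F.center).target ∧ (chartAt E F.center).symm y.1 ∈ F.dom}
  map_source' := by
    rintro z ⟨hz, -⟩
    have h := F.dom_subset hz
    refine ⟨(chartAt E F.center).map_source h, ?_⟩
    change (chartAt E F.center).symm (chartAt E F.center z.base) ∈ F.dom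
    rwa [(chartAt E F.center).left_inv h]
  map_target' := by
    rintro ⟨y, Q⟩ ⟨-, hy⟩
    rw [dif_pos hy]
    refine ⟨hy, ?_⟩
    simp only [mkPoint, read_write]
    exact (isUnit_cayley (inclF_mem Q)).1
  left_inv' := by
    rintro z ⟨hz, hu⟩
    have h := F.dom_subset hz
    have hi := (chartAt E F.center).left_inv h
    have hc := cayleyInv_mem (F.isOrthoCplx_read z hz) hu
    have hz' : (chartAt E F.center).symm (chartAt E F.center z.base) ∈ F.dom := by rwa [hi]
    rw [dif_pos hz']
    have gen : ∀ (x : N) (hx : x ∈ F.dom) (hxz : x = z.base)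
        (K : Std (halfDim E) →L[ℝ] Std (halfDim E)) (hK : IsOrthoCplx K)
        (_ : K = F.read z.base z.str), F.mkPoint x hx K hK = z := by
      intro x hx hxz K hK hKe
      subst hxz
      exact F.mkPoint_read z hx K hK hKe
    exact gen _ _ hi _ _ (by rw [inclF_projF hc.1, hc.2])
  right_inv' := by
    rintro ⟨y, Q⟩ ⟨hy1, hy⟩
    rw [dif_pos hy]
    simp only [mkPoint, read_write, (isUnit_cayley (inclF_mem Q)).2, projF_inclF]
    congr 1
    exact (chartAt E F.center).right_inv hy1

/-- The change of frames. -/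
def trans (F F' : OrthoFrame g) (x : N) : Std (halfDim E) →L[ℝ] Std (halfDim E) :=
  ((F'.frame x).symm : Tan E x →L[ℝ] Std (halfDim E)) ∘L
    (F.frame x : Std (halfDim E) →L[ℝ] Tan E x)

theorem read_write_trans (F F' : OrthoFrame g) (x : N)
    (K : Std (halfDim E) →L[ℝ] Std (halfDim E)) :
    F'.read x (F.write x K) = F.trans F' x * K * F'.trans F x := rfl

theorem inner_trans (F F' : OrthoFrame g) {x : N} (hx : x ∈ F'.dom) (u v : Std (halfDim E)) :
    ⟪F.trans F' x u, v⟫ = g.inner x (F.frame x u) (F'.frame x v) := by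
  rw [← F'.isometry x hx]
  simp [trans]

end OrthoFrame

end
section

variable {E : Type*} [NormedAddCommGroup E] [NormedSpace ℝ E]
  {N : Type*} [TopologicalSpace N] [ChartedSpace E N]

theorem contMDiffOn_end {V : Type*} [NormedAddCommGroup V] [InnerProductSpace ℝ V]
    [FiniteDimensional ℝ V] {f : N → V →L[ℝ] V} {s : Set N}
    (h : ∀ u v, ContMDiffOn 𝓘(ℝ, E) 𝓘(ℝ, ℝ) ∞ (fun x => ⟪f x u, v⟫) s) :
    ContMDiffOn 𝓘(ℝ, E) 𝓘(ℝ, V →L[ℝ] V) ∞ f s := by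
  let b := stdOrthonormalBasis ℝ V
  let ι := Fin (Module.finrank ℝ V)
  let L : (ι → ι → ℝ) →ₗ[ℝ] (V →L[ℝ] V) :=
    { toFun := fun c => ∑ i, ∑ j, c i j • ((innerSL ℝ (b i)).smulRight (b j))
      map_add' := by
        intro c d
        simp only [Pi.add_apply, add_smul, Finset.sum_add_distrib]
      map_smul' := by
        intro r c
        simp only [Pi.smul_apply, smul_eq_mul, mul_smul, Finset.smul_sum, RingHom.id_apply] }
  have hf : f = fun x => L.toContinuousLinearMap (fun i j => ⟪f x (b i), b j⟫) := by
    ext x v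
    have h1 : f x v = ∑ i, ⟪b i, v⟫ • f x (b i) := by
      conv_lhs => rw [← b.sum_repr' v]
      simp
    have h2 : ∀ i, f x (b i) = ∑ j, ⟪f x (b i), b j⟫ • b j := by
      intro i
      conv_lhs => rw [← b.sum_repr' (f x (b i))]
      simp only [real_inner_comm]
    have h3 : f x v = ∑ i, ∑ j, ⟪b i, v⟫ • (⟪f x (b i), b j⟫ • b j) := by
      rw [h1]
      refine Finset.sum_congr rfl fun i _ => ?_
      conv_lhs => rw [h2 i]
      rw [Finset.smul_sum]
    rw [h3]
    simp only [LinearMap.coe_toContinuousLinearMap', LinearMap.coe_mk, AddHom.coe_mk, L,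
      sum_apply, smul_apply, ContinuousLinearMap.smulRight_apply,
      innerSL_apply_apply]
    refine Finset.sum_congr rfl fun i _ => Finset.sum_congr rfl fun j _ => ?_
    rw [smul_comm]
  rw [hf]
  refine (L.toContinuousLinearMap.contDiff (n := ∞)).contMDiff.comp_contMDiffOn ?_
  rw [contMDiffOn_pi_space]
  intro i
  rw [contMDiffOn_pi_space]
  intro j
  exact h _ _

variable [IsManifold 𝓘(ℝ, E) ∞ N]

theorem contMDiffOn_inner (g : RMetric E N) {s : Set N} {X Y : ∀ x : N, Tan E x}
    (hX : ContMDiffOn 𝓘(ℝ, E) (𝓘(ℝ, E).prod 𝓘(ℝ, E)) ∞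
      (fun x => (⟨x, X x⟩ : TangentBundle 𝓘(ℝ, E) N)) s)
    (hY : ContMDiffOn 𝓘(ℝ, E) (𝓘(ℝ, E).prod 𝓘(ℝ, E)) ∞
      (fun x => (⟨x, Y x⟩ : TangentBundle 𝓘(ℝ, E) N)) s) :
    ContMDiffOn 𝓘(ℝ, E) 𝓘(ℝ, ℝ) ∞ (fun x => g.inner x (X x) (Y x)) s := by
  intro x hx
  have : ContMDiffWithinAt 𝓘(ℝ, E) (𝓘(ℝ, E).prod 𝓘(ℝ, ℝ)) ∞
      (fun m ↦ Bundle.TotalSpace.mk' ℝ (E := Bundle.Trivial N ℝ) m (g.inner m (X m) (Y m))) s x := by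
    apply ContMDiffWithinAt.clm_bundle_apply₂ (F₁ := E) (F₂ := E)
    · exact g.contMDiff.contMDiffAt.contMDiffWithinAt
    · exact hX x hx
    · exact hY x hx
  simp only [Bundle.contMDiffWithinAt_totalSpace] at this
  exact this.2

variable {g : RMetric E N}

theorem OrthoFrame.contMDiffOn_trans (F F' : OrthoFrame g) :
    ContMDiffOn 𝓘(ℝ, E) 𝓘(ℝ, Std (halfDim E) →L[ℝ] Std (halfDim E)) ∞ (F.trans F')
      (F.dom ∩ F'.dom) := by
  refine contMDiffOn_end fun u v => ?_
  refine (contMDiffOn_inner g ((F.smooth u).mono Set.inter_subset_left)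
    ((F'.smooth v).mono Set.inter_subset_right)).congr fun x hx => ?_
  exact F.inner_trans F' hx.2 u v

theorem contDiffOn_ringInverse {R : Type*} [NormedRing R] [NormedAlgebra ℝ R] [CompleteSpace R] :
    ContDiffOn ℝ ∞ (Ring.inverse : R → R) {a | IsUnit a} := by
  rintro _ ⟨u, rfl⟩
  exact (contDiffAt_ringInverse ℝ u).contDiffWithinAt

theorem contDiff_cayley (m : ℕ) : ContDiff ℝ ∞ (fun Q : FModel m => cayley (inclF m Q)) := by
  have hi : ContDiff ℝ ∞ (inclF m) := (inclF m).contDiff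
  have h1 : ContDiff ℝ ∞ (fun Q : FModel m => Ring.inverse (1 - inclF m Q)) := by
    rw [← contDiffOn_univ]
    exact contDiffOn_ringInverse.comp (contDiff_const.sub hi).contDiffOn
      fun Q _ => isUnit_one_sub (inclF_mem Q).1
  exact contDiff_const.mul ((contDiff_const.add hi).mul h1)

/-- The domain of the change of coordinates, apart from an invertibility condition. -/
theorem OrthoFrame.contDiffOn_matrix (F F' : OrthoFrame g) :
    IsOpen {y : E × FModel (halfDim E) | y.1 ∈ (chartAt E F.center).target ∧
      (chartAt E F.center).symm y.1 ∈ F.dom ∩ F'.dom} ∧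
    ContDiffOn ℝ ∞ (fun y : E × FModel (halfDim E) =>
      (chartAt E F'.center) ((chartAt E F.center).symm y.1))
      {y | y.1 ∈ (chartAt E F.center).target ∧
        (chartAt E F.center).symm y.1 ∈ F.dom ∩ F'.dom} ∧
    ContDiffOn ℝ ∞ (fun y : E × FModel (halfDim E) =>
      F.trans F' ((chartAt E F.center).symm y.1) * cayley (inclF _ y.2) *
        F'.trans F ((chartAt E F.center).symm y.1))
      {y | y.1 ∈ (chartAt E F.center).target ∧
        (chartAt E F.center).symm y.1 ∈ F.dom ∩ F'.dom} := by
  set D : Set (E × FModel (halfDim E)) := {y | y.1 ∈ (chartAt E F.center).target ∧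
    (chartAt E F.center).symm y.1 ∈ F.dom ∩ F'.dom}
  have hfst : ContMDiff 𝓘(ℝ, E × FModel (halfDim E)) 𝓘(ℝ, E) ∞
      (Prod.fst : E × FModel (halfDim E) → E) := contDiff_fst.contMDiff
  have hx : ContMDiffOn 𝓘(ℝ, E × FModel (halfDim E)) 𝓘(ℝ, E) ∞
      (fun y : E × FModel (halfDim E) => (chartAt E F.center).symm y.1) D :=
    (contMDiffOn_chart_symm (I := 𝓘(ℝ, E)) (n := ∞) (x := F.center)).comp hfst.contMDiffOn
      fun y hy => hy.1
  refine ⟨?_, ?_, ?_⟩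
  · have ho := (chartAt E F.center).isOpen_inter_preimage_symm (F.isOpen_dom.inter F'.isOpen_dom)
    exact ho.preimage continuous_fst
  · rw [← contMDiffOn_iff_contDiffOn]
    exact (contMDiffOn_chart (I := 𝓘(ℝ, E)) (n := ∞) (x := F'.center)).comp hx
      fun y hy => F'.dom_subset hy.2.2
  · have h1 : ContDiffOn ℝ ∞ (fun y : E × FModel (halfDim E) =>
        F.trans F' ((chartAt E F.center).symm y.1)) D := by
      rw [← contMDiffOn_iff_contDiffOn]
      exact (F.contMDiffOn_trans F').comp hx fun y hy => hy.2
    have h2 : ContDiffOn ℝ ∞ (fun y : E × FModel (halfDim E) =>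
        F'.trans F ((chartAt E F.center).symm y.1)) D := by
      rw [← contMDiffOn_iff_contDiffOn]
      exact (F'.contMDiffOn_trans F).comp hx fun y hy => hy.2.symm
    have h3 : ContDiffOn ℝ ∞ (fun y : E × FModel (halfDim E) => cayley (inclF _ y.2)) D :=
      ((contDiff_cayley _).comp contDiff_snd).contDiffOn
    exact (h1.mul h3).mul h2

theorem OrthoFrame.chart_change (F F' : OrthoFrame g) (z₀ z₀' : TwistorSpace g) :
    IsOpen ((F.chart z₀).symm.trans (F'.chart z₀')).source ∧
    ContDiffOn ℝ ∞ ((F.chart z₀).symm.trans (F'.chart z₀'))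
      ((F.chart z₀).symm.trans (F'.chart z₀')).source := by
  obtain ⟨ho, hc, hK⟩ := F.contDiffOn_matrix F'
  set D : Set (E × FModel (halfDim E)) := {y | y.1 ∈ (chartAt E F.center).target ∧
    (chartAt E F.center).symm y.1 ∈ F.dom ∩ F'.dom}
  set K := fun y : E × FModel (halfDim E) =>
      F.trans F' ((chartAt E F.center).symm y.1) * cayley (inclF _ y.2) *
        F'.trans F ((chartAt E F.center).symm y.1)
  have hu : ContDiffOn ℝ ∞ (fun y => 1 - stdJ (halfDim E) * K y) D :=
    contDiffOn_const.sub (contDiffOn_const.mul hK)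
  have hopen : IsOpen (D ∩ (fun y => 1 - stdJ (halfDim E) * K y) ⁻¹' {a | IsUnit a}) :=
    hu.continuousOn.isOpen_inter_preimage ho Units.isOpen
  have hsrc : ((F.chart z₀).symm.trans (F'.chart z₀')).source =
      D ∩ (fun y => 1 - stdJ (halfDim E) * K y) ⁻¹' {a | IsUnit a} := by
    ext y
    rw [PartialEquiv.trans_source]
    constructor
    · rintro ⟨⟨h1, h2⟩, h3⟩
      change (F.chart z₀).symm y ∈ (F'.chart z₀').source at h3
      have e : (F.chart z₀).symm y =
          F.mkPoint _ h2 (cayley (inclF _ y.2)) (isOrthoCplx_cayley (inclF_mem y.2)) := dif_pos h2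
      rw [e] at h3
      exact ⟨⟨h1, h2, h3.1⟩, h3.2⟩
    · rintro ⟨⟨h1, h2, h3⟩, h4⟩
      refine ⟨⟨h1, h2⟩, ?_⟩
      change (F.chart z₀).symm y ∈ (F'.chart z₀').source
      have e : (F.chart z₀).symm y =
          F.mkPoint _ h2 (cayley (inclF _ y.2)) (isOrthoCplx_cayley (inclF_mem y.2)) := dif_pos h2
      rw [e]
      exact ⟨h3, h4⟩
  rw [hsrc]
  refine ⟨hopen, ?_⟩
  have h1 : ContDiffOn ℝ ∞ (fun y => Ring.inverse (1 - stdJ (halfDim E) * K y))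
      (D ∩ (fun y => 1 - stdJ (halfDim E) * K y) ⁻¹' {a | IsUnit a}) :=
    contDiffOn_ringInverse.comp (hu.mono Set.inter_subset_left) fun y hy => hy.2
  have h2 : ContDiffOn ℝ ∞ (fun y => (-(stdJ (halfDim E) * K y) - 1))
      (D ∩ (fun y => 1 - stdJ (halfDim E) * K y) ⁻¹' {a | IsUnit a}) :=
    ((contDiffOn_const.mul hK).neg.sub contDiffOn_const).mono Set.inter_subset_left
  have h3 : ContDiffOn ℝ ∞ (fun y => projF _ (cayleyInv (K y)))
      (D ∩ (fun y => 1 - stdJ (halfDim E) * K y) ⁻¹' {a | IsUnit a}) :=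
    (projF _).contDiff.comp_contDiffOn (h2.mul h1)
  refine ((hc.mono Set.inter_subset_left).prodMk h3).congr ?_
  rintro y ⟨⟨h1, h2, h3⟩, h4⟩
  change (F'.chart z₀') ((F.chart z₀).symm y) = _
  have e : (F.chart z₀).symm y =
      F.mkPoint _ h2 (cayley (inclF _ y.2)) (isOrthoCplx_cayley (inclF_mem y.2)) := dif_pos h2
  rw [e]
  rfl

end
section

variable {E : Type*} [NormedAddCommGroup E] [NormedSpace ℝ E] [FiniteDimensional ℝ E]
  {N : Type*} [TopologicalSpace N] [ChartedSpace E N] [IsManifold 𝓘(ℝ, E) ∞ N]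
  {g : RMetric E N}

theorem finrank_std (m : ℕ) : Module.finrank ℝ (Std m) = 2 * m := by
  rw [LinearEquiv.finrank_eq (Std.equiv m).toLinearEquiv]
  simp [two_mul]

theorem two_mul_halfDim {V : Type*} [AddCommGroup V] [Module ℝ V] [FiniteDimensional ℝ V]
    (J : V →ₗ[ℝ] V) (hJ : ∀ v, J (J v) = -v) :
    2 * (Module.finrank ℝ V / 2) = Module.finrank ℝ V := by
  have h : J ∘ₗ J = (-1 : ℝ) • LinearMap.id := by
    ext v; simp [hJ]
  have hd := congrArg LinearMap.det h
  rw [LinearMap.det_comp, LinearMap.det_smul, LinearMap.det_id, mul_one] at hd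
  rcases Nat.even_or_odd (Module.finrank ℝ V) with he | ho
  · obtain ⟨k, hk⟩ := he
    omega
  · rw [ho.neg_one_pow] at hd
    nlinarith [mul_self_nonneg (LinearMap.det J)]

/-- A complex structure `J` orthogonal for an inner product `b` becomes the standard one in a
suitable orthonormal basis. -/
theorem exists_adapted {V : Type*} [AddCommGroup V] [Module ℝ V] [FiniteDimensional ℝ V]
    (b : V →ₗ[ℝ] V →ₗ[ℝ] ℝ) (hs : ∀ u v, b u v = b v u) (hp : ∀ v, v ≠ 0 → 0 < b v v)
    (J : V →ₗ[ℝ] V) (hJ : ∀ v, J (J v) = -v) (hJb : ∀ u v, b (J u) (J v) = b u v)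
    (m : ℕ) (hm : 2 * m = Module.finrank ℝ V) :
    ∃ L : Std m →ₗ[ℝ] V, (∀ u v, b (L u) (L v) = ⟪u, v⟫) ∧ ∀ v, L (stdJ m v) = J (L v) := by
  obtain ⟨e, he⟩ := exists_unitary b hs hp J hJ hJb m hm.le
  let L : Std m →ₗ[ℝ] V :=
    { toFun := fun v => (∑ k, Std.equiv m v (Sum.inl k) • e k) +
        ∑ k, Std.equiv m v (Sum.inr k) • J (e k)
      map_add' := by
        intro u v
        simp only [map_add, PiLp.add_apply, add_smul, Finset.sum_add_distrib]; abel
      map_smul' := by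
        intro c v
        simp only [map_smul, PiLp.smul_apply, smul_eq_mul, mul_smul, Finset.smul_sum,
          RingHom.id_apply, smul_add] }
  have hL : ∀ v, L v = (∑ k, Std.equiv m v (Sum.inl k) • e k) +
        ∑ k, Std.equiv m v (Sum.inr k) • J (e k) := fun v => rfl
  refine ⟨L, fun u v => ?_, fun v => ?_⟩
  · have h1 : ∀ i j, b (e i) (e j) = (if i = j then 1 else 0) := fun i j => (he i j).1
    have h2 : ∀ i j, b (e i) (J (e j)) = 0 := fun i j => (he i j).2
    have h3 : ∀ i j, b (J (e i)) (e j) = 0 := fun i j => by rw [hs]; exact h2 j i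
    have h4 : ∀ i j, b (J (e i)) (J (e j)) = (if i = j then 1 else 0) := fun i j => by
      rw [hJb]; exact h1 i j
    rw [hL, hL, ← (Std.equiv m).inner_map_map u v]
    simp only [map_add, map_sum, map_smul, LinearMap.add_apply, LinearMap.sum_apply,
      LinearMap.smul_apply, h1, h2, h3, h4, smul_eq_mul, PiLp.inner_apply, Fintype.sum_sum_type]
    simp [mul_comm]
  · rw [hL, hL, map_add, map_sum, map_sum]
    simp only [stdJ_inl, stdJ_inr, map_smul, hJ, neg_smul, smul_neg]
    rw [add_comm]

theorem exists_frame (z : TwistorSpace g) :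
    ∃ F : OrthoFrame g, z.base ∈ F.dom ∧ F.read z.base z.str = stdJ (halfDim E) := by
  classical
  obtain ⟨p, J, hJ, hJg⟩ := z
  simp only
  set m := halfDim E with hm
  have hfinT : ∀ x : N, Module.finrank ℝ (Tan E x) = Module.finrank ℝ E := fun x => rfl
  have hfdT : ∀ x : N, FiniteDimensional ℝ (Tan E x) := fun x =>
    inferInstanceAs (FiniteDimensional ℝ E)
  have heven : 2 * m = Module.finrank ℝ E := two_mul_halfDim (V := Tan E p) J.toLinearMap hJ
  let bil : ∀ x : N, Tan E x →ₗ[ℝ] Tan E x →ₗ[ℝ] ℝ := fun x =>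
    LinearMap.mk₂ ℝ (fun u v => g.inner x u v) (by intros; simp) (by intros; simp)
      (by intros; simp) (by intros; simp)
  obtain ⟨L, hLg, hLJ⟩ := exists_adapted (V := Tan E p) (bil p) (g.symm p) (g.pos p)
    J.toLinearMap hJ hJg m heven
  replace hLg : ∀ u v, g.inner p (L u) (L v) = ⟪u, v⟫ := hLg
  replace hLJ : ∀ v, L (stdJ m v) = J (L v) := hLJ
  let e := trivializationAt E (fun x : N => TangentSpace 𝓘(ℝ, E) x) p
  have hpe : p ∈ e.baseSet := FiberBundle.mem_baseSet_trivializationAt' p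
  have hbase : e.baseSet = (chartAt E p).source := TangentBundle.trivializationAt_baseSet p
  let l : Std m →L[ℝ] E := (e.continuousLinearMapAt ℝ p) ∘L L.toContinuousLinearMap
  let M : ∀ x : N, Std m →L[ℝ] Tan E x := fun x => (e.symmL ℝ x) ∘L l
  have hMp : ∀ v, M p v = L v := fun v => e.symmL_continuousLinearMapAt hpe (L v)
  have hMs : ∀ {s : Set N} {f : N → Std m}, IsOpen s → s ⊆ e.baseSet →
      ContMDiffOn 𝓘(ℝ, E) 𝓘(ℝ, Std m) ∞ f s →
      ContMDiffOn 𝓘(ℝ, E) (𝓘(ℝ, E).prod 𝓘(ℝ, E)) ∞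
        (fun x => (⟨x, M x (f x)⟩ : TangentBundle 𝓘(ℝ, E) N)) s := by
    intro s f hso hs hf
    rw [e.contMDiffOn_section_iff hso hs]
    refine (l.contDiff.contMDiff.comp_contMDiffOn hf).congr fun x hx => ?_
    change (e ⟨x, e.symmL ℝ x (l (f x))⟩).2 = l (f x)
    rw [← e.continuousLinearMapAt_apply_of_mem ℝ (hs hx)]
    exact e.continuousLinearMapAt_symmL (hs hx) _
  have hMinj : ∀ x ∈ e.baseSet, ∀ v, M x v = 0 → v = 0 := by
    intro x hx v hv
    have h1 : l v = 0 := by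
      have := e.continuousLinearMapAt_symmL (R := ℝ) hx (l v)
      rw [← this]
      change e.continuousLinearMapAt ℝ x (M x v) = 0
      rw [hv, map_zero]
    have h2 : L v = 0 := by
      rw [← hMp v]
      change e.symmL ℝ p (l v) = 0
      rw [h1, map_zero]
    have h3 := hLg v v
    rw [h2] at h3
    simp only [map_zero] at h3
    exact inner_self_eq_zero.1 h3.symm
  -- the metric read in the frame `M`
  let b := stdOrthonormalBasis ℝ (Std m)
  let P : N → (Std m →L[ℝ] Std m) := fun x => LinearMap.toContinuousLinearMap
    { toFun := fun u => ∑ i, g.inner x (M x u) (M x (b i)) • b i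
      map_add' := fun u v => by
        simp only [map_add, add_apply, add_smul, Finset.sum_add_distrib]
      map_smul' := fun c u => by
        simp only [map_smul, smul_apply, smul_eq_mul, mul_smul,
          Finset.smul_sum, RingHom.id_apply] }
  have hP : ∀ x u v, ⟪P x u, v⟫ = g.inner x (M x u) (M x v) := by
    intro x u v
    change ⟪∑ i, g.inner x (M x u) (M x (b i)) • b i, v⟫ = _
    conv_rhs => rw [← b.sum_repr' v]
    simp only [sum_inner, map_sum, map_smul, real_inner_smul_left, smul_eq_mul, mul_comm]
  have hPsym : ∀ x, P x ∈ symEnd (Std m) := by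
    intro x u v
    rw [hP x u v, g.symm, ← hP x v u, real_inner_comm]
  have hPp : P p = 1 := by
    ext u
    refine ext_inner_right ℝ fun v => ?_
    rw [hP, hMp, hMp, hLg]; rfl
  have hPs : ContMDiffOn 𝓘(ℝ, E) 𝓘(ℝ, Std m →L[ℝ] Std m) ∞ P e.baseSet := by
    refine contMDiffOn_end fun u v => ?_
    simp only [hP]
    exact contMDiffOn_inner g (hMs e.open_baseSet subset_rfl contMDiffOn_const)
      (hMs e.open_baseSet subset_rfl contMDiffOn_const)
  obtain ⟨r, U, hUo, hU1, hr1, hr, hrU⟩ := exists_sqrt (Std m)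
  let W : Set N := e.baseSet ∩ P ⁻¹' U
  have hWo : IsOpen W := hPs.continuousOn.isOpen_inter_preimage e.open_baseSet hUo
  have hpW : p ∈ W := ⟨hpe, by change P p ∈ U; rwa [hPp]⟩
  have hPinj : ∀ x ∈ e.baseSet, ∀ v, P x v = 0 → v = 0 := by
    intro x hx v hv
    refine hMinj x hx v ?_
    by_contra hne
    have h1 := g.pos x _ hne
    rw [← hP, hv, inner_zero_left] at h1
    exact lt_irrefl _ h1
  have hSu : ∀ x ∈ W, IsUnit (r (P x)) := by
    intro x hx
    refine isUnit_of_forall_ne fun v hv => hPinj x hx.1 v ?_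
    rw [← (hrU (P x) hx.2 (hPsym x)).2]
    change r (P x) (r (P x) v) = 0
    rw [hv, map_zero]
  let T : N → (Std m →L[ℝ] Std m) := fun x => Ring.inverse (r (P x))
  have hT : ContMDiffOn 𝓘(ℝ, E) 𝓘(ℝ, Std m →L[ℝ] Std m) ∞ T W := by
    have h1 : ContMDiffOn 𝓘(ℝ, E) 𝓘(ℝ, Std m →L[ℝ] Std m) ∞ (fun x => r (P x)) W :=
      (hr.of_le le_top).contMDiffOn.comp (hPs.mono Set.inter_subset_left) fun x hx => hx.2
    exact contDiffOn_ringInverse.contMDiffOn.comp h1 fun x hx => hSu x hx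
  let B : ∀ x : N, Std m →L[ℝ] Tan E x := fun x => M x ∘L T x
  have hB : ∀ x ∈ W, ∀ u v, g.inner x (B x u) (B x v) = ⟪u, v⟫ := by
    intro x hx u v
    change g.inner x (M x (T x u)) (M x (T x v)) = _
    have h2 := hrU (P x) hx.2 (hPsym x)
    have h3 : ∀ w, r (P x) (T x w) = w := fun w => by
      have := congrArg (fun A : Std m →L[ℝ] Std m => A w) (Ring.mul_inverse_cancel _ (hSu x hx))
      simpa using this
    rw [← hP]
    have h4 : P x (T x u) = r (P x) (r (P x) (T x u)) :=
      congrArg (fun A : Std m →L[ℝ] Std m => A (T x u)) h2.2.symm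
    rw [h4, h3, h2.1, h3]
  have hBinj : ∀ x ∈ W, Function.Injective (B x) := by
    intro x hx
    refine (injective_iff_map_eq_zero (B x)).2 fun v hv => ?_
    have h := hB x hx v v
    rw [hv] at h
    simp only [map_zero] at h
    exact inner_self_eq_zero.1 h.symm
  have hdim : ∀ x : N, Module.finrank ℝ (Std m) = Module.finrank ℝ (Tan E x) := fun x => by
    rw [finrank_std, hfinT, heven]
  have hBbij : ∀ x ∈ W, Function.Bijective (B x) := fun x hx =>
    ⟨hBinj x hx, (LinearMap.injective_iff_surjective_of_finrank_eq_finrank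
      (f := (B x).toLinearMap) (hdim x)).1 (hBinj x hx)⟩
  have hT2 : ∀ x : N, T2Space (Tan E x) := fun x => inferInstanceAs (T2Space E)
  let fr : ∀ x : N, Std m ≃L[ℝ] Tan E x := fun x =>
    if hx : x ∈ W then
      LinearEquiv.toContinuousLinearEquiv (LinearEquiv.ofBijective (B x).toLinearMap (hBbij x hx))
    else
      LinearEquiv.toContinuousLinearEquiv (LinearEquiv.ofFinrankEq _ _ (hdim x))
  have hfr : ∀ x ∈ W, ∀ v, fr x v = B x v := by
    intro x hx v
    simp only [fr, dif_pos hx]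
    rfl
  refine ⟨⟨p, W, hWo, fun x hx => hbase ▸ hx.1, fr, fun v => ?_, fun x hx u v => ?_⟩, hpW, ?_⟩
  · refine (hMs hWo Set.inter_subset_left (hT.clm_apply contMDiffOn_const) :
      ContMDiffOn _ _ _ (fun x => (⟨x, M x (T x v)⟩ : TangentBundle 𝓘(ℝ, E) N)) W).congr
      fun x hx => ?_
    rw [hfr x hx]; rfl
  · rw [hfr x hx, hfr x hx, hB x hx]
  · have hTp : T p = 1 := by
      simp only [T, hPp, hr1, Ring.inverse_one]
    have hfp : ∀ v, fr p v = L v := by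
      intro v
      rw [hfr p hpW]
      change M p (T p v) = L v
      rw [hTp, one_apply_eq_self, hMp]
    ext v
    change (fr p).symm (J (fr p v)) = stdJ m v
    rw [hfp, ← hLJ, ← hfp, ContinuousLinearEquiv.symm_apply_apply]

/-- An orthonormal frame near a point of the twistor space. -/
def frameAt (z : TwistorSpace g) : OrthoFrame g := (exists_frame z).choose

theorem mem_chart_frameAt (z : TwistorSpace g) : z ∈ ((frameAt z).chart z).source := by
  obtain ⟨h1, h2⟩ := (exists_frame z).choose_spec
  refine ⟨h1, ?_⟩
  change IsUnit (1 - stdJ (halfDim E) * (frameAt z).read z.base z.str)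
  rw [show (frameAt z).read z.base z.str = stdJ (halfDim E) from h2, stdJ_mul_self, sub_neg_eq_add]
  refine ⟨⟨1 + 1, (1 / 2 : ℝ) • 1, ?_, ?_⟩, rfl⟩
  · rw [mul_smul_comm, mul_one, ← two_smul ℝ, smul_smul]; norm_num
  · rw [smul_mul_assoc, one_mul, ← two_smul ℝ, smul_smul]; norm_num

/-- The atlas of the twistor space: the charts given by all smooth local orthonormal frames. -/
def twistorCore (g : RMetric E N) :
    ChartedSpaceCore (E × FModel (halfDim E)) (TwistorSpace g) where
  atlas := {c | ∃ (F : OrthoFrame g) (z₀ : TwistorSpace g), c = F.chart z₀}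
  chartAt z := (frameAt z).chart z
  mem_chart_source := mem_chart_frameAt
  chart_mem_atlas z := ⟨_, _, rfl⟩
  open_source := by
    rintro _ _ ⟨F, z₀, rfl⟩ ⟨F', z₀', rfl⟩
    exact (F.chart_change F' z₀ z₀').1
  continuousOn_toFun := by
    rintro _ _ ⟨F, z₀, rfl⟩ ⟨F', z₀', rfl⟩
    exact (F.chart_change F' z₀ z₀').2.continuousOn

instance (g : RMetric E N) : TopologicalSpace (TwistorSpace g) :=
  (twistorCore g).toTopologicalSpace

instance (g : RMetric E N) : ChartedSpace (E × FModel (halfDim E)) (TwistorSpace g) :=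
  (twistorCore g).toChartedSpace

instance (g : RMetric E N) : IsManifold 𝓘(ℝ, E × FModel (halfDim E)) ∞ (TwistorSpace g) := by
  refine isManifold_of_contDiffOn _ _ _ ?_
  rintro e e' he he'
  have h : e ∈ ⋃ (c) (hc : c ∈ (twistorCore g).atlas),
      {(twistorCore g).openPartialHomeomorph c hc} := he
  have h' : e' ∈ ⋃ (c) (hc : c ∈ (twistorCore g).atlas),
      {(twistorCore g).openPartialHomeomorph c hc} := he'
  simp only [Set.mem_iUnion, Set.mem_singleton_iff] at h h'
  obtain ⟨c, hc, rfl⟩ := h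
  obtain ⟨c', hc', rfl⟩ := h'
  obtain ⟨F, z₀, rfl⟩ := hc
  obtain ⟨F', z₀', rfl⟩ := hc'
  have h := (F.chart_change F' z₀ z₀').2
  simp only [mfld_simps] at h ⊢
  exact h

end

/-! ### The Levi-Civita connection and totally geodesic maps -/

section

variable {E : Type*} [NormedAddCommGroup E] [NormedSpace ℝ E]
  {M : Type*} [TopologicalSpace M] [ChartedSpace E M] [IsManifold 𝓘(ℝ, E) ∞ M]
  {E' : Type*} [NormedAddCommGroup E'] [NormedSpace ℝ E']
  {M' : Type*} [TopologicalSpace M'] [ChartedSpace E' M'] [IsManifold 𝓘(ℝ, E') ∞ M']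

/-- The local trivialization of the tangent bundle given by the chart at `p`. Over `p` itself it is
the identity of `T_p M = E`. -/
abbrev tanTriv (E : Type*) [NormedAddCommGroup E] [NormedSpace ℝ E] {M : Type*}
    [TopologicalSpace M] [ChartedSpace E M] [IsManifold 𝓘(ℝ, E) ∞ M] (p : M) :
    Bundle.Trivialization E (Bundle.TotalSpace.proj (F := E) (E := fun x : M => Tan E x)) :=
  haveI : IsManifold 𝓘(ℝ, E) 1 M := .of_le (n := ∞) (by simp)
  trivializationAt E (fun x : M => Tan E x) p

/-- The coefficients `g_{ij}` of a metric in the chart at `p`, as a function on `E` with values in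
the bilinear forms on `E`. -/
def metricInChart (g : RMetric E M) (p : M) (y : E) : E →L[ℝ] E →L[ℝ] ℝ :=
  let q : M := (chartAt E p).symm y
  let G : E →L[ℝ] E →L[ℝ] ℝ := g.inner q
  let S : E →L[ℝ] E := (tanTriv E p).symmL ℝ q
  G.bilinearComp S S

/-- The Christoffel symbols at `p` of a metric in the chart at `p`: `christoffel g p u v` is the
vector `Γ(u, v)` with
`g(Γ(u, v), w) = (1 / 2) (∂_u g(v, w) + ∂_v g(u, w) - ∂_w g(u, v))`. -/
def christoffel (g : RMetric E M) (p : M) (u : E) : E →L[ℝ] E :=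
  let y := chartAt E p p
  let D : E →L[ℝ] E →L[ℝ] E →L[ℝ] ℝ := fderiv ℝ (metricInChart g p) y
  (metricInChart g p y).inverse ∘L ((1 / 2 : ℝ) • (D u + D.flip u - (D.flip u).flip))

/-- The derivative `(f^*∇)_X s` at `p` of a vector field `s` along `f : M → M'`, for the
Levi-Civita connection `∇` of a metric on `M'`: in the chart at `f p` it is
`∂_X s + Γ(f_* X, s)`. -/
def covDerivAlong (g' : RMetric E' M') (f : M → M') (s : ∀ x : M, Tan E' (f x)) (p : M)
    (X : Tan E p) : Tan E' (f p) :=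
  let c : E' := mfderiv 𝓘(ℝ, E) 𝓘(ℝ, E')
    (fun x => (tanTriv E' (f p)).continuousLinearMapAt ℝ (f x) (s x)) p X
  c + christoffel g' (f p) (mfderiv 𝓘(ℝ, E) 𝓘(ℝ, E') f p X) (s p)

/-- The derivative `∇_X Y` at `p` of a vector field `Y` for the Levi-Civita connection of `g`. -/
def leviCivita (g : RMetric E M) (Y : ∀ x : M, Tan E x) (p : M) (X : Tan E p) : Tan E p :=
  covDerivAlong g id Y p X

/-- The vector field `Y` is smooth at `p`. -/
def SmoothFieldAt (Y : ∀ x : M, Tan E x) (p : M) : Prop :=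
  ContMDiffAt 𝓘(ℝ, E) (𝓘(ℝ, E).prod 𝓘(ℝ, E)) ∞
    (fun x => (⟨x, Y x⟩ : TangentBundle 𝓘(ℝ, E) M)) p

/-- The second fundamental form `(f^*∇')_X (f_* Y) - f_* (∇_X Y)` at `p` of a map
`f : (M, g) → (M', g')`. -/
def secondFundamentalForm (g : RMetric E M) (g' : RMetric E' M') (f : M → M') (p : M)
    (X : Tan E p) (Y : ∀ x : M, Tan E x) : Tan E' (f p) :=
  covDerivAlong g' f (fun x => mfderiv 𝓘(ℝ, E) 𝓘(ℝ, E') f x (Y x)) p X -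
    mfderiv 𝓘(ℝ, E) 𝓘(ℝ, E') f p (leviCivita g Y p X)

/-- A map is totally geodesic if its second fundamental form vanishes. -/
def IsTotallyGeodesic (g : RMetric E M) (g' : RMetric E' M') (f : M → M') : Prop :=
  ∀ (p : M) (X : Tan E p) (Y : ∀ x : M, Tan E x), SmoothFieldAt Y p →
    secondFundamentalForm g g' f p X Y = 0

/-- A smooth embedding that pulls back the metric of the target to the metric of the source. -/
structure IsIsometricEmbedding (g : RMetric E M) (g' : RMetric E' M') (f : M → M') : Prop where
  isSmoothEmbedding : Manifold.IsSmoothEmbedding 𝓘(ℝ, E) 𝓘(ℝ, E') ∞ f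
  isometric : ∀ (p : M) (u v : Tan E p), g'.inner (f p) (mfderiv 𝓘(ℝ, E) 𝓘(ℝ, E') f p u)
    (mfderiv 𝓘(ℝ, E) 𝓘(ℝ, E') f p v) = g.inner p u v

end

/-! ### Kähler structures -/

section

variable {E : Type*} [NormedAddCommGroup E] [NormedSpace ℝ E]
  {N : Type*} [TopologicalSpace N] [ChartedSpace E N] [IsManifold 𝓘(ℝ, E) ∞ N]

/-- The pair `(g, J)` is an almost Hermitian structure: `J` is a smooth field of
`g`-orthogonal complex structures. -/
structure IsAlmostHermitian (g : RMetric E N) (J : ∀ x : N, Tan E x →L[ℝ] Tan E x) : Prop where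
  smooth : ContMDiff 𝓘(ℝ, E) (𝓘(ℝ, E).prod 𝓘(ℝ, E →L[ℝ] E)) ∞
    (fun x => Bundle.TotalSpace.mk' (E →L[ℝ] E)
      (E := fun x : N => Tan E x →L[ℝ] Tan E x) x (J x))
  sq : ∀ (x : N) (v : Tan E x), J x (J x v) = -v
  orth : ∀ (x : N) (u v : Tan E x), g.inner x (J x u) (J x v) = g.inner x u v

/-- The Lie bracket of vector fields. -/
abbrev bracket (X Y : ∀ x : N, Tan E x) : ∀ x : N, Tan E x :=
  VectorField.mlieBracket 𝓘(ℝ, E) X Y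

/-- The Nijenhuis tensor of `J` on the vector fields `X` and `Y`. -/
def nijenhuis (J : ∀ x : N, Tan E x →L[ℝ] Tan E x) (X Y : ∀ x : N, Tan E x) (p : N) : Tan E p :=
  bracket (fun x => J x (X x)) (fun x => J x (Y x)) p - J p (bracket (fun x => J x (X x)) Y p) -
    J p (bracket X (fun x => J x (Y x)) p) - bracket X Y p

/-- The form `ω(u, v) = g(J u, v)`. -/
def kaehlerForm (g : RMetric E N) (J : ∀ x : N, Tan E x →L[ℝ] Tan E x) (x : N)
    (u v : Tan E x) : ℝ :=
  g.inner x (J x u) v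

/-- The derivative at `p` of the function `f` in the direction `v`. -/
def dirDeriv (f : N → ℝ) (p : N) (v : Tan E p) : ℝ :=
  mfderiv 𝓘(ℝ, E) 𝓘(ℝ, ℝ) f p v

/-- The value at `p` of the exterior derivative of the two-form `α` on the vector fields
`X`, `Y`, `Z`. -/
def extDerivTwo (α : ∀ x : N, Tan E x → Tan E x → ℝ) (X Y Z : ∀ x : N, Tan E x) (p : N) : ℝ :=
  dirDeriv (fun x => α x (Y x) (Z x)) p (X p) + dirDeriv (fun x => α x (Z x) (X x)) p (Y p) +
    dirDeriv (fun x => α x (X x) (Y x)) p (Z p) -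
    α p (bracket X Y p) (Z p) - α p (bracket Y Z p) (X p) - α p (bracket Z X p) (Y p)

/-- `(N, g, J)` is Kähler: it is almost Hermitian, `J` is integrable and the Kähler form is
closed. -/
structure IsKaehler (g : RMetric E N) (J : ∀ x : N, Tan E x →L[ℝ] Tan E x) : Prop extends
    IsAlmostHermitian g J where
  integrable : ∀ (p : N) (X Y : ∀ x : N, Tan E x), SmoothFieldAt X p → SmoothFieldAt Y p →
    nijenhuis J X Y p = 0
  closed : ∀ (p : N) (X Y Z : ∀ x : N, Tan E x), SmoothFieldAt X p → SmoothFieldAt Y p →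
    SmoothFieldAt Z p → extDerivTwo (kaehlerForm g J) X Y Z p = 0

/-- An almost Hermitian structure as a section of the twistor space. -/
def IsAlmostHermitian.toTwistor {g : RMetric E N} {J : ∀ x : N, Tan E x →L[ℝ] Tan E x}
    (hJ : IsAlmostHermitian g J) (x : N) : TwistorSpace g :=
  ⟨x, J x, hJ.sq x, hJ.orth x⟩

end

/-! ### The metrics of the twistor space -/

section

variable {E : Type*} [NormedAddCommGroup E] [NormedSpace ℝ E] [FiniteDimensional ℝ E]
  {N : Type*} [TopologicalSpace N] [ChartedSpace E N] [IsManifold 𝓘(ℝ, E) ∞ N]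
  {g : RMetric E N}

/-- The tangent space of the twistor space. -/
abbrev TanTw (z : TwistorSpace g) : Type _ := Tan (E × FModel (halfDim E)) z

/-- The differential at `z` of the projection of the twistor space to `N`. -/
def dProj (z : TwistorSpace g) (ξ : TanTw z) : Tan E z.base :=
  mfderiv 𝓘(ℝ, E × FModel (halfDim E)) 𝓘(ℝ, E) (TwistorSpace.base (g := g)) z ξ

/-- The complex structure of a point `z` of the twistor space, read in the chart of `N` at `p`. -/
def strInChart (p : N) (z : TwistorSpace g) : E →L[ℝ] E :=
  (tanTriv E p).continuousLinearMapAt ℝ z.base ∘L z.str ∘L (tanTriv E p).symmL ℝ z.base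

/-- The vertical part of a tangent vector `ξ` of the twistor space at `z = (p, J)`, as an
endomorphism of `T_p N`: the covariant derivative in the direction `ξ` of the tautological field of
endomorphisms for the Levi-Civita connection, which is `∂_ξ J + [Γ(π_* ξ), J]` in the chart
at `p`. The horizontal space is its kernel, and on a vertical vector (one that is tangent to the
fibre, so that `π_* ξ = 0`) it is the endomorphism which that vector is. -/
def verticalPart (z : TwistorSpace g) (ξ : TanTw z) : Tan E z.base →L[ℝ] Tan E z.base :=
  let d : E →L[ℝ] E :=
    mfderiv 𝓘(ℝ, E × FModel (halfDim E)) 𝓘(ℝ, E →L[ℝ] E) (strInChart z.base) z ξ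
  let J : E →L[ℝ] E := z.str
  let Γ : E →L[ℝ] E := christoffel g z.base (dProj z ξ)
  d + Γ ∘L J - J ∘L Γ

/-- The inner product `G(A, B) = -(1 / n) Trace (A B)` of skew-symmetric endomorphisms,
`n` being the dimension. -/
def traceForm {x : N} (A B : Tan E x →L[ℝ] Tan E x) : ℝ :=
  -(1 / (Module.finrank ℝ E : ℝ)) * LinearMap.trace ℝ (Tan E x) (A ∘L B).toLinearMap

/-- The metric `h_t` of the twistor space: `π^* g` on the horizontal space, `t G` on the vertical
one, the two spaces being orthogonal. -/
def twistorForm (t : ℝ) (z : TwistorSpace g) (ξ η : TanTw z) : ℝ :=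
  g.inner z.base (dProj z ξ) (dProj z η) + t * traceForm (verticalPart z ξ) (verticalPart z η)

end

end Twistor

end

/-!
Write `∇ₓω(v, w) = g((∇ₓJ)v, w)`. This trilinear form is skew in its last two arguments; closedness
of `ω` makes its cyclic sum vanish, and integrability of `J` relates its values under `J`. Together
these force `∇J = 0`: the section `J` of the twistor space is horizontal, so that `J^* h_t = g`.

Locally the metric of the twistor space has Kaluza-Klein form `h = π^* g + B(φ, φ)`, where `φ` is
the vertical part of a tangent vector in an orthonormal frame. If `π ∘ f = id` and `φ ∘ df = 0`,
then differentiating these two identities once more in Koszul's formula for `h` shows that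
`D²f(u, v) + Γʰ(df u, df v) - df(Γᵍ(u, v))` is `h`-orthogonal to every vector.
-/

open scoped Manifold ContDiff Topology RealInnerProductSpace

noncomputable section

namespace Twistor

section ModelDeriv

variable {E : Type*} [NormedAddCommGroup E] [NormedSpace ℝ E]
  {M : Type*} [TopologicalSpace M] [ChartedSpace E M]
  {E' : Type*} [NormedAddCommGroup E'] [NormedSpace ℝ E']
  {M' : Type*} [TopologicalSpace M'] [ChartedSpace E' M']
  {G : Type*} [NormedAddCommGroup G] [NormedSpace ℝ G]

/-- The differential `mfderiv`, retyped as a map between the model spaces, with which all tangent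
spaces coincide by definition. This keeps dependent types out of computations. -/
def modelDeriv (E E' : Type*) [NormedAddCommGroup E] [NormedSpace ℝ E] [NormedAddCommGroup E']
    [NormedSpace ℝ E'] {M M' : Type*} [TopologicalSpace M] [ChartedSpace E M]
    [TopologicalSpace M'] [ChartedSpace E' M'] (f : M → M') (x : M) : E →L[ℝ] E' :=
  mfderiv 𝓘(ℝ, E) 𝓘(ℝ, E') f x

theorem modelDeriv_eq_of_hasMFDerivAt {f : M → M'} {x : M} {A : E →L[ℝ] E'}
    (hf : HasMFDerivAt 𝓘(ℝ, E) 𝓘(ℝ, E') f x A) : modelDeriv E E' f x = A :=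
  hf.mfderiv

theorem modelDeriv_congr {f f' : M → M'} {x : M} (h : f =ᶠ[𝓝 x] f') :
    modelDeriv E E' f x = modelDeriv E E' f' x :=
  h.mfderiv_eq

theorem modelDeriv_comp {E'' : Type*} [NormedAddCommGroup E''] [NormedSpace ℝ E''] {M'' : Type*}
    [TopologicalSpace M''] [ChartedSpace E'' M''] {f : M → M'} {f' : M' → M''} {x : M}
    (hf' : MDifferentiableAt 𝓘(ℝ, E') 𝓘(ℝ, E'') f' (f x))
    (hf : MDifferentiableAt 𝓘(ℝ, E) 𝓘(ℝ, E') f x) :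
    modelDeriv E E'' (fun x => f' (f x)) x = modelDeriv E' E'' f' (f x) ∘L modelDeriv E E' f x :=
  mfderiv_comp x hf' hf

theorem modelDeriv_eq_fderiv (f : E → E') (x : E) : modelDeriv E E' f x = fderiv ℝ f x :=
  mfderiv_eq_fderiv

theorem modelDeriv_eq_fderiv_chart {f : M → G} {p : M}
    (hf : MDifferentiableAt 𝓘(ℝ, E) 𝓘(ℝ, G) f p) :
    modelDeriv E G f p = fderiv ℝ (fun y => f ((chartAt E p).symm y)) (chartAt E p p) := by
  refine hf.mfderiv.trans ?_
  simp only [writtenInExtChartAt, mfld_simps, fderivWithin_univ]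
  rfl

theorem modelDeriv_const (c : G) (x : M) : modelDeriv E G (fun _ : M => c) x = 0 :=
  modelDeriv_eq_of_hasMFDerivAt (hasMFDerivAt_const c x)

theorem modelDeriv_prodMk {G' : Type*} [NormedAddCommGroup G'] [NormedSpace ℝ G'] {f : M → G}
    {f' : M → G'} {x : M} (hf : MDifferentiableAt 𝓘(ℝ, E) 𝓘(ℝ, G) f x)
    (hf' : MDifferentiableAt 𝓘(ℝ, E) 𝓘(ℝ, G') f' x) :
    modelDeriv E (G × G') (fun x => (f x, f' x)) x =
      (modelDeriv E G f x).prod (modelDeriv E G' f' x) :=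
  modelDeriv_eq_of_hasMFDerivAt
    ⟨hf.continuousAt.prodMk hf'.continuousAt, hf.hasMFDerivAt.2.prodMk hf'.hasMFDerivAt.2⟩

end ModelDeriv

section ChartCalculus

variable {E : Type*} [NormedAddCommGroup E] [NormedSpace ℝ E]
  {M : Type*} [TopologicalSpace M] [ChartedSpace E M] [IsManifold 𝓘(ℝ, E) ∞ M]
  {E' : Type*} [NormedAddCommGroup E'] [NormedSpace ℝ E']
  {M' : Type*} [TopologicalSpace M'] [ChartedSpace E' M']
  {G : Type*} [NormedAddCommGroup G] [NormedSpace ℝ G]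

/-- The coordinates, in the chart at `p`, of a tangent vector at `x`. -/
def toChart (E : Type*) [NormedAddCommGroup E] [NormedSpace ℝ E] {M : Type*} [TopologicalSpace M]
    [ChartedSpace E M] [IsManifold 𝓘(ℝ, E) ∞ M] (p x : M) : E →L[ℝ] E :=
  (tanTriv E p).continuousLinearMapAt ℝ x

/-- The tangent vector at `x` with given coordinates in the chart at `p`. -/
def ofChart (E : Type*) [NormedAddCommGroup E] [NormedSpace ℝ E] {M : Type*} [TopologicalSpace M]
    [ChartedSpace E M] [IsManifold 𝓘(ℝ, E) ∞ M] (p x : M) : E →L[ℝ] E :=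
  (tanTriv E p).symmL ℝ x

theorem toChart_eq_modelDeriv {p x : M} (hx : x ∈ (chartAt E p).source) :
    toChart E p x = modelDeriv E E (chartAt E p) x :=
  TangentBundle.continuousLinearMapAt_trivializationAt hx

theorem ofChart_eq_modelDeriv {p x : M} (hx : x ∈ (chartAt E p).source) :
    ofChart E p x = modelDeriv E E (chartAt E p).symm (chartAt E p x) := by
  refine (TangentBundle.symmL_trivializationAt hx).trans ?_
  rw [modelDeriv, ← mfderivWithin_univ, modelWithCornersSelf_coe, Set.range_id]
  rfl

theorem ofChart_toChart {p x : M} (hx : x ∈ (chartAt E p).source) (v : E) :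
    ofChart E p x (toChart E p x v) = v :=
  (tanTriv E p).symmL_continuousLinearMapAt (R := ℝ)
    (show x ∈ (tanTriv E p).baseSet from hx) v

theorem toChart_ofChart {p x : M} (hx : x ∈ (chartAt E p).source) (v : E) :
    toChart E p x (ofChart E p x v) = v :=
  (tanTriv E p).continuousLinearMapAt_symmL (R := ℝ)
    (show x ∈ (tanTriv E p).baseSet from hx) v

theorem toChart_self (p : M) (v : E) : toChart E p p v = v := by
  rw [toChart, TangentBundle.continuousLinearMapAt_trivializationAt_eq_core (mem_chart_source E p)]
  exact (tangentBundleCore 𝓘(ℝ, E) M).coordChange_self _ _ (mem_chart_source E p) v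

theorem ofChart_self (p : M) (v : E) : ofChart E p p v = v := by
  conv_lhs => rw [← toChart_self p v]
  exact ofChart_toChart (mem_chart_source E p) v

theorem mdifferentiableAt_chartAt {p x : M} (hx : x ∈ (chartAt E p).source) :
    MDifferentiableAt 𝓘(ℝ, E) 𝓘(ℝ, E) (chartAt E p) x :=
  (mdifferentiable_chart p).mdifferentiableAt hx

theorem mdifferentiableAt_comp_chart_symm {f : M → M'} {p x : M} (hx : x ∈ (chartAt E p).source)
    (hf : MDifferentiableAt 𝓘(ℝ, E) 𝓘(ℝ, E') f x) :
    MDifferentiableAt 𝓘(ℝ, E) 𝓘(ℝ, E') (fun y => f ((chartAt E p).symm y)) (chartAt E p x) := by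
  refine MDifferentiableAt.comp (I' := 𝓘(ℝ, E)) (chartAt E p x) (g := f)
    (f := (chartAt E p).symm) ?_
    ((mdifferentiable_chart p).mdifferentiableAt_symm ((chartAt E p).map_source hx))
  rwa [(chartAt E p).left_inv hx]

theorem differentiableAt_comp_chart_symm {f : M → G} {p x : M} (hx : x ∈ (chartAt E p).source)
    (hf : MDifferentiableAt 𝓘(ℝ, E) 𝓘(ℝ, G) f x) :
    DifferentiableAt ℝ (fun y => f ((chartAt E p).symm y)) (chartAt E p x) :=
  mdifferentiableAt_iff_differentiableAt.1 (mdifferentiableAt_comp_chart_symm hx hf)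

theorem modelDeriv_clm_apply {A : M → E' →L[ℝ] G} {v : M → E'} {p : M}
    (hA : MDifferentiableAt 𝓘(ℝ, E) 𝓘(ℝ, E' →L[ℝ] G) A p)
    (hv : MDifferentiableAt 𝓘(ℝ, E) 𝓘(ℝ, E') v p) (u : E) :
    modelDeriv E G (fun x => A x (v x)) p u =
      A p (modelDeriv E E' v p u) + modelDeriv E (E' →L[ℝ] G) A p u (v p) := by
  have hp := mem_chart_source E p
  rw [modelDeriv_eq_fderiv_chart (hA.clm_apply hv), modelDeriv_eq_fderiv_chart hA,
    modelDeriv_eq_fderiv_chart hv, ((differentiableAt_comp_chart_symm hp hA).hasFDerivAt.clm_apply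
      (differentiableAt_comp_chart_symm hp hv).hasFDerivAt).fderiv]
  simp [(chartAt E p).left_inv hp]

theorem modelDeriv_clm_apply_const {A : M → E' →L[ℝ] G} {p : M}
    (hA : MDifferentiableAt 𝓘(ℝ, E) 𝓘(ℝ, E' →L[ℝ] G) A p) (v : E') (u : E) :
    modelDeriv E G (fun x => A x v) p u = modelDeriv E (E' →L[ℝ] G) A p u v := by
  rw [modelDeriv_clm_apply hA mdifferentiableAt_const, modelDeriv_const, zero_apply, map_zero,
    zero_add]

theorem modelDeriv_const_clm_apply (L : E' →L[ℝ] G) {v : M → E'} {p : M}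
    (hv : MDifferentiableAt 𝓘(ℝ, E) 𝓘(ℝ, E') v p) (u : E) :
    modelDeriv E G (fun x => L (v x)) p u = L (modelDeriv E E' v p u) := by
  rw [modelDeriv_clm_apply (A := fun _ => L) mdifferentiableAt_const hv, modelDeriv_const,
    zero_apply, zero_apply, add_zero]

theorem modelDeriv_clm_comp {G' : Type*} [NormedAddCommGroup G'] [NormedSpace ℝ G']
    {A : M → E' →L[ℝ] G} {B : M → G' →L[ℝ] E'} {p : M}
    (hA : MDifferentiableAt 𝓘(ℝ, E) 𝓘(ℝ, E' →L[ℝ] G) A p)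
    (hB : MDifferentiableAt 𝓘(ℝ, E) 𝓘(ℝ, G' →L[ℝ] E') B p) (u : E) :
    modelDeriv E (G' →L[ℝ] G) (fun x => A x ∘L B x) p u =
      A p ∘L modelDeriv E (G' →L[ℝ] E') B p u + modelDeriv E (E' →L[ℝ] G) A p u ∘L B p := by
  have hp := mem_chart_source E p
  rw [modelDeriv_eq_fderiv_chart (hA.clm_comp hB), modelDeriv_eq_fderiv_chart hA,
    modelDeriv_eq_fderiv_chart hB, ((differentiableAt_comp_chart_symm hp hA).hasFDerivAt.clm_comp
      (differentiableAt_comp_chart_symm hp hB).hasFDerivAt).fderiv]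
  simp [(chartAt E p).left_inv hp]

theorem contMDiffAt_comp_chart_symm {f : M → M'} {p x : M} (hx : x ∈ (chartAt E p).source)
    (hf : ContMDiffAt 𝓘(ℝ, E) 𝓘(ℝ, E') ∞ f x) :
    ContMDiffAt 𝓘(ℝ, E) 𝓘(ℝ, E') ∞ (fun y => f ((chartAt E p).symm y)) (chartAt E p x) := by
  refine ContMDiffAt.comp (I' := 𝓘(ℝ, E)) (chartAt E p x) (g := f) (f := (chartAt E p).symm) ?_ ?_
  · rwa [(chartAt E p).left_inv hx]
  · exact (contMDiffOn_chart_symm (I := 𝓘(ℝ, E)) (n := ∞) (x := p)).contMDiffAt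
      ((chartAt E p).open_target.mem_nhds ((chartAt E p).map_source hx))

theorem contMDiffOn_comp_chart_iff {f : E → G} {p : M} :
    ContMDiffOn 𝓘(ℝ, E) 𝓘(ℝ, G) ∞ (fun x => f (chartAt E p x)) (chartAt E p).source ↔
      ContDiffOn ℝ ∞ f (chartAt E p).target := by
  rw [← contMDiffOn_iff_contDiffOn]
  constructor
  · intro h
    refine (h.comp (contMDiffOn_chart_symm (I := 𝓘(ℝ, E)) (n := ∞) (x := p))
      fun y hy => (chartAt E p).map_target hy).congr fun y hy => ?_
    rw [Function.comp_apply, (chartAt E p).right_inv hy]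
  · intro h
    exact h.comp (contMDiffOn_chart (I := 𝓘(ℝ, E)) (n := ∞) (x := p))
      fun x hx => (chartAt E p).map_source hx

theorem modelDeriv_comp_ofChart {f : M → M'} {p x : M} (hx : x ∈ (chartAt E p).source)
    (hf : MDifferentiableAt 𝓘(ℝ, E) 𝓘(ℝ, E') f x) :
    modelDeriv E E' f x ∘L ofChart E p x =
      modelDeriv E E' (fun y => f ((chartAt E p).symm y)) (chartAt E p x) := by
  have hleft := (chartAt E p).left_inv hx
  rw [modelDeriv_comp (f := (chartAt E p).symm) (f' := f) (x := chartAt E p x) (by rwa [hleft])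
    ((mdifferentiable_chart p).mdifferentiableAt_symm ((chartAt E p).map_source hx)),
    hleft, ofChart_eq_modelDeriv hx]

theorem toChart_comp_modelDeriv_comp_ofChart [IsManifold 𝓘(ℝ, E') ∞ M'] {f : M → M'} {p x : M}
    {p' : M'} (hx : x ∈ (chartAt E p).source) (hfx : f x ∈ (chartAt E' p').source)
    (hf : MDifferentiableAt 𝓘(ℝ, E) 𝓘(ℝ, E') f x) :
    toChart E' p' (f x) ∘L modelDeriv E E' f x ∘L ofChart E p x =
      fderiv ℝ (fun y => chartAt E' p' (f ((chartAt E p).symm y))) (chartAt E p x) := by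
  have hleft := (chartAt E p).left_inv hx
  rw [modelDeriv_comp_ofChart hx hf, ← modelDeriv_eq_fderiv, modelDeriv_comp (f' := chartAt E' p')
    (f := fun y => f ((chartAt E p).symm y)) (by rw [hleft]; exact mdifferentiableAt_chartAt hfx)
    (mdifferentiableAt_comp_chart_symm hx hf), hleft, toChart_eq_modelDeriv hfx]

theorem contMDiffOn_field_iff_toChart {Y : ∀ x : M, Tan E x} {s : Set M} (hs : IsOpen s) {p : M}
    (hsp : s ⊆ (chartAt E p).source) :
    ContMDiffOn 𝓘(ℝ, E) (𝓘(ℝ, E).prod 𝓘(ℝ, E)) ∞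
      (fun x => (⟨x, Y x⟩ : TangentBundle 𝓘(ℝ, E) M)) s ↔
    ContMDiffOn 𝓘(ℝ, E) 𝓘(ℝ, E) ∞ (fun x => toChart E p x (Y x)) s := by
  have hb : s ⊆ (tanTriv E p).baseSet := hsp
  rw [(tanTriv E p).contMDiffOn_section_iff hs hb]
  exact contMDiffOn_congr fun x hx =>
    ((tanTriv E p).continuousLinearMapAt_apply_of_mem ℝ (hb hx) (Y x)).symm

theorem smoothFieldAt_iff_toChart {Y : ∀ x : M, Tan E x} {p x : M}
    (hx : x ∈ (chartAt E p).source) :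
    SmoothFieldAt Y x ↔ ContMDiffAt 𝓘(ℝ, E) 𝓘(ℝ, E) ∞ (fun x => toChart E p x (Y x)) x := by
  have hb : x ∈ (tanTriv E p).baseSet := hx
  have hcoord : (fun x => toChart E p x (Y x)) =ᶠ[𝓝 x] fun x => (tanTriv E p ⟨x, Y x⟩).2 := by
    filter_upwards [(tanTriv E p).open_baseSet.mem_nhds hb] with y hy
    exact (tanTriv E p).continuousLinearMapAt_apply_of_mem ℝ hy (Y y)
  rw [SmoothFieldAt, hcoord.contMDiffAt_iff]
  exact (tanTriv E p).contMDiffAt_section_iff hb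

theorem SmoothFieldAt.mdifferentiableAt_toChart {Y : ∀ x : M, Tan E x} {p : M}
    (hY : SmoothFieldAt Y p) :
    MDifferentiableAt 𝓘(ℝ, E) 𝓘(ℝ, E) (fun x => toChart E p x (Y x)) p :=
  ((smoothFieldAt_iff_toChart (mem_chart_source E p)).1 hY).mdifferentiableAt (by simp)

theorem smoothFieldAt_ofChart {p x : M} (hx : x ∈ (chartAt E p).source) (w : E) :
    SmoothFieldAt (fun x : M => (ofChart E p x w : Tan E x)) x := by
  refine (smoothFieldAt_iff_toChart hx).2 ?_
  refine (contMDiffAt_const (c := w)).congr_of_eventuallyEq ?_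
  filter_upwards [(chartAt E p).open_source.mem_nhds hx] with y hy
  exact toChart_ofChart hy w

theorem exists_smoothFieldAt_eq (p : M) (v : E) : ∃ X : M → E, SmoothFieldAt X p ∧ X p = v :=
  ⟨fun x => ofChart E p x v, smoothFieldAt_ofChart (mem_chart_source E p) v, ofChart_self p v⟩

end ChartCalculus

section PositiveForm

variable {E : Type*} [NormedAddCommGroup E] [NormedSpace ℝ E]

theorem isVonNBounded_of_isCoercive {b : E →L[ℝ] E →L[ℝ] ℝ} (hb : IsCoercive b) :
    Bornology.IsVonNBounded ℝ {v : E | b v v < 1} := by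
  obtain ⟨c, hc, hcb⟩ := hb
  rw [NormedSpace.isVonNBounded_iff, isBounded_iff_forall_norm_le]
  refine ⟨Real.sqrt (1 / c), fun v hv => Real.le_sqrt_of_sq_le ?_⟩
  rw [le_div_iff₀ hc]
  have hlt : b v v < 1 := hv
  linarith [hcb v]

variable [FiniteDimensional ℝ E]

theorem isInvertible_of_pos {b : E →L[ℝ] E →L[ℝ] ℝ} (hb : ∀ v, v ≠ 0 → 0 < b v v) :
    b.IsInvertible := by
  have hinj : Function.Injective b := by
    refine (injective_iff_map_eq_zero b).2 fun v hv => ?_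
    by_contra hne
    simpa [hv] using hb v hne
  have hdim : Module.finrank ℝ E = Module.finrank ℝ (E →L[ℝ] ℝ) := by
    rw [← (LinearMap.toContinuousLinearMap (𝕜 := ℝ) (E := E) (F' := ℝ)).finrank_eq]
    exact (Subspace.dual_finrank_eq (K := ℝ) (V := E)).symm
  let e := (LinearEquiv.ofInjectiveOfFinrankEq b.toLinearMap hinj hdim).toContinuousLinearEquiv
  exact ⟨e, by ext; rfl⟩

theorem isCoercive_of_pos {b : E →L[ℝ] E →L[ℝ] ℝ} (hb : ∀ v, v ≠ 0 → 0 < b v v) :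
    IsCoercive b := by
  rcases subsingleton_or_nontrivial E with hE | hE
  · exact ⟨1, one_pos, fun v => by simp [Subsingleton.elim v 0]⟩
  obtain ⟨v₀, hv₀, hmin⟩ := (isCompact_sphere (0 : E) 1).exists_isMinOn
    (NormedSpace.sphere_nonempty.2 zero_le_one)
    (show Continuous fun v : E => b v v by fun_prop).continuousOn
  have hv₀0 : v₀ ≠ 0 := by
    rintro rfl
    exact absurd hv₀ (by simp)
  refine ⟨b v₀ v₀, hb v₀ hv₀0, fun v => ?_⟩
  rcases eq_or_ne v 0 with rfl | hv
  · simp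
  have hn : ‖v‖ ≠ 0 := norm_ne_zero_iff.2 hv
  have hle : b v₀ v₀ ≤ b (‖v‖⁻¹ • v) (‖v‖⁻¹ • v) := hmin (by simp [norm_smul, hn])
  simp only [map_smul, smul_apply, smul_eq_mul] at hle
  calc b v₀ v₀ * ‖v‖ * ‖v‖ ≤ (‖v‖⁻¹ * (‖v‖⁻¹ * b v v)) * ‖v‖ * ‖v‖ := by gcongr
    _ = b v v := by field_simp

end PositiveForm

section MetricInChart

variable {E : Type*} [NormedAddCommGroup E] [NormedSpace ℝ E]
  {M : Type*} [TopologicalSpace M] [ChartedSpace E M] [IsManifold 𝓘(ℝ, E) ∞ M]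

/-- The metric at `x` as a bilinear form on the model space, to which `T_x M` is equal by
definition. -/
def metricAt (g : RMetric E M) (x : M) : E →L[ℝ] E →L[ℝ] ℝ := g.inner x

theorem metricAt_symm (g : RMetric E M) (x : M) (u v : E) :
    metricAt g x u v = metricAt g x v u := g.symm x u v

theorem metricAt_pos (g : RMetric E M) (x : M) {v : E} (hv : v ≠ 0) : 0 < metricAt g x v v :=
  g.pos x v hv

/-- The coefficients, in the chart at `p`, of a field of bilinear forms on the tangent spaces. -/
def formInChart (b : M → E →L[ℝ] E →L[ℝ] ℝ) (p : M) (y : E) : E →L[ℝ] E →L[ℝ] ℝ :=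
  (b ((chartAt E p).symm y)).bilinearComp (ofChart E p ((chartAt E p).symm y))
    (ofChart E p ((chartAt E p).symm y))

theorem formInChart_apply (b : M → E →L[ℝ] E →L[ℝ] ℝ) (p : M) (y u v : E) :
    formInChart b p y u v = b ((chartAt E p).symm y) (ofChart E p ((chartAt E p).symm y) u)
      (ofChart E p ((chartAt E p).symm y) v) := rfl

theorem metricInChart_eq_formInChart (g : RMetric E M) (p : M) :
    metricInChart g p = formInChart (metricAt g) p := rfl

theorem trivializationAt_form_eq_formInChart (b : M → E →L[ℝ] E →L[ℝ] ℝ) {p x : M}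
    (hx : x ∈ (chartAt E p).source) :
    (trivializationAt (E →L[ℝ] E →L[ℝ] ℝ) (fun x : M => Tan E x →L[ℝ] Tan E x →L[ℝ] ℝ) p
      ⟨x, b x⟩).2 = formInChart b p (chartAt E p x) := by
  have hof : ∀ u : E, ofChart E p x u = (tanTriv E p).symm x u := fun u =>
    (tanTriv E p).symmL_apply (R := ℝ) hx u
  ext u v
  refine (inCoordinates_apply_eq₂ (F₁ := E) (F₂ := E) (F₃ := ℝ) (E₁ := fun x : M => Tan E x)
    (E₂ := fun x : M => Tan E x) (E₃ := Bundle.Trivial M ℝ) (ϕ := b x) (v := u) (w := v)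
    (x₀ := p) (x := x) hx hx (by simp)).trans ?_
  rw [formInChart_apply, (chartAt E p).left_inv hx,
    Bundle.Trivialization.coe_linearMapAt_of_mem _ (by simp), hof, hof]
  rfl

theorem contMDiff_form_iff (b : M → E →L[ℝ] E →L[ℝ] ℝ) :
    ContMDiff 𝓘(ℝ, E) (𝓘(ℝ, E).prod 𝓘(ℝ, E →L[ℝ] E →L[ℝ] ℝ)) ∞
      (fun x => Bundle.TotalSpace.mk' (E →L[ℝ] E →L[ℝ] ℝ)
        (E := fun x : M => Tan E x →L[ℝ] Tan E x →L[ℝ] ℝ) x (b x)) ↔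
    ∀ p : M, ContDiffOn ℝ ∞ (formInChart b p) (chartAt E p).target := by
  have : ∀ x : M, ContinuousAdd (Tan E x →L[ℝ] ℝ) := fun _ =>
    inferInstanceAs (ContinuousAdd (E →L[ℝ] ℝ))
  have : ∀ x : M, ContinuousSMul ℝ (Tan E x →L[ℝ] ℝ) := fun _ =>
    inferInstanceAs (ContinuousSMul ℝ (E →L[ℝ] ℝ))
  have hchart : ∀ p : M, (ContMDiffOn 𝓘(ℝ, E) (𝓘(ℝ, E).prod 𝓘(ℝ, E →L[ℝ] E →L[ℝ] ℝ)) ∞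
      (fun x => Bundle.TotalSpace.mk' (E →L[ℝ] E →L[ℝ] ℝ)
        (E := fun x : M => Tan E x →L[ℝ] Tan E x →L[ℝ] ℝ) x (b x)) (chartAt E p).source ↔
      ContDiffOn ℝ ∞ (formInChart b p) (chartAt E p).target) := by
    intro p
    let e := trivializationAt (E →L[ℝ] E →L[ℝ] ℝ)
      (fun x : M => Tan E x →L[ℝ] Tan E x →L[ℝ] ℝ) p
    have hb : e.baseSet = (chartAt E p).source := by simp [e]
    rw [← contMDiffOn_comp_chart_iff]
    refine (e.contMDiffOn_section_iff (chartAt E p).open_source hb.ge).trans ?_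
    exact contMDiffOn_congr fun x hx => trivializationAt_form_eq_formInChart b hx
  refine ⟨fun h p => (hchart p).1 h.contMDiffOn, fun h x => ?_⟩
  exact ((hchart x).2 (h x)).contMDiffAt
    ((chartAt E x).open_source.mem_nhds (mem_chart_source E x))

variable (g : RMetric E M)

theorem contDiffOn_metricInChart (p : M) :
    ContDiffOn ℝ ∞ (metricInChart g p) (chartAt E p).target :=
  (contMDiff_form_iff (metricAt g)).1 g.contMDiff p

theorem contDiffAt_metricInChart (p : M) :
    ContDiffAt ℝ ∞ (metricInChart g p) (chartAt E p p) :=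
  (contDiffOn_metricInChart g p).contDiffAt
    ((chartAt E p).open_target.mem_nhds (mem_chart_target E p))

theorem metricInChart_toChart {p x : M} (hx : x ∈ (chartAt E p).source) (u v : E) :
    metricInChart g p (chartAt E p x) (toChart E p x u) (toChart E p x v) = metricAt g x u v := by
  rw [metricInChart_eq_formInChart, formInChart_apply, (chartAt E p).left_inv hx,
    ofChart_toChart hx, ofChart_toChart hx]

theorem metricInChart_self (p : M) :
    metricInChart g p (chartAt E p p) = metricAt g p := by
  ext u v
  simpa only [toChart_self] using metricInChart_toChart g (mem_chart_source E p) u v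

theorem metricInChart_symm (p : M) (y u v : E) :
    metricInChart g p y u v = metricInChart g p y v u := by
  rw [metricInChart_eq_formInChart, formInChart_apply, formInChart_apply, metricAt_symm]

theorem fderiv_metricInChart_symm (p : M) (a u v : E) :
    fderiv ℝ (metricInChart g p) (chartAt E p p) a u v =
      fderiv ℝ (metricInChart g p) (chartAt E p p) a v u := by
  have hd : DifferentiableAt ℝ (metricInChart g p) (chartAt E p p) :=
    (contDiffAt_metricInChart g p).differentiableAt (by simp)
  have hcoeff : ∀ u v : E, fderiv ℝ (fun y => metricInChart g p y u v) (chartAt E p p) a =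
      fderiv ℝ (metricInChart g p) (chartAt E p p) a u v := by
    intro u v
    rw [((hd.hasFDerivAt.clm_apply (hasFDerivAt_const u _)).clm_apply
      (hasFDerivAt_const v _)).fderiv]
    simp
  rw [← hcoeff, ← hcoeff]
  simp only [metricInChart_symm g p _ u v]

variable [FiniteDimensional ℝ E]

theorem inner_christoffel (p : M) (u v w : E) :
    metricInChart g p (chartAt E p p) (christoffel g p u v) w =
      (1 / 2) * (fderiv ℝ (metricInChart g p) (chartAt E p p) u v w +
        fderiv ℝ (metricInChart g p) (chartAt E p p) v u w -
        fderiv ℝ (metricInChart g p) (chartAt E p p) w u v) := by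
  have hinv : (metricInChart g p (chartAt E p p)).IsInvertible := by
    rw [metricInChart_self]
    exact isInvertible_of_pos fun v hv => metricAt_pos g p hv
  simp only [christoffel, ContinuousLinearMap.comp_apply]
  rw [hinv.self_apply_inverse]
  simp

theorem christoffel_symm (p : M) (u v : E) : christoffel g p u v = christoffel g p v u := by
  rw [← sub_eq_zero]
  by_contra hne
  have hpos := metricAt_pos g p hne
  rw [← metricInChart_self, map_sub (metricInChart g p _), sub_apply, inner_christoffel,
    inner_christoffel, fderiv_metricInChart_symm g p _ u v] at hpos
  linarith

theorem fderiv_metricInChart_eq_christoffel (p : M) (a u v : E) :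
    fderiv ℝ (metricInChart g p) (chartAt E p p) a u v =
      metricAt g p (christoffel g p a u) v + metricAt g p u (christoffel g p a v) := by
  rw [metricAt_symm g p u, ← metricInChart_self, inner_christoffel, inner_christoffel]
  linarith [fderiv_metricInChart_symm g p a u v, fderiv_metricInChart_symm g p u a v,
    fderiv_metricInChart_symm g p v a u]

/-- The Christoffel symbols as a continuous bilinear map. -/
def christoffelL (p : M) : E →L[ℝ] E →L[ℝ] E :=
  LinearMap.toContinuousLinearMap
    { toFun := fun u => christoffel g p u
      map_add' := fun a b => by simp only [christoffel, map_add]; ext; simp; module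
      map_smul' := fun a b => by simp only [christoffel, map_smul]; ext; simp; module }

end MetricInChart

/-! ### The Levi-Civita connection in model coordinates -/

section Bracket

variable {E : Type*} [NormedAddCommGroup E] [NormedSpace ℝ E]
  {M : Type*} [TopologicalSpace M] [ChartedSpace E M] [IsManifold 𝓘(ℝ, E) ∞ M]

theorem lieBracketWithin_univ_of_eventuallyEq {V W V' W' : E → E} {y : E} (hV : V =ᶠ[𝓝 y] V')
    (hW : W =ᶠ[𝓝 y] W') : VectorField.lieBracketWithin ℝ V W Set.univ y =
      fderiv ℝ W' y (V' y) - fderiv ℝ V' y (W' y) := by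
  rw [VectorField.lieBracketWithin_univ, VectorField.lieBracket, hV.fderiv_eq, hW.fderiv_eq,
    hV.eq_of_nhds, hW.eq_of_nhds]

theorem mpullbackWithin_chart_symm {p : M} (V : M → E) {y : E} (hy : y ∈ (chartAt E p).target) :
    VectorField.mpullbackWithin 𝓘(ℝ, E) 𝓘(ℝ, E) (chartAt E p).symm V Set.univ y =
      toChart E p ((chartAt E p).symm y) (V ((chartAt E p).symm y)) := by
  have hx := (chartAt E p).map_target hy
  have hderiv : modelDeriv E E (chartAt E p).symm y = ofChart E p ((chartAt E p).symm y) := by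
    rw [ofChart_eq_modelDeriv hx, (chartAt E p).right_inv hy]
  have hinv : (ofChart E p ((chartAt E p).symm y)).inverse =
      toChart E p ((chartAt E p).symm y) := by
    refine ContinuousLinearMap.inverse_eq ?_ ?_
    · ext v; exact ofChart_toChart hx v
    · ext v; exact toChart_ofChart hx v
  rw [← hinv, ← hderiv]
  simp only [VectorField.mpullbackWithin, mfderivWithin_univ]
  rfl

/-- The Lie bracket of vector fields, as a vector of the model space. -/
def modelBracket (X Y : M → E) (p : M) : E := bracket (N := M) X Y p

theorem modelBracket_eq_modelDeriv_sub {X Y : M → E} {p : M}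
    (hX : MDifferentiableAt 𝓘(ℝ, E) 𝓘(ℝ, E) (fun x => toChart E p x (X x)) p)
    (hY : MDifferentiableAt 𝓘(ℝ, E) 𝓘(ℝ, E) (fun x => toChart E p x (Y x)) p) :
    modelBracket X Y p = modelDeriv E E (fun x => toChart E p x (Y x)) p (X p) -
      modelDeriv E E (fun x => toChart E p x (X x)) p (Y p) := by
  let pull (V : M → E) (y : E) : E :=
    VectorField.mpullbackWithin 𝓘(ℝ, E) 𝓘(ℝ, E) (chartAt E p).symm V Set.univ y
  have hpull (V : M → E) : pull V =ᶠ[𝓝 (chartAt E p p)]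
      fun y => toChart E p ((chartAt E p).symm y) (V ((chartAt E p).symm y)) := by
    filter_upwards [(chartAt E p).open_target.mem_nhds (mem_chart_target E p)] with y hy
    exact mpullbackWithin_chart_symm V hy
  have hchart : modelDeriv E E (chartAt E p) p = ContinuousLinearMap.id ℝ E := by
    ext v
    rw [← toChart_eq_modelDeriv (mem_chart_source E p)]
    exact toChart_self p v
  have hbracket : modelBracket X Y p = (modelDeriv E E (chartAt E p) p).inverse
      (VectorField.lieBracketWithin ℝ (pull X) (pull Y) Set.univ (chartAt E p p)) := by
    simp only [modelBracket, bracket, VectorField.mlieBracket, VectorField.mlieBracketWithin,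
      VectorField.mpullback, mfld_simps]
    rfl
  rw [hbracket, hchart, ContinuousLinearMap.inverse_id,
    lieBracketWithin_univ_of_eventuallyEq (hpull X) (hpull Y), modelDeriv_eq_fderiv_chart hX,
    modelDeriv_eq_fderiv_chart hY]
  simp only [(chartAt E p).left_inv (mem_chart_source E p), toChart_self]
  rfl

theorem modelDeriv_metricAt (g : RMetric E M) {X Y : M → E} {p : M}
    (hX : MDifferentiableAt 𝓘(ℝ, E) 𝓘(ℝ, E) (fun x => toChart E p x (X x)) p)
    (hY : MDifferentiableAt 𝓘(ℝ, E) 𝓘(ℝ, E) (fun x => toChart E p x (Y x)) p) (u : E) :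
    modelDeriv E ℝ (fun x => metricAt g x (X x) (Y x)) p u =
      fderiv ℝ (metricInChart g p) (chartAt E p p) u (X p) (Y p) +
      metricAt g p (modelDeriv E E (fun x => toChart E p x (X x)) p u) (Y p) +
      metricAt g p (X p) (modelDeriv E E (fun x => toChart E p x (Y x)) p u) := by
  have hp := mem_chart_source E p
  have hg : MDifferentiableAt 𝓘(ℝ, E) 𝓘(ℝ, E →L[ℝ] E →L[ℝ] ℝ) (metricInChart g p)
      (chartAt E p p) :=
    ((contDiffAt_metricInChart g p).differentiableAt (by simp)).mdifferentiableAt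
  have hchart := mdifferentiableAt_chartAt hp
  have hgp : MDifferentiableAt 𝓘(ℝ, E) 𝓘(ℝ, E →L[ℝ] E →L[ℝ] ℝ)
      (fun x => metricInChart g p (chartAt E p x)) p :=
    hg.comp (I' := 𝓘(ℝ, E)) p hchart
  have hcoord : (fun x => metricAt g x (X x) (Y x)) =ᶠ[𝓝 p]
      fun x => metricInChart g p (chartAt E p x) (toChart E p x (X x)) (toChart E p x (Y x)) := by
    filter_upwards [(chartAt E p).open_source.mem_nhds hp] with x hx
    exact (metricInChart_toChart g hx _ _).symm
  rw [modelDeriv_congr hcoord, modelDeriv_clm_apply (hgp.clm_apply hX) hY,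
    modelDeriv_clm_apply hgp hX, modelDeriv_comp hg hchart, modelDeriv_eq_fderiv,
    ← toChart_eq_modelDeriv hp]
  simp only [ContinuousLinearMap.comp_apply, add_apply, toChart_self, metricInChart_self]
  ring

end Bracket

section CovDeriv

variable {E : Type*} [NormedAddCommGroup E] [NormedSpace ℝ E]
  {M : Type*} [TopologicalSpace M] [ChartedSpace E M] [IsManifold 𝓘(ℝ, E) ∞ M]

/-- The covariant derivative `∇_u X` at `p`, as a vector of the model space. -/
def covDeriv (g : RMetric E M) (X : M → E) (p : M) (u : E) : E :=
  modelDeriv E E (fun x => toChart E p x (X x)) p u + christoffel g p u (X p)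

variable (g : RMetric E M) {X Y : M → E} {p : M}

theorem covDeriv_neg (u : E) : covDeriv g (fun x => -X x) p u = -covDeriv g X p u := by
  have hneg : modelDeriv E E (fun x => -toChart E p x (X x)) p =
      -modelDeriv E E (fun x => toChart E p x (X x)) p := mfderiv_neg
  simp only [covDeriv, map_neg, hneg, neg_apply, neg_add]

variable [FiniteDimensional ℝ E]

theorem modelBracket_eq_covDeriv_sub
    (hX : MDifferentiableAt 𝓘(ℝ, E) 𝓘(ℝ, E) (fun x => toChart E p x (X x)) p)
    (hY : MDifferentiableAt 𝓘(ℝ, E) 𝓘(ℝ, E) (fun x => toChart E p x (Y x)) p) :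
    modelBracket X Y p = covDeriv g Y p (X p) - covDeriv g X p (Y p) := by
  rw [modelBracket_eq_modelDeriv_sub hX hY, covDeriv, covDeriv, christoffel_symm g p (Y p)]
  abel

theorem modelDeriv_metricAt_eq_covDeriv
    (hX : MDifferentiableAt 𝓘(ℝ, E) 𝓘(ℝ, E) (fun x => toChart E p x (X x)) p)
    (hY : MDifferentiableAt 𝓘(ℝ, E) 𝓘(ℝ, E) (fun x => toChart E p x (Y x)) p) (u : E) :
    modelDeriv E ℝ (fun x => metricAt g x (X x) (Y x)) p u =
      metricAt g p (covDeriv g X p u) (Y p) + metricAt g p (X p) (covDeriv g Y p u) := by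
  rw [modelDeriv_metricAt g hX hY, fderiv_metricInChart_eq_christoffel, covDeriv, covDeriv]
  simp only [map_add, add_apply]
  ring

end CovDeriv

/-! ### The complex structure of a Kähler manifold is parallel -/

section KaehlerParallel

variable {E : Type*} [NormedAddCommGroup E] [NormedSpace ℝ E]
  {N : Type*} [TopologicalSpace N] [ChartedSpace E N]

/-- The value at `x` of a field of endomorphisms, as an endomorphism of the model space. -/
def endAt (J : ∀ x : N, Tan E x →L[ℝ] Tan E x) (x : N) : E →L[ℝ] E := J x

variable [IsManifold 𝓘(ℝ, E) ∞ N]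

/-- A field of endomorphisms in the chart at `p`. -/
def endInChart (J : ∀ x : N, Tan E x →L[ℝ] Tan E x) (p x : N) : E →L[ℝ] E :=
  toChart E p x ∘L endAt J x ∘L ofChart E p x

/-- The covariant derivative `∇_u J` at `p` of a field of endomorphisms. -/
def covDerivEnd (g : RMetric E N) (J : ∀ x : N, Tan E x →L[ℝ] Tan E x) (p : N) (u : E) :
    E →L[ℝ] E :=
  modelDeriv E (E →L[ℝ] E) (endInChart J p) p u + christoffel g p u ∘L endAt J p -
    endAt J p ∘L christoffel g p u

variable {g : RMetric E N} {J : ∀ x : N, Tan E x →L[ℝ] Tan E x} {p : N}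

theorem endInChart_self (J : ∀ x : N, Tan E x →L[ℝ] Tan E x) (p : N) :
    endInChart J p p = endAt J p := by
  ext v
  simp only [endInChart, ContinuousLinearMap.comp_apply, toChart_self, ofChart_self]

theorem endInChart_toChart {x : N} (hx : x ∈ (chartAt E p).source) (v : E) :
    endInChart J p x (toChart E p x v) = toChart E p x (endAt J x v) := by
  simp only [endInChart, ContinuousLinearMap.comp_apply, ofChart_toChart hx]

theorem toChart_endAt_eventuallyEq (J : ∀ x : N, Tan E x →L[ℝ] Tan E x) (p : N) (X : N → E) :
    (fun x => toChart E p x (endAt J x (X x))) =ᶠ[𝓝 p]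
      fun x => endInChart J p x (toChart E p x (X x)) := by
  filter_upwards [(chartAt E p).open_source.mem_nhds (mem_chart_source E p)] with x hx
  exact (endInChart_toChart hx _).symm

theorem mdifferentiableAt_toChart_endAt {X : N → E}
    (hJ : MDifferentiableAt 𝓘(ℝ, E) 𝓘(ℝ, E →L[ℝ] E) (endInChart J p) p)
    (hX : MDifferentiableAt 𝓘(ℝ, E) 𝓘(ℝ, E) (fun x => toChart E p x (X x)) p) :
    MDifferentiableAt 𝓘(ℝ, E) 𝓘(ℝ, E) (fun x => toChart E p x (endAt J x (X x))) p :=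
  (hJ.clm_apply hX).congr_of_eventuallyEq (toChart_endAt_eventuallyEq J p X)

theorem covDeriv_endAt (g : RMetric E N) {X : N → E}
    (hJ : MDifferentiableAt 𝓘(ℝ, E) 𝓘(ℝ, E →L[ℝ] E) (endInChart J p) p)
    (hX : MDifferentiableAt 𝓘(ℝ, E) 𝓘(ℝ, E) (fun x => toChart E p x (X x)) p) (u : E) :
    covDeriv g (fun x => endAt J x (X x)) p u =
      covDerivEnd g J p u (X p) + endAt J p (covDeriv g X p u) := by
  rw [covDeriv, modelDeriv_congr (toChart_endAt_eventuallyEq J p X), modelDeriv_clm_apply hJ hX,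
    covDeriv, covDerivEnd, endInChart_self, toChart_self]
  simp only [map_add, add_apply, sub_apply, ContinuousLinearMap.comp_apply]
  abel

theorem endAt_endAt (hJ : IsAlmostHermitian g J) (x : N) (v : E) :
    endAt J x (endAt J x v) = -v := hJ.sq x v

theorem metricAt_endAt_left (hJ : IsAlmostHermitian g J) (x : N) (u v : E) :
    metricAt g x (endAt J x u) v = -metricAt g x u (endAt J x v) := by
  have horth : metricAt g x (endAt J x u) (endAt J x (endAt J x v)) =
      metricAt g x u (endAt J x v) := hJ.orth x u _
  rw [endAt_endAt hJ, map_neg] at horth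
  linarith

theorem metricAt_endAt_swap (hJ : IsAlmostHermitian g J) (x : N) (u v : E) :
    metricAt g x (endAt J x u) v = -metricAt g x (endAt J x v) u := by
  rw [metricAt_endAt_left hJ, metricAt_symm]

theorem IsAlmostHermitian.contMDiffAt_endInChart (hJ : IsAlmostHermitian g J) (p : N) :
    ContMDiffAt 𝓘(ℝ, E) 𝓘(ℝ, E →L[ℝ] E) ∞ (endInChart J p) p :=
  ((contMDiffAt_hom_bundle _).1 (hJ.smooth p)).2

theorem IsAlmostHermitian.mdifferentiableAt_endInChart (hJ : IsAlmostHermitian g J) (p : N) :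
    MDifferentiableAt 𝓘(ℝ, E) 𝓘(ℝ, E →L[ℝ] E) (endInChart J p) p :=
  (hJ.contMDiffAt_endInChart p).mdifferentiableAt (by simp)

theorem IsAlmostHermitian.covDerivEnd_endAt (hJ : IsAlmostHermitian g J) (p : N) (u v : E) :
    covDerivEnd g J p u (endAt J p v) = -endAt J p (covDerivEnd g J p u v) := by
  obtain ⟨X, hX, rfl⟩ := exists_smoothFieldAt_eq p v
  have hJp := hJ.mdifferentiableAt_endInChart p
  have hXp := hX.mdifferentiableAt_toChart
  have hsq := covDeriv_endAt g hJp (mdifferentiableAt_toChart_endAt hJp hXp) u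
  simp only [endAt_endAt hJ] at hsq
  rw [covDeriv_neg, covDeriv_endAt g hJp hXp, map_add, endAt_endAt hJ, ← add_assoc] at hsq
  exact eq_neg_of_add_eq_zero_left (right_eq_add.1 hsq)

variable [FiniteDimensional ℝ E]

theorem IsAlmostHermitian.metricAt_covDerivEnd_left (hJ : IsAlmostHermitian g J) (p : N)
    (u v w : E) :
    metricAt g p (covDerivEnd g J p u v) w = -metricAt g p (covDerivEnd g J p u w) v := by
  obtain ⟨X, hX, rfl⟩ := exists_smoothFieldAt_eq p v
  obtain ⟨Y, hY, rfl⟩ := exists_smoothFieldAt_eq p w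
  have hJp := hJ.mdifferentiableAt_endInChart p
  have hXp := hX.mdifferentiableAt_toChart
  have hYp := hY.mdifferentiableAt_toChart
  have hskew : modelDeriv E ℝ (fun x => metricAt g x (endAt J x (X x)) (Y x)) p u =
      -modelDeriv E ℝ (fun x => metricAt g x (endAt J x (Y x)) (X x)) p u := by
    simp only [metricAt_endAt_left hJ _ (X _), metricAt_symm g _ (X _)]
    exact DFunLike.congr_fun mfderiv_neg u
  rw [modelDeriv_metricAt_eq_covDeriv g (mdifferentiableAt_toChart_endAt hJp hXp) hYp,
    modelDeriv_metricAt_eq_covDeriv g (mdifferentiableAt_toChart_endAt hJp hYp) hXp,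
    covDeriv_endAt g hJp hXp, covDeriv_endAt g hJp hYp] at hskew
  simp only [map_add, add_apply] at hskew
  linarith [metricAt_endAt_swap hJ p (X p) (covDeriv g Y p u),
    metricAt_endAt_swap hJ p (Y p) (covDeriv g X p u)]

theorem IsKaehler.metricAt_covDerivEnd_cyclic (hJ : IsKaehler g J) (p : N) (u v w : E) :
    metricAt g p (covDerivEnd g J p u v) w + metricAt g p (covDerivEnd g J p v w) u +
      metricAt g p (covDerivEnd g J p w u) v = 0 := by
  obtain ⟨X, hX, rfl⟩ := exists_smoothFieldAt_eq p u
  obtain ⟨Y, hY, rfl⟩ := exists_smoothFieldAt_eq p v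
  obtain ⟨Z, hZ, rfl⟩ := exists_smoothFieldAt_eq p w
  have hJp := hJ.mdifferentiableAt_endInChart p
  have hXp := hX.mdifferentiableAt_toChart
  have hYp := hY.mdifferentiableAt_toChart
  have hZp := hZ.mdifferentiableAt_toChart
  have hclosed : modelDeriv E ℝ (fun x => metricAt g x (endAt J x (Y x)) (Z x)) p (X p) +
      modelDeriv E ℝ (fun x => metricAt g x (endAt J x (Z x)) (X x)) p (Y p) +
      modelDeriv E ℝ (fun x => metricAt g x (endAt J x (X x)) (Y x)) p (Z p) -
      metricAt g p (endAt J p (modelBracket X Y p)) (Z p) -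
      metricAt g p (endAt J p (modelBracket Y Z p)) (X p) -
      metricAt g p (endAt J p (modelBracket Z X p)) (Y p) = 0 := hJ.closed p X Y Z hX hY hZ
  rw [modelBracket_eq_covDeriv_sub g hXp hYp, modelBracket_eq_covDeriv_sub g hYp hZp,
    modelBracket_eq_covDeriv_sub g hZp hXp,
    modelDeriv_metricAt_eq_covDeriv g (mdifferentiableAt_toChart_endAt hJp hYp) hZp,
    modelDeriv_metricAt_eq_covDeriv g (mdifferentiableAt_toChart_endAt hJp hZp) hXp,
    modelDeriv_metricAt_eq_covDeriv g (mdifferentiableAt_toChart_endAt hJp hXp) hYp,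
    covDeriv_endAt g hJp hXp, covDeriv_endAt g hJp hYp, covDeriv_endAt g hJp hZp] at hclosed
  simp only [map_add, map_sub, add_apply, sub_apply] at hclosed
  linarith [metricAt_endAt_swap hJ.toIsAlmostHermitian p (X p) (covDeriv g Y p (Z p)),
    metricAt_endAt_swap hJ.toIsAlmostHermitian p (Y p) (covDeriv g Z p (X p)),
    metricAt_endAt_swap hJ.toIsAlmostHermitian p (Z p) (covDeriv g X p (Y p))]

theorem IsKaehler.covDerivEnd_integrable (hJ : IsKaehler g J) (p : N) (u v : E) :
    covDerivEnd g J p (endAt J p u) v - covDerivEnd g J p (endAt J p v) u +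
      endAt J p (covDerivEnd g J p v u) - endAt J p (covDerivEnd g J p u v) = 0 := by
  obtain ⟨X, hX, rfl⟩ := exists_smoothFieldAt_eq p u
  obtain ⟨Y, hY, rfl⟩ := exists_smoothFieldAt_eq p v
  have hJp := hJ.mdifferentiableAt_endInChart p
  have hXp := hX.mdifferentiableAt_toChart
  have hYp := hY.mdifferentiableAt_toChart
  have hJX := mdifferentiableAt_toChart_endAt hJp hXp
  have hJY := mdifferentiableAt_toChart_endAt hJp hYp
  have hnijenhuis : modelBracket (fun x => endAt J x (X x)) (fun x => endAt J x (Y x)) p -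
      endAt J p (modelBracket (fun x => endAt J x (X x)) Y p) -
      endAt J p (modelBracket X (fun x => endAt J x (Y x)) p) - modelBracket X Y p = 0 :=
    hJ.integrable p X Y hX hY
  rw [modelBracket_eq_covDeriv_sub g hJX hJY, modelBracket_eq_covDeriv_sub g hJX hYp,
    modelBracket_eq_covDeriv_sub g hXp hJY, modelBracket_eq_covDeriv_sub g hXp hYp] at hnijenhuis
  simp only [covDeriv_endAt g hJp hXp, covDeriv_endAt g hJp hYp, map_add, map_sub,
    endAt_endAt hJ.toIsAlmostHermitian] at hnijenhuis
  rw [← hnijenhuis]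
  abel

/-- `Φ u v w` stands for `g((∇_u J) v, w)`. -/
theorem eq_zero_of_closed_of_integrable {V : Type*} (J : V → V) (Φ : V → V → V → ℝ)
    (hJ : ∀ u v w, Φ u v (J (J w)) = -Φ u v w)
    (hskew : ∀ u v w, Φ u v w = -Φ u w v)
    (hanti : ∀ u v w, Φ u (J v) w = Φ u v (J w))
    (hclosed : ∀ u v w, Φ u v w + Φ v w u + Φ w u v = 0)
    (hintegrable : ∀ u v w, Φ (J u) v w - Φ (J v) u w - Φ v u (J w) + Φ u v (J w) = 0)
    (u v w : V) : Φ u v w = 0 := by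
  have hclosedJ := hclosed u (J v) (J w)
  have hintJ := hintegrable v w (J u)
  have huvw := hanti u v (J w)
  rw [hJ, hJ] at hintJ
  rw [hJ] at huvw
  linarith [hclosed u v w, hanti (J v) w u, hanti (J w) u v, hskew (J w) (J u) v, hskew w u v]

theorem IsKaehler.covDerivEnd_eq_zero (hJ : IsKaehler g J) (p : N) (u : E) :
    covDerivEnd g J p u = 0 := by
  have hah := hJ.toIsAlmostHermitian
  have hform (v w : E) : metricAt g p (covDerivEnd g J p u v) w = 0 := by
    refine eq_zero_of_closed_of_integrable (endAt J p)
      (fun u v w => metricAt g p (covDerivEnd g J p u v) w) (fun u v w => ?_)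
      (hah.metricAt_covDerivEnd_left p) (fun u v w => ?_) (hJ.metricAt_covDerivEnd_cyclic p)
      (fun u v w => ?_) u v w
    · rw [endAt_endAt hah, map_neg]
    · rw [hah.covDerivEnd_endAt, map_neg, neg_apply, metricAt_endAt_left hah, neg_neg]
    · have hintegrable := DFunLike.congr_fun
        (congrArg (metricAt g p) (hJ.covDerivEnd_integrable p u v)) w
      simp only [map_add, map_sub, map_zero, zero_apply, add_apply, sub_apply,
        metricAt_endAt_left hah] at hintegrable
      linarith
  ext v
  by_contra hne
  exact (metricAt_pos g p hne).ne' (hform v _)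

end KaehlerParallel

/-! ### Horizontal sections for metrics of Kaluza-Klein type -/

section Horizontal

variable {V W S : Type*} [NormedAddCommGroup V] [NormedSpace ℝ V] [NormedAddCommGroup W]
  [NormedSpace ℝ W] [NormedAddCommGroup S] [NormedSpace ℝ S]

theorem fderiv_apply_fderiv_add_apply_fderiv_fderiv {f : V → W} {ψ : W → W →L[ℝ] S} {x₀ b : V}
    {c : S} (hf : ContDiffAt ℝ 2 f x₀) (hψ : DifferentiableAt ℝ ψ (f x₀))
    (hψf : ∀ᶠ x in 𝓝 x₀, ψ (f x) (fderiv ℝ f x b) = c) (a : V) :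
    fderiv ℝ ψ (f x₀) (fderiv ℝ f x₀ a) (fderiv ℝ f x₀ b) +
      ψ (f x₀) (fderiv ℝ (fderiv ℝ f) x₀ a b) = 0 := by
  have hf' : DifferentiableAt ℝ (fderiv ℝ f) x₀ :=
    (hf.fderiv_right (m := 1) (by norm_num)).differentiableAt (by simp)
  have hderiv := (hψ.hasFDerivAt.comp x₀ (hf.differentiableAt (by simp)).hasFDerivAt).clm_apply
    (hf'.hasFDerivAt.clm_apply (hasFDerivAt_const b x₀))
  have hconst : (fun x => (ψ ∘ f) x (fderiv ℝ f x b)) =ᶠ[𝓝 x₀] fun _ => c := hψf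
  have hzero := DFunLike.congr_fun
    (hderiv.fderiv.symm.trans (hconst.fderiv_eq.trans (fderiv_const_apply c))) a
  simpa [add_comm] using hzero

theorem eventually_fderiv_fderiv_of_eventually_leftInverse {f : V → W} {π : W → V} {x₀ : V}
    (hf : ContDiffAt ℝ 2 f x₀) (hπ : ContDiffAt ℝ 2 π (f x₀)) (hπf : ∀ᶠ x in 𝓝 x₀, π (f x) = x) :
    ∀ᶠ x in 𝓝 x₀, ∀ a, fderiv ℝ π (f x) (fderiv ℝ f x a) = a := by
  have hfd : ∀ᶠ x in 𝓝 x₀, DifferentiableAt ℝ f x :=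
    (hf.eventually (by simp)).mono fun x hx => hx.differentiableAt (by simp)
  have hπd : ∀ᶠ x in 𝓝 x₀, DifferentiableAt ℝ π (f x) :=
    hf.continuousAt.eventually
      ((hπ.eventually (by simp)).mono fun y hy => hy.differentiableAt (by simp))
  filter_upwards [hπf.eventually_nhds, hfd, hπd] with x hid hfx hπx a
  have hchain := (hπx.hasFDerivAt.comp x hfx.hasFDerivAt).fderiv
  have hid' : π ∘ f =ᶠ[𝓝 x] id := hid
  rw [hid'.fderiv_eq, fderiv_id] at hchain
  exact (DFunLike.congr_fun hchain a).symm

theorem fderiv_kaluzaKlein {π : W → V} {g : V → V →L[ℝ] V →L[ℝ] ℝ} {h : W → W →L[ℝ] W →L[ℝ] ℝ}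
    {φ : W → W →L[ℝ] S} {B : S →L[ℝ] S →L[ℝ] ℝ} {y₀ : W} (hπ : ContDiffAt ℝ 2 π y₀)
    (hg : DifferentiableAt ℝ g (π y₀)) (hφ : DifferentiableAt ℝ φ y₀)
    (hhd : DifferentiableAt ℝ h y₀)
    (hh : ∀ᶠ y in 𝓝 y₀, ∀ w w', h y w w' =
      g (π y) (fderiv ℝ π y w) (fderiv ℝ π y w') + B (φ y w) (φ y w'))
    (a b c : W) : fderiv ℝ h y₀ a b c =
      fderiv ℝ g (π y₀) (fderiv ℝ π y₀ a) (fderiv ℝ π y₀ b) (fderiv ℝ π y₀ c) +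
      g (π y₀) (fderiv ℝ (fderiv ℝ π) y₀ a b) (fderiv ℝ π y₀ c) +
      g (π y₀) (fderiv ℝ π y₀ b) (fderiv ℝ (fderiv ℝ π) y₀ a c) +
      B (fderiv ℝ φ y₀ a b) (φ y₀ c) + B (φ y₀ b) (fderiv ℝ φ y₀ a c) := by
  have hπ' : DifferentiableAt ℝ (fderiv ℝ π) y₀ :=
    (hπ.fderiv_right (m := 1) (by norm_num)).differentiableAt (by simp)
  have hπv (v : W) : HasFDerivAt (fun y => fderiv ℝ π y v) _ y₀ :=
    hπ'.hasFDerivAt.clm_apply (hasFDerivAt_const v _)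
  have hφv (v : W) : HasFDerivAt (fun y => φ y v) _ y₀ :=
    hφ.hasFDerivAt.clm_apply (hasFDerivAt_const v _)
  have hcoeff := (hhd.hasFDerivAt.clm_apply (hasFDerivAt_const b _)).clm_apply
    (hasFDerivAt_const c _)
  have hπg : HasFDerivAt (fun y => g (π y)) (fderiv ℝ g (π y₀) ∘L fderiv ℝ π y₀) y₀ :=
    HasFDerivAt.comp (g := g) y₀ hg.hasFDerivAt (hπ.differentiableAt (by simp)).hasFDerivAt
  have hsum := ((hπg.clm_apply (hπv b)).clm_apply (hπv c)).add
    (((B.hasFDerivAt (x := φ y₀ b)).comp y₀ (hφv b)).clm_apply (hφv c))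
  have heq : (fun y => h y b c) =ᶠ[𝓝 y₀] _ := hh.mono fun y hy => hy b c
  have hderiv := DFunLike.congr_fun
    (hcoeff.fderiv.symm.trans (heq.fderiv_eq.trans hsum.fderiv)) a
  simp only [ContinuousLinearMap.comp_zero, zero_add, ContinuousLinearMap.flip_apply,
    ContinuousLinearMap.flip_add, add_apply, Function.comp_apply,
    ContinuousLinearMap.comp_apply] at hderiv
  rw [hderiv]
  ring

/-- Differentiating `dπ ∘ df = id` and `φ ∘ df = 0` along `f` expresses the images of the second
derivative of `f` under `dπ` and `φ` through the first derivatives of `dπ` and `φ`, and these are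
the terms that Koszul's formula for `h` produces. -/
theorem secondFundamentalForm_eq_zero_of_horizontal {f : V → W} {π : W → V}
    {g : V → V →L[ℝ] V →L[ℝ] ℝ} {h : W → W →L[ℝ] W →L[ℝ] ℝ} {φ : W → W →L[ℝ] S}
    {B : S →L[ℝ] S →L[ℝ] ℝ} {x₀ : V}
    (hf : ContDiffAt ℝ 2 f x₀) (hπ : ContDiffAt ℝ 2 π (f x₀)) (hg : DifferentiableAt ℝ g x₀)
    (hg_symm : ∀ u v, g x₀ u v = g x₀ v u)
    (hφ : DifferentiableAt ℝ φ (f x₀)) (hπf : ∀ᶠ x in 𝓝 x₀, π (f x) = x)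
    (hh : ∀ᶠ y in 𝓝 (f x₀), ∀ w w', h y w w' =
      g (π y) (fderiv ℝ π y w) (fderiv ℝ π y w') + B (φ y w) (φ y w'))
    (hhd : DifferentiableAt ℝ h (f x₀))
    (hφf : ∀ᶠ x in 𝓝 x₀, ∀ u, φ (f x) (fderiv ℝ f x u) = 0)
    {Γg : V → V → V} (hΓg : ∀ u v w, g x₀ (Γg u v) w =
      (1 / 2) * (fderiv ℝ g x₀ u v w + fderiv ℝ g x₀ v u w - fderiv ℝ g x₀ w u v))
    {Γh : W → W → W} (hΓh : ∀ u v w, h (f x₀) (Γh u v) w =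
      (1 / 2) * (fderiv ℝ h (f x₀) u v w + fderiv ℝ h (f x₀) v u w - fderiv ℝ h (f x₀) w u v))
    (u v : V) (w : W) :
    h (f x₀) (fderiv ℝ (fderiv ℝ f) x₀ u v + Γh (fderiv ℝ f x₀ u) (fderiv ℝ f x₀ v) -
      fderiv ℝ f x₀ (Γg u v)) w = 0 := by
  have hx₀ : π (f x₀) = x₀ := hπf.self_of_nhds
  have hπ' : DifferentiableAt ℝ (fderiv ℝ π) (f x₀) :=
    (hπ.fderiv_right (m := 1) (by norm_num)).differentiableAt (by simp)
  have hfs : fderiv ℝ (fderiv ℝ f) x₀ v u = fderiv ℝ (fderiv ℝ f) x₀ u v :=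
    hf.isSymmSndFDerivAt (by simp) v u
  have hπs (a b : W) : fderiv ℝ (fderiv ℝ π) (f x₀) a b = fderiv ℝ (fderiv ℝ π) (f x₀) b a :=
    hπ.isSymmSndFDerivAt (by simp) a b
  have hπf' := eventually_fderiv_fderiv_of_eventually_leftInverse hf hπ hπf
  have hπ₀ (a : V) : fderiv ℝ π (f x₀) (fderiv ℝ f x₀ a) = a := hπf'.self_of_nhds a
  have hφ₀ (a : V) : φ (f x₀) (fderiv ℝ f x₀ a) = 0 := hφf.self_of_nhds a
  have hh₀ (a b : W) : h (f x₀) a b = g x₀ (fderiv ℝ π (f x₀) a) (fderiv ℝ π (f x₀) b) +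
      B (φ (f x₀) a) (φ (f x₀) b) := by
    rw [hh.self_of_nhds, hx₀]
  have hh' := fderiv_kaluzaKlein hπ (by rwa [hx₀]) hφ hhd hh
  rw [hx₀] at hh'
  have hπ'' := fderiv_apply_fderiv_add_apply_fderiv_fderiv hf hπ' (hπf'.mono fun x hx => hx v) u
  have hφ'' (a b : V) := fderiv_apply_fderiv_add_apply_fderiv_fderiv hf hφ
    (hφf.mono fun x hx => hx b) a
  have hφvu := hφ'' v u
  rw [hfs] at hφvu
  have hgπ := congrArg (fun s => g x₀ s (fderiv ℝ π (f x₀) w)) hπ''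
  have hBuv := congrArg (fun s => B s (φ (f x₀) w)) (hφ'' u v)
  have hBvu := congrArg (fun s => B s (φ (f x₀) w)) hφvu
  simp only [map_add, add_apply, map_zero, zero_apply] at hgπ hBuv hBvu
  rw [map_sub, map_add, sub_apply, add_apply, hΓh]
  simp only [hh₀, hh', hπ₀, hφ₀, map_zero, zero_apply, add_zero]
  rw [hΓg, hπs w, hπs w, hπs (fderiv ℝ f x₀ v) (fderiv ℝ f x₀ u)]
  linarith [hg_symm u (fderiv ℝ (fderiv ℝ π) (f x₀) (fderiv ℝ f x₀ v) w),
    hg_symm v (fderiv ℝ (fderiv ℝ π) (f x₀) (fderiv ℝ f x₀ u) w)]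

end Horizontal

/-! ### Orthonormal frames and their connection matrices -/

section Smoothness

variable {E : Type*} [NormedAddCommGroup E] [NormedSpace ℝ E]
  {N : Type*} [TopologicalSpace N] [ChartedSpace E N]

theorem contMDiffOn_clm_of_apply {V G : Type*} [NormedAddCommGroup V] [NormedSpace ℝ V]
    [FiniteDimensional ℝ V] [NormedAddCommGroup G] [NormedSpace ℝ G]
    {f : N → V →L[ℝ] G} {s : Set N}
    (h : ∀ v, ContMDiffOn 𝓘(ℝ, E) 𝓘(ℝ, G) ∞ (fun x => f x v) s) :
    ContMDiffOn 𝓘(ℝ, E) 𝓘(ℝ, V →L[ℝ] G) ∞ f s := by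
  let b := Module.finBasis ℝ V
  let coord (i) : V →L[ℝ] ℝ := LinearMap.toContinuousLinearMap (b.coord i)
  have hf : f = fun x => ∑ i, ContinuousLinearMap.smulRightL ℝ V G (coord i) (f x (b i)) := by
    funext x
    ext v
    conv_lhs => rw [← b.sum_repr v, map_sum]
    simp [coord]
  rw [hf]
  exact contMDiffOn_finsetSum fun i _ =>
    (ContinuousLinearMap.contMDiff (n := ∞) _).comp_contMDiffOn (h (b i))

theorem contMDiffOn_of_inner {V : Type*} [NormedAddCommGroup V] [InnerProductSpace ℝ V]
    [FiniteDimensional ℝ V] {f : N → V} {s : Set N}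
    (h : ∀ v, ContMDiffOn 𝓘(ℝ, E) 𝓘(ℝ, ℝ) ∞ (fun x => ⟪f x, v⟫) s) :
    ContMDiffOn 𝓘(ℝ, E) 𝓘(ℝ, V) ∞ f s := by
  let b := stdOrthonormalBasis ℝ V
  have hf : f = fun x => ∑ i, ⟪f x, b i⟫ • b i := by
    funext x
    simp only [real_inner_comm (b _) (f x), b.sum_repr']
  rw [hf]
  exact contMDiffOn_finsetSum fun i _ => (h (b i)).smul contMDiffOn_const

theorem contMDiffOn_modelBracket [IsManifold 𝓘(ℝ, E) ∞ N] [CompleteSpace E] {X Y : N → E}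
    {s : Set N} (hs : IsOpen s)
    (hX : ContMDiffOn 𝓘(ℝ, E) (𝓘(ℝ, E).prod 𝓘(ℝ, E)) ∞
      (fun x => (⟨x, X x⟩ : TangentBundle 𝓘(ℝ, E) N)) s)
    (hY : ContMDiffOn 𝓘(ℝ, E) (𝓘(ℝ, E).prod 𝓘(ℝ, E)) ∞
      (fun x => (⟨x, Y x⟩ : TangentBundle 𝓘(ℝ, E) N)) s) :
    ContMDiffOn 𝓘(ℝ, E) (𝓘(ℝ, E).prod 𝓘(ℝ, E)) ∞
      (fun x => (⟨x, modelBracket (E := E) (M := N) X Y x⟩ : TangentBundle 𝓘(ℝ, E) N)) s := by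
  have : IsManifold 𝓘(ℝ, E) (minSmoothness ℝ 3) N := by
    rw [minSmoothness_of_isRCLikeNormedField]; infer_instance
  have : IsManifold 𝓘(ℝ, E) (((⊤ : ℕ∞) : WithTop ℕ∞) + 1) N :=
    inferInstanceAs (IsManifold 𝓘(ℝ, E) ∞ N)
  intro x hx
  exact (ContMDiffAt.mlieBracket_vectorField (m := (⊤ : ℕ∞)) (n := (⊤ : ℕ∞))
    (hX.contMDiffAt (hs.mem_nhds hx)) (hY.contMDiffAt (hs.mem_nhds hx))
    (by simp)).contMDiffWithinAt

end Smoothness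

namespace OrthoFrame

variable {E : Type*} [NormedAddCommGroup E] [NormedSpace ℝ E]
  {N : Type*} [TopologicalSpace N] [ChartedSpace E N] [IsManifold 𝓘(ℝ, E) ∞ N]
  {g : RMetric E N} (F : OrthoFrame g)

/-- The frame at `x`, as a map to the model space. -/
def fr (x : N) : Std (halfDim E) →L[ℝ] E := (F.frame x : Std (halfDim E) →L[ℝ] Tan E x)

/-- The inverse of the frame at `x`, as a map from the model space. -/
def frInv (x : N) : E →L[ℝ] Std (halfDim E) := ((F.frame x).symm : Tan E x →L[ℝ] Std (halfDim E))

theorem fr_frInv (x : N) (v : E) : F.fr x (F.frInv x v) = v := (F.frame x).apply_symm_apply v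

theorem frInv_fr (x : N) (v : Std (halfDim E)) : F.frInv x (F.fr x v) = v :=
  (F.frame x).symm_apply_apply v

theorem metricAt_fr {x : N} (hx : x ∈ F.dom) (u v : Std (halfDim E)) :
    metricAt g x (F.fr x u) (F.fr x v) = ⟪u, v⟫ := F.isometry x hx u v

theorem inner_frInv {x : N} (hx : x ∈ F.dom) (u : E) (v : Std (halfDim E)) :
    ⟪F.frInv x u, v⟫ = metricAt g x u (F.fr x v) := by
  rw [← F.metricAt_fr hx, F.fr_frInv]

/-- The frame in the chart at `q`. -/
def frChart (q x : N) : Std (halfDim E) →L[ℝ] E := toChart E q x ∘L F.fr x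

/-- The inverse of the frame in the chart at `q`. -/
def frChartInv (q x : N) : E →L[ℝ] Std (halfDim E) := F.frInv x ∘L ofChart E q x

theorem frChartInv_frChart {q x : N} (hx : x ∈ (chartAt E q).source) :
    F.frChartInv q x ∘L F.frChart q x = ContinuousLinearMap.id ℝ _ := by
  ext v
  simp only [frChart, frChartInv, ContinuousLinearMap.comp_apply, ofChart_toChart hx, F.frInv_fr,
    ContinuousLinearMap.id_apply]

theorem frChart_self (q : N) : F.frChart q q = F.fr q := by
  ext v; simp only [frChart, ContinuousLinearMap.comp_apply, toChart_self]

theorem dom_inter_source_mem_nhds {q x : N} (hx : x ∈ F.dom) (hq : x ∈ (chartAt E q).source) :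
    F.dom ∩ (chartAt E q).source ∈ 𝓝 x :=
  (F.isOpen_dom.inter (chartAt E q).open_source).mem_nhds ⟨hx, hq⟩

theorem contMDiffOn_frChart (q : N) :
    ContMDiffOn 𝓘(ℝ, E) 𝓘(ℝ, Std (halfDim E) →L[ℝ] E) ∞ (F.frChart q)
      (F.dom ∩ (chartAt E q).source) :=
  contMDiffOn_clm_of_apply fun v =>
    (contMDiffOn_field_iff_toChart (Y := fun x => F.frame x v)
      (F.isOpen_dom.inter (chartAt E q).open_source) Set.inter_subset_right).1
      ((F.smooth v).mono Set.inter_subset_left)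

theorem mdifferentiableAt_frChart {q x : N} (hx : x ∈ F.dom) (hq : x ∈ (chartAt E q).source) :
    MDifferentiableAt 𝓘(ℝ, E) 𝓘(ℝ, Std (halfDim E) →L[ℝ] E) (F.frChart q) x :=
  ((F.contMDiffOn_frChart q).contMDiffAt
    (F.dom_inter_source_mem_nhds hx hq)).mdifferentiableAt (by simp)

theorem mdifferentiableAt_toChart_fr {x : N} (hx : x ∈ F.dom) (v : Std (halfDim E)) :
    MDifferentiableAt 𝓘(ℝ, E) 𝓘(ℝ, E) (fun y => toChart E x y (F.fr y v)) x :=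
  (F.mdifferentiableAt_frChart hx (mem_chart_source E x)).clm_apply mdifferentiableAt_const

variable [FiniteDimensional ℝ E]

/-- The connection matrix of the frame: `conn x X v` is the expression in the frame of the
derivative of the field `v` of the frame in the direction `X`. -/
def conn (x : N) : E →L[ℝ] Std (halfDim E) →L[ℝ] Std (halfDim E) :=
  ContinuousLinearMap.compL ℝ (Std (halfDim E)) E (Std (halfDim E)) (F.frInv x) ∘L
    (modelDeriv E (Std (halfDim E) →L[ℝ] E) (F.frChart x) x +
      (ContinuousLinearMap.compL ℝ (Std (halfDim E)) E E).flip (F.fr x) ∘L christoffelL g x)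

theorem conn_apply (x : N) (X : E) (v : Std (halfDim E)) : F.conn x X v =
    F.frInv x (modelDeriv E (Std (halfDim E) →L[ℝ] E) (F.frChart x) x X v +
      christoffel g x X (F.fr x v)) := rfl

theorem inner_conn {x : N} (hx : x ∈ F.dom) (X : E) (v w : Std (halfDim E)) :
    ⟪F.conn x X v, w⟫ = metricAt g x (covDeriv g (fun y => F.fr y v) x X) (F.fr x w) := by
  rw [conn_apply, F.inner_frInv hx, covDeriv, ← modelDeriv_clm_apply_const
    (F.mdifferentiableAt_frChart hx (mem_chart_source E x))]
  rfl

theorem metricAt_covDeriv_fr {x : N} (hx : x ∈ F.dom) (X : E)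
    (v w : Std (halfDim E)) :
    metricAt g x (covDeriv g (fun y => F.fr y v) x X) (F.fr x w) =
      -metricAt g x (covDeriv g (fun y => F.fr y w) x X) (F.fr x v) := by
  have hconst : (fun y => metricAt g y (F.fr y v) (F.fr y w)) =ᶠ[𝓝 x] fun _ => ⟪v, w⟫ := by
    filter_upwards [F.isOpen_dom.mem_nhds hx] with y hy using F.metricAt_fr hy v w
  have hderiv := modelDeriv_metricAt_eq_covDeriv g (F.mdifferentiableAt_toChart_fr hx v)
    (F.mdifferentiableAt_toChart_fr hx w) X
  rw [modelDeriv_congr hconst, modelDeriv_const, zero_apply, metricAt_symm g x (F.fr x v)]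
    at hderiv
  exact eq_neg_of_add_eq_zero_left hderiv.symm

theorem conn_skew {x : N} (hx : x ∈ F.dom) (X : E) (v w : Std (halfDim E)) :
    ⟪F.conn x X v, w⟫ = -⟪v, F.conn x X w⟫ := by
  rw [real_inner_comm (F.conn x X w) v, F.inner_conn hx, F.inner_conn hx,
    F.metricAt_covDeriv_fr hx]

/-- Koszul's formula for the fields of an orthonormal frame. -/
theorem inner_conn_fr {x : N} (hx : x ∈ F.dom)
    (u v w : Std (halfDim E)) :
    ⟪F.conn x (F.fr x u) v, w⟫ = (1 / 2) *
      (metricAt g x (modelBracket (fun y => F.fr y u) (fun y => F.fr y v) x) (F.fr x w) -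
        metricAt g x (modelBracket (fun y => F.fr y v) (fun y => F.fr y w) x) (F.fr x u) +
        metricAt g x (modelBracket (fun y => F.fr y w) (fun y => F.fr y u) x) (F.fr x v)) := by
  have hdiff := F.mdifferentiableAt_toChart_fr hx
  rw [F.inner_conn hx, modelBracket_eq_covDeriv_sub g (hdiff u) (hdiff v),
    modelBracket_eq_covDeriv_sub g (hdiff v) (hdiff w),
    modelBracket_eq_covDeriv_sub g (hdiff w) (hdiff u)]
  simp only [map_sub, sub_apply]
  linarith [F.metricAt_covDeriv_fr hx (F.fr x u) v w, F.metricAt_covDeriv_fr hx (F.fr x v) u w,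
    F.metricAt_covDeriv_fr hx (F.fr x w) u v]

theorem contMDiffOn_frChartInv (q : N) :
    ContMDiffOn 𝓘(ℝ, E) 𝓘(ℝ, E →L[ℝ] Std (halfDim E)) ∞ (F.frChartInv q)
      (F.dom ∩ (chartAt E q).source) := by
  refine contMDiffOn_clm_of_apply fun u => contMDiffOn_of_inner fun v => ?_
  have hu : ContMDiffOn 𝓘(ℝ, E) (𝓘(ℝ, E).prod 𝓘(ℝ, E)) ∞
      (fun x => (⟨x, ofChart E q x u⟩ : TangentBundle 𝓘(ℝ, E) N))
      (F.dom ∩ (chartAt E q).source) := fun x hx =>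
    ContMDiffAt.contMDiffWithinAt (smoothFieldAt_ofChart hx.2 u)
  exact (contMDiffOn_inner g hu ((F.smooth v).mono Set.inter_subset_left)).congr
    fun x hx => F.inner_frInv hx.1 _ v

theorem mdifferentiableAt_frChartInv {q x : N} (hx : x ∈ F.dom)
    (hq : x ∈ (chartAt E q).source) :
    MDifferentiableAt 𝓘(ℝ, E) 𝓘(ℝ, E →L[ℝ] Std (halfDim E)) (F.frChartInv q) x :=
  ((F.contMDiffOn_frChartInv q).contMDiffAt
    (F.dom_inter_source_mem_nhds hx hq)).mdifferentiableAt (by simp)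

theorem contMDiffOn_conn_fr :
    ContMDiffOn 𝓘(ℝ, E) 𝓘(ℝ, Std (halfDim E) →L[ℝ] Std (halfDim E) →L[ℝ] Std (halfDim E)) ∞
      (fun x => F.conn x ∘L F.fr x) F.dom := by
  have hbracket (u v w : Std (halfDim E)) : ContMDiffOn 𝓘(ℝ, E) 𝓘(ℝ, ℝ) ∞ (fun x =>
      metricAt g x (modelBracket (fun y => F.fr y u) (fun y => F.fr y v) x) (F.fr x w)) F.dom :=
    contMDiffOn_inner g (contMDiffOn_modelBracket F.isOpen_dom (F.smooth u) (F.smooth v))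
      (F.smooth w)
  refine contMDiffOn_clm_of_apply fun u => contMDiffOn_end fun v w => ?_
  exact (contMDiffOn_const.mul
    (((hbracket u v w).sub (hbracket v w u)).add (hbracket w u v))).congr
    fun x hx => F.inner_conn_fr hx u v w

theorem contMDiffOn_conn_ofChart (q : N) :
    ContMDiffOn 𝓘(ℝ, E) 𝓘(ℝ, E →L[ℝ] Std (halfDim E) →L[ℝ] Std (halfDim E)) ∞
      (fun x => F.conn x ∘L ofChart E q x) (F.dom ∩ (chartAt E q).source) := by
  refine ((F.contMDiffOn_conn_fr.mono Set.inter_subset_left).clm_comp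
    (F.contMDiffOn_frChartInv q)).congr fun x _ => ?_
  ext u v
  simp only [ContinuousLinearMap.comp_apply, frChartInv, F.fr_frInv]

end OrthoFrame

/-! ### The twistor space and the vertical part of its tangent vectors -/

section TwistorCharts

variable {E : Type*} [NormedAddCommGroup E] [NormedSpace ℝ E]
  {N : Type*} [TopologicalSpace N] [ChartedSpace E N] [IsManifold 𝓘(ℝ, E) ∞ N]
  {g : RMetric E N}

/-- The model space of the twistor space. -/
abbrev TwModel (E : Type*) [NormedAddCommGroup E] [NormedSpace ℝ E] : Type _ :=
  E × FModel (halfDim E)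

/-- The complex structure of a point of the twistor space, as an endomorphism of the model
space. -/
def strAt (z : TwistorSpace g) : E →L[ℝ] E := z.str

/-- The complex structure of a point of the twistor space, as a matrix in the frame. -/
def OrthoFrame.matrix (F : OrthoFrame g) (z : TwistorSpace g) :
    Std (halfDim E) →L[ℝ] Std (halfDim E) := F.read z.base z.str

theorem OrthoFrame.fr_matrix (F : OrthoFrame g) (z : TwistorSpace g) (v : Std (halfDim E)) :
    F.fr z.base (F.matrix z v) = strAt z (F.fr z.base v) :=
  F.fr_frInv z.base _

theorem OrthoFrame.strInChart_eq (F : OrthoFrame g) (q : N) :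
    (strInChart q : TwistorSpace g → E →L[ℝ] E) =
      fun w => F.frChart q w.base ∘L (F.matrix w ∘L F.frChartInv q w.base) := by
  funext w
  ext v
  change toChart E q w.base (strAt w (ofChart E q w.base v)) =
    toChart E q w.base (F.fr w.base (F.matrix w (F.frInv w.base (ofChart E q w.base v))))
  rw [F.fr_matrix, F.fr_frInv]

theorem OrthoFrame.matrix_skew (F : OrthoFrame g) {z : TwistorSpace g} (hz : z.base ∈ F.dom)
    (u v : Std (halfDim E)) : ⟪F.matrix z u, v⟫ = -⟪u, F.matrix z v⟫ :=
  (F.isOrthoCplx_read z hz).skew u v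

variable [FiniteDimensional ℝ E]

theorem base_mem_dom {z₀ z : TwistorSpace g} (hz : z ∈ (chartAt (TwModel E) z₀).source) :
    z.base ∈ (frameAt z₀).dom := hz.1

theorem base_eq_chart_symm {z₀ z : TwistorSpace g} (hz : z ∈ (chartAt (TwModel E) z₀).source) :
    z.base = (chartAt E (frameAt z₀).center).symm (chartAt (TwModel E) z₀ z).1 :=
  ((chartAt E (frameAt z₀).center).left_inv ((frameAt z₀).dom_subset hz.1)).symm

theorem matrix_eq_cayley {z₀ z : TwistorSpace g} (hz : z ∈ (chartAt (TwModel E) z₀).source) :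
    (frameAt z₀).matrix z = cayley (inclF (halfDim E) (chartAt (TwModel E) z₀ z).2) := by
  obtain ⟨hmem, hinv⟩ := cayleyInv_mem ((frameAt z₀).isOrthoCplx_read z hz.1) hz.2
  exact ((congrArg cayley (inclF_projF hmem)).trans hinv).symm

theorem contMDiffOn_base (z₀ : TwistorSpace g) :
    ContMDiffOn 𝓘(ℝ, TwModel E) 𝓘(ℝ, E) ∞ (TwistorSpace.base (g := g))
      (chartAt (TwModel E) z₀).source := by
  have hfst : ContMDiffOn 𝓘(ℝ, TwModel E) 𝓘(ℝ, E) ∞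
      (fun z : TwistorSpace g => (chartAt (TwModel E) z₀ z).1) (chartAt (TwModel E) z₀).source :=
    (contDiff_fst (n := ∞)).contMDiff.comp_contMDiffOn
      (contMDiffOn_chart (I := 𝓘(ℝ, TwModel E)) (n := ∞) (x := z₀))
  exact ((contMDiffOn_chart_symm (I := 𝓘(ℝ, E)) (n := ∞) (x := (frameAt z₀).center)).comp hfst
    fun z hz => (chartAt E (frameAt z₀).center).map_source ((frameAt z₀).dom_subset hz.1)).congr
    fun _ hz => base_eq_chart_symm hz

theorem contMDiff_base : ContMDiff 𝓘(ℝ, TwModel E) 𝓘(ℝ, E) ∞ (TwistorSpace.base (g := g)) :=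
  fun z => (contMDiffOn_base z).contMDiffAt
    ((chartAt (TwModel E) z).open_source.mem_nhds (mem_chart_source _ z))

theorem contMDiffOn_matrix (z₀ : TwistorSpace g) :
    ContMDiffOn 𝓘(ℝ, TwModel E) 𝓘(ℝ, Std (halfDim E) →L[ℝ] Std (halfDim E)) ∞
      (frameAt z₀).matrix (chartAt (TwModel E) z₀).source :=
  (((contDiff_cayley (halfDim E)).comp contDiff_snd).contMDiff.comp_contMDiffOn
    (contMDiffOn_chart (I := 𝓘(ℝ, TwModel E)) (n := ∞) (x := z₀))).congr
    fun _ hz => matrix_eq_cayley hz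

theorem mdifferentiableAt_base (z : TwistorSpace g) :
    MDifferentiableAt 𝓘(ℝ, TwModel E) 𝓘(ℝ, E) (TwistorSpace.base (g := g)) z :=
  (contMDiff_base z).mdifferentiableAt (by simp)

theorem mdifferentiableAt_matrix {z₀ z : TwistorSpace g}
    (hz : z ∈ (chartAt (TwModel E) z₀).source) :
    MDifferentiableAt 𝓘(ℝ, TwModel E) 𝓘(ℝ, Std (halfDim E) →L[ℝ] Std (halfDim E))
      (frameAt z₀).matrix z :=
  ((contMDiffOn_matrix z₀).contMDiffAt
    ((chartAt (TwModel E) z₀).open_source.mem_nhds hz)).mdifferentiableAt (by simp)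

/-- `dProj` as a continuous linear map between the model spaces. -/
def dProjL (z : TwistorSpace g) : TwModel E →L[ℝ] E :=
  modelDeriv (TwModel E) E (TwistorSpace.base (g := g)) z

/-- `verticalPart` as a continuous linear map between the model spaces. -/
def verticalPartL (z : TwistorSpace g) : TwModel E →L[ℝ] E →L[ℝ] E :=
  modelDeriv (TwModel E) (E →L[ℝ] E) (strInChart z.base) z +
    ((ContinuousLinearMap.compL ℝ E E E).flip (strAt z) -
      ContinuousLinearMap.compL ℝ E E E (strAt z)) ∘L christoffelL g z.base ∘L dProjL z

theorem verticalPartL_apply (z : TwistorSpace g) (ξ : TwModel E) : verticalPartL z ξ =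
    modelDeriv (TwModel E) (E →L[ℝ] E) (strInChart z.base) z ξ +
      (christoffel g z.base (dProjL z ξ) ∘L strAt z -
        strAt z ∘L christoffel g z.base (dProjL z ξ)) := rfl

theorem verticalPart_eq_verticalPartL (z : TwistorSpace g) (ξ : TwModel E) :
    verticalPart z ξ = verticalPartL z ξ := by
  rw [verticalPartL_apply, ← add_sub_assoc]
  rfl

namespace OrthoFrame

variable (F : OrthoFrame g)

theorem fr_conn (x : N) (X : E) (v : Std (halfDim E)) : F.fr x (F.conn x X v) =
    modelDeriv E (Std (halfDim E) →L[ℝ] E) (F.frChart x) x X v +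
      christoffel g x X (F.fr x v) := by
  rw [conn_apply, fr_frInv]

variable {F} {z : TwistorSpace g} (hz : z.base ∈ F.dom)
  (hK : MDifferentiableAt 𝓘(ℝ, TwModel E) 𝓘(ℝ, Std (halfDim E) →L[ℝ] Std (halfDim E)) F.matrix z)

include hz

theorem mdifferentiableAt_frChart_base :
    MDifferentiableAt 𝓘(ℝ, TwModel E) 𝓘(ℝ, Std (halfDim E) →L[ℝ] E)
      (fun w : TwistorSpace g => F.frChart z.base w.base) z :=
  (F.mdifferentiableAt_frChart hz (mem_chart_source E z.base)).comp z (mdifferentiableAt_base z)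

include hK

theorem mdifferentiableAt_strInChart :
    MDifferentiableAt 𝓘(ℝ, TwModel E) 𝓘(ℝ, E →L[ℝ] E)
      (strInChart z.base : TwistorSpace g → E →L[ℝ] E) z := by
  rw [F.strInChart_eq]
  exact (mdifferentiableAt_frChart_base hz).clm_comp (hK.clm_comp
    ((F.mdifferentiableAt_frChartInv hz (mem_chart_source E z.base)).comp z
      (mdifferentiableAt_base z)))

/-- This is the derivative with respect to `w` of the identity
`strInChart q w ∘ F.frChart q w.base = F.frChart q w.base ∘ F.matrix w`. -/
theorem modelDeriv_strInChart_fr (ξ : TwModel E) (v : Std (halfDim E)) :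
    modelDeriv (TwModel E) (E →L[ℝ] E) (strInChart z.base) z ξ (F.fr z.base v) =
      F.fr z.base (modelDeriv (TwModel E) (Std (halfDim E) →L[ℝ] Std (halfDim E)) F.matrix z ξ v) +
      modelDeriv E (Std (halfDim E) →L[ℝ] E) (F.frChart z.base) z.base (dProjL z ξ)
        (F.matrix z v) -
      strAt z (modelDeriv E (Std (halfDim E) →L[ℝ] E) (F.frChart z.base) z.base (dProjL z ξ)
        v) := by
  have hsource := mem_chart_source E z.base
  have hfr := mdifferentiableAt_frChart_base hz
  have hstr : (fun w : TwistorSpace g => strInChart z.base w ∘L F.frChart z.base w.base) =ᶠ[𝓝 z]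
      fun w => F.frChart z.base w.base ∘L F.matrix w := by
    filter_upwards [(mdifferentiableAt_base z).continuousAt.preimage_mem_nhds
      ((chartAt E z.base).open_source.mem_nhds hsource)] with w hw
    rw [F.strInChart_eq, ContinuousLinearMap.comp_assoc, ContinuousLinearMap.comp_assoc,
      F.frChartInv_frChart hw, ContinuousLinearMap.comp_id]
  have hstr_self : strInChart z.base z = strAt z := by
    ext u
    exact (toChart_self _ _).trans (congrArg (strAt z) (ofChart_self _ _))
  have hderiv := (modelDeriv_clm_comp (mdifferentiableAt_strInChart hz hK) hfr ξ).symm.trans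
    ((DFunLike.congr_fun (modelDeriv_congr hstr) ξ).trans (modelDeriv_clm_comp hfr hK ξ))
  rw [modelDeriv_comp (f' := F.frChart z.base)
    (F.mdifferentiableAt_frChart hz hsource) (mdifferentiableAt_base z), F.frChart_self,
    hstr_self] at hderiv
  exact eq_sub_of_add_eq' (DFunLike.congr_fun hderiv v)

theorem frInv_verticalPartL_fr (ξ : TwModel E) :
    F.frInv z.base ∘L verticalPartL z ξ ∘L F.fr z.base =
      modelDeriv (TwModel E) (Std (halfDim E) →L[ℝ] Std (halfDim E)) F.matrix z ξ +
        (F.conn z.base (dProjL z ξ) ∘L F.matrix z -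
          F.matrix z ∘L F.conn z.base (dProjL z ξ)) := by
  ext1 v
  refine (congrArg (F.frInv z.base) ?_).trans (F.frInv_fr z.base _)
  change verticalPartL z ξ (F.fr z.base v) = F.fr z.base _
  rw [verticalPartL_apply]
  simp only [ContinuousLinearMap.comp_apply, add_apply, sub_apply, map_add, map_sub,
    modelDeriv_strInChart_fr hz hK, F.fr_matrix, F.fr_conn]
  abel

end OrthoFrame

end TwistorCharts

/-! ### The trace form -/

section TraceForm

/-- The bilinear form `c Trace (A B)` on the endomorphisms of a vector space. -/
def traceFormL (V : Type*) [NormedAddCommGroup V] [NormedSpace ℝ V] [FiniteDimensional ℝ V]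
    (c : ℝ) : (V →L[ℝ] V) →L[ℝ] (V →L[ℝ] V) →L[ℝ] ℝ :=
  c • (ContinuousLinearMap.compL ℝ (V →L[ℝ] V) (V →L[ℝ] V) ℝ (LinearMap.toContinuousLinearMap
    (LinearMap.trace ℝ V ∘ₗ ContinuousLinearMap.coeLM ℝ)) ∘L ContinuousLinearMap.compL ℝ V V V)

variable {V : Type*} [NormedAddCommGroup V] [NormedSpace ℝ V] [FiniteDimensional ℝ V]

theorem traceFormL_apply (c : ℝ) (A B : V →L[ℝ] V) :
    traceFormL V c A B = c * LinearMap.trace ℝ V (A ∘L B).toLinearMap := rfl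

theorem traceFormL_symm (c : ℝ) (A B : V →L[ℝ] V) :
    traceFormL V c A B = traceFormL V c B A :=
  congrArg (c * ·) (LinearMap.trace_mul_comm ℝ A.toLinearMap B.toLinearMap)

theorem traceFormL_conj {U : Type*} [NormedAddCommGroup U] [NormedSpace ℝ U]
    [FiniteDimensional ℝ U] (c : ℝ) (A B : V →L[ℝ] V) {i : U →L[ℝ] V} {j : V →L[ℝ] U}
    (hij : ∀ v, i (j v) = v) :
    traceFormL U c (j ∘L A ∘L i) (j ∘L B ∘L i) = traceFormL V c A B := by
  have hcomp : ((j ∘L A ∘L i) ∘L (j ∘L B ∘L i)).toLinearMap =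
      j.toLinearMap ∘ₗ ((A ∘L B).toLinearMap ∘ₗ i.toLinearMap) := by
    ext v; simp [hij]
  have hcancel : ((A ∘L B).toLinearMap ∘ₗ i.toLinearMap) ∘ₗ j.toLinearMap =
      (A ∘L B).toLinearMap := by
    ext v; simp [hij]
  rw [traceFormL_apply, traceFormL_apply, hcomp, LinearMap.trace_comp_comm', hcancel]

variable {U : Type*} [NormedAddCommGroup U] [InnerProductSpace ℝ U] [FiniteDimensional ℝ U]

theorem trace_comp_self_of_skew {A : U →L[ℝ] U} (hA : ∀ u v, ⟪A u, v⟫ = -⟪u, A v⟫) :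
    LinearMap.trace ℝ U (A ∘L A).toLinearMap =
      -∑ i, ‖A (stdOrthonormalBasis ℝ U i)‖ ^ 2 := by
  rw [LinearMap.trace_eq_sum_inner _ (stdOrthonormalBasis ℝ U), ← Finset.sum_neg_distrib]
  refine Finset.sum_congr rfl fun i _ => ?_
  rw [← real_inner_self_eq_norm_sq, hA, neg_neg]
  rfl

theorem traceFormL_self_pos {c : ℝ} (hc : c < 0) {A : U →L[ℝ] U}
    (hA : ∀ u v, ⟪A u, v⟫ = -⟪u, A v⟫) (hne : A ≠ 0) : 0 < traceFormL U c A A := by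
  rw [traceFormL_apply, trace_comp_self_of_skew hA]
  refine mul_pos_of_neg_of_neg hc (neg_neg_of_pos ?_)
  obtain ⟨i, hi⟩ : ∃ i, A (stdOrthonormalBasis ℝ U i) ≠ 0 := by
    by_contra! hzero
    exact hne (ContinuousLinearMap.coe_injective ((stdOrthonormalBasis ℝ U).toBasis.ext fun i => by
      simpa using hzero i))
  exact Finset.sum_pos' (fun i _ => by positivity) ⟨i, Finset.mem_univ i, by positivity⟩

end TraceForm

/-! ### The metric of the twistor space -/

section TwistorMetric

variable {E : Type*} [NormedAddCommGroup E] [NormedSpace ℝ E]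

/-- The factor `-t / n` of the trace form in the metric `h_t` of the twistor space. -/
def verticalFactor (E : Type*) [NormedAddCommGroup E] [NormedSpace ℝ E] (t : ℝ) : ℝ :=
  t * (-(1 / (Module.finrank ℝ E : ℝ)))

theorem verticalFactor_neg {t : ℝ} (ht : 0 < t) (hE : 0 < Module.finrank ℝ E) :
    verticalFactor E t < 0 :=
  mul_neg_of_pos_of_neg ht (neg_neg_of_pos (one_div_pos.2 (Nat.cast_pos.2 hE)))

theorem traceFormL_self_pos_of_std {t : ℝ} (ht : 0 < t)
    {A : Std (halfDim E) →L[ℝ] Std (halfDim E)} (hA : ∀ u v, ⟪A u, v⟫ = -⟪u, A v⟫)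
    (hne : A ≠ 0) : 0 < traceFormL (Std (halfDim E)) (verticalFactor E t) A A := by
  have : Nontrivial (Std (halfDim E)) := not_subsingleton_iff_nontrivial.1 fun _ =>
    hne (Subsingleton.elim _ _)
  have hdim := Module.finrank_pos (R := ℝ) (M := Std (halfDim E))
  rw [finrank_std, halfDim] at hdim
  exact traceFormL_self_pos (verticalFactor_neg ht (by omega)) hA hne

variable [FiniteDimensional ℝ E]
  {N : Type*} [TopologicalSpace N] [ChartedSpace E N] [IsManifold 𝓘(ℝ, E) ∞ N]
  {g : RMetric E N}

/-- `twistorForm` as a field of continuous bilinear forms on the model space. -/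
def twistorFormL (t : ℝ) (z : TwistorSpace g) : TwModel E →L[ℝ] TwModel E →L[ℝ] ℝ :=
  (metricAt g z.base).bilinearComp (dProjL z) (dProjL z) +
    (traceFormL E (verticalFactor E t)).bilinearComp (verticalPartL z) (verticalPartL z)

theorem twistorFormL_apply (t : ℝ) (z : TwistorSpace g) (ξ η : TwModel E) :
    twistorFormL t z ξ η = metricAt g z.base (dProjL z ξ) (dProjL z η) +
      traceFormL E (verticalFactor E t) (verticalPartL z ξ) (verticalPartL z η) :=
  rfl

theorem twistorFormL_eq_twistorForm (t : ℝ) (z : TwistorSpace g) (ξ η : TwModel E) :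
    twistorFormL t z ξ η = twistorForm t z ξ η := by
  rw [twistorFormL_apply, traceFormL_apply, verticalFactor, mul_assoc,
    ← verticalPart_eq_verticalPartL, ← verticalPart_eq_verticalPartL]
  rfl

theorem twistorFormL_symm (t : ℝ) (z : TwistorSpace g) (ξ η : TwModel E) :
    twistorFormL t z ξ η = twistorFormL t z η ξ := by
  rw [twistorFormL_apply, twistorFormL_apply, metricAt_symm, traceFormL_symm]

/-- The vertical part of tangent vectors of the twistor space, read in an orthonormal frame. -/
def OrthoFrame.vertical (F : OrthoFrame g) (z : TwistorSpace g) :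
    TwModel E →L[ℝ] Std (halfDim E) →L[ℝ] Std (halfDim E) :=
  modelDeriv (TwModel E) (Std (halfDim E) →L[ℝ] Std (halfDim E)) F.matrix z +
    ((ContinuousLinearMap.compL ℝ _ _ _).flip (F.matrix z) -
      ContinuousLinearMap.compL ℝ _ _ _ (F.matrix z)) ∘L F.conn z.base ∘L dProjL z

theorem OrthoFrame.vertical_apply (F : OrthoFrame g) (z : TwistorSpace g) (ξ : TwModel E) :
    F.vertical z ξ =
      modelDeriv (TwModel E) (Std (halfDim E) →L[ℝ] Std (halfDim E)) F.matrix z ξ +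
        (F.conn z.base (dProjL z ξ) ∘L F.matrix z -
          F.matrix z ∘L F.conn z.base (dProjL z ξ)) :=
  rfl

variable {z₀ z : TwistorSpace g} (hz : z ∈ (chartAt (TwModel E) z₀).source)

include hz in
theorem twistorFormL_eq_vertical (t : ℝ) (ξ η : TwModel E) :
    twistorFormL t z ξ η = metricAt g z.base (dProjL z ξ) (dProjL z η) +
      traceFormL (Std (halfDim E)) (verticalFactor E t) ((frameAt z₀).vertical z ξ)
        ((frameAt z₀).vertical z η) := by
  rw [twistorFormL_apply, OrthoFrame.vertical_apply, OrthoFrame.vertical_apply,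
    ← OrthoFrame.frInv_verticalPartL_fr hz.1 (mdifferentiableAt_matrix hz),
    ← OrthoFrame.frInv_verticalPartL_fr hz.1 (mdifferentiableAt_matrix hz),
    traceFormL_conj _ _ _ ((frameAt z₀).fr_frInv z.base)]

include hz

theorem modelDeriv_matrix_skew (ξ : TwModel E) (u v : Std (halfDim E)) :
    ⟪modelDeriv (TwModel E) (Std (halfDim E) →L[ℝ] Std (halfDim E)) (frameAt z₀).matrix z ξ u, v⟫ =
      -⟪u, modelDeriv (TwModel E) (Std (halfDim E) →L[ℝ] Std (halfDim E))
        (frameAt z₀).matrix z ξ v⟫ := by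
  let L : (Std (halfDim E) →L[ℝ] Std (halfDim E)) →L[ℝ] ℝ :=
    innerSL ℝ v ∘L ContinuousLinearMap.apply ℝ _ u + innerSL ℝ u ∘L ContinuousLinearMap.apply ℝ _ v
  have hL : ∀ A, L A = ⟪A u, v⟫ + ⟪u, A v⟫ := fun A =>
    congrArg (· + ⟪u, A v⟫) (real_inner_comm (A u) v)
  have hzero : (fun w => L ((frameAt z₀).matrix w)) =ᶠ[𝓝 z] fun _ => 0 := by
    filter_upwards [(chartAt (TwModel E) z₀).open_source.mem_nhds hz] with w hw
    rw [hL, (frameAt z₀).matrix_skew hw.1, neg_add_cancel]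
  have hderiv := modelDeriv_const_clm_apply L (mdifferentiableAt_matrix hz) ξ
  rw [modelDeriv_congr hzero, modelDeriv_const, zero_apply, hL] at hderiv
  exact eq_neg_of_add_eq_zero_left hderiv.symm

theorem vertical_skew (ξ : TwModel E) (u v : Std (halfDim E)) :
    ⟪(frameAt z₀).vertical z ξ u, v⟫ = -⟪u, (frameAt z₀).vertical z ξ v⟫ := by
  have hmatrix := (frameAt z₀).matrix_skew hz.1
  have hconn := (frameAt z₀).conn_skew hz.1 (dProjL z ξ)
  simp only [OrthoFrame.vertical_apply, add_apply, sub_apply, ContinuousLinearMap.comp_apply,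
    inner_add_left, inner_sub_left, inner_add_right, inner_sub_right,
    modelDeriv_matrix_skew hz ξ u v, hmatrix _ v, hconn _ v, hmatrix u, hconn u]
  ring

omit hz

theorem contDiffAt_cayleyInv {m : ℕ} {K : Std m →L[ℝ] Std m} (hK : IsUnit (1 - stdJ m * K)) :
    ContDiffAt ℝ ∞ (cayleyInv (m := m)) K := by
  have hinverse : ContDiffAt ℝ ∞ Ring.inverse (1 - stdJ m * K) := by
    obtain ⟨u, hu⟩ := hK
    rw [← hu]
    exact contDiffAt_ringInverse ℝ u
  exact ((contDiffAt_const.mul contDiffAt_id).neg.sub contDiffAt_const).mul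
    (hinverse.comp K (contDiffAt_const.sub (contDiffAt_const.mul contDiffAt_id)))

theorem eq_zero_of_modelDeriv_matrix_eq_zero {ξ : TwModel E} (hbase : dProjL z ξ = 0)
    (hmatrix : modelDeriv (TwModel E) (Std (halfDim E) →L[ℝ] Std (halfDim E))
      (frameAt z).matrix z ξ = 0) : ξ = 0 := by
  have hz := mem_chart_source (TwModel E) z
  have hfst := mdifferentiableAt_chartAt ((frameAt z).dom_subset (base_mem_dom hz))
  have hsnd : MDifferentiableAt 𝓘(ℝ, Std (halfDim E) →L[ℝ] Std (halfDim E))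
      𝓘(ℝ, FModel (halfDim E)) (fun K => projF (halfDim E) (cayleyInv K)) ((frameAt z).matrix z) :=
    ((projF (halfDim E)).differentiableAt.comp _
      ((contDiffAt_cayleyInv hz.2).differentiableAt (by simp))).mdifferentiableAt
  have hchart : modelDeriv (TwModel E) (TwModel E) (chartAt (TwModel E) z) z = _ :=
    modelDeriv_prodMk (hfst.comp z (mdifferentiableAt_base z))
      (hsnd.comp z (mdifferentiableAt_matrix hz))
  have hself : modelDeriv (TwModel E) (TwModel E) (chartAt (TwModel E) z) z ξ = ξ := by
    rw [← toChart_eq_modelDeriv hz, toChart_self]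
  rw [← hself, hchart]
  refine Prod.ext ?_ ?_
  · refine (DFunLike.congr_fun (modelDeriv_comp hfst (mdifferentiableAt_base z)) ξ).trans ?_
    exact (congrArg (modelDeriv E E _ _) hbase).trans (ContinuousLinearMap.map_zero _)
  · refine (DFunLike.congr_fun (modelDeriv_comp hsnd (mdifferentiableAt_matrix hz)) ξ).trans ?_
    exact (congrArg (modelDeriv _ (FModel (halfDim E)) _ _) hmatrix).trans
      (ContinuousLinearMap.map_zero _)

theorem vertical_ne_zero {ξ : TwModel E} (hbase : dProjL z ξ = 0) (hξ : ξ ≠ 0) :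
    (frameAt z).vertical z ξ ≠ 0 := fun hvertical => by
  refine hξ (eq_zero_of_modelDeriv_matrix_eq_zero hbase ?_)
  rwa [OrthoFrame.vertical_apply, hbase, map_zero, ContinuousLinearMap.zero_comp,
    ContinuousLinearMap.comp_zero, sub_zero, add_zero] at hvertical

theorem twistorFormL_pos {t : ℝ} (ht : 0 < t) (z : TwistorSpace g) {ξ : TwModel E} (hξ : ξ ≠ 0) :
    0 < twistorFormL t z ξ ξ := by
  have hz := mem_chart_source (TwModel E) z
  rw [twistorFormL_eq_vertical hz]
  by_cases hbase : dProjL z ξ = 0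
  · rw [hbase, map_zero, zero_add]
    exact traceFormL_self_pos_of_std ht (vertical_skew hz ξ) (vertical_ne_zero hbase hξ)
  · refine add_pos_of_pos_of_nonneg (metricAt_pos g z.base hbase) ?_
    by_cases hvertical : (frameAt z).vertical z ξ = 0
    · rw [hvertical, map_zero]
    · exact (traceFormL_self_pos_of_std ht (vertical_skew hz ξ) hvertical).le

end TwistorMetric

/-! ### The metric of the twistor space in its charts -/

section TwistorMetricInChart

variable {E : Type*} [NormedAddCommGroup E] [NormedSpace ℝ E] [FiniteDimensional ℝ E]
  {N : Type*} [TopologicalSpace N] [ChartedSpace E N] [IsManifold 𝓘(ℝ, E) ∞ N]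
  {g : RMetric E N} (z₀ : TwistorSpace g) (p : N)

/-- The part of the target of the chart at `z₀` that lies over the chart of `N` at `p`. -/
def overChart : Set (TwModel E) :=
  (chartAt (TwModel E) z₀).target ∩ (chartAt (TwModel E) z₀).symm ⁻¹'
    (TwistorSpace.base ⁻¹' (chartAt E p).source)

/-- The projection to `N` in the charts at `z₀` and `p`. -/
def baseInChart (y : TwModel E) : E :=
  chartAt E p ((chartAt (TwModel E) z₀).symm y).base

/-- The tautological complex structure in the frame and the chart at `z₀`. -/
def matrixInChart (y : TwModel E) : Std (halfDim E) →L[ℝ] Std (halfDim E) :=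
  (frameAt z₀).matrix ((chartAt (TwModel E) z₀).symm y)

/-- The connection matrix of the frame at `z₀`, in the charts at `z₀` and `p`. -/
def connInChart (y : TwModel E) : E →L[ℝ] Std (halfDim E) →L[ℝ] Std (halfDim E) :=
  (frameAt z₀).conn ((chartAt (TwModel E) z₀).symm y).base ∘L
    ofChart E p ((chartAt (TwModel E) z₀).symm y).base

/-- The vertical part of tangent vectors in the frame at `z₀` and in the charts at `z₀`
and `p`. -/
def verticalInChart (y : TwModel E) : TwModel E →L[ℝ] Std (halfDim E) →L[ℝ] Std (halfDim E) :=
  fderiv ℝ (matrixInChart z₀) y +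
    ((ContinuousLinearMap.compL ℝ _ _ _).flip (matrixInChart z₀ y) -
      ContinuousLinearMap.compL ℝ _ _ _ (matrixInChart z₀ y)) ∘L connInChart z₀ p y ∘L
        fderiv ℝ (baseInChart z₀ p) y

theorem isOpen_overChart : IsOpen (overChart z₀ p) :=
  (chartAt (TwModel E) z₀).isOpen_inter_preimage_symm
    ((chartAt E p).open_source.preimage contMDiff_base.continuous)

theorem overChart_center :
    overChart z₀ (frameAt z₀).center = (chartAt (TwModel E) z₀).target :=
  Set.inter_eq_left.2 fun _ hy =>
    (frameAt z₀).dom_subset (base_mem_dom ((chartAt (TwModel E) z₀).map_target hy))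

theorem contMDiffOn_base_symm :
    ContMDiffOn 𝓘(ℝ, TwModel E) 𝓘(ℝ, E) ∞
      (fun y => ((chartAt (TwModel E) z₀).symm y).base) (chartAt (TwModel E) z₀).target :=
  contMDiff_base.comp_contMDiffOn
    (contMDiffOn_chart_symm (I := 𝓘(ℝ, TwModel E)) (n := ∞) (x := z₀))

theorem contDiffOn_baseInChart : ContDiffOn ℝ ∞ (baseInChart z₀ p) (overChart z₀ p) := by
  rw [← contMDiffOn_iff_contDiffOn]
  exact (contMDiffOn_chart (I := 𝓘(ℝ, E)) (n := ∞) (x := p)).comp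
    ((contMDiffOn_base_symm z₀).mono Set.inter_subset_left) fun y hy => hy.2

theorem contDiffOn_fderiv_baseInChart :
    ContDiffOn ℝ ∞ (fderiv ℝ (baseInChart z₀ p)) (overChart z₀ p) :=
  (contDiffOn_baseInChart z₀ p).fderiv_of_isOpen (isOpen_overChart z₀ p) (by simp)

theorem contDiffOn_matrixInChart :
    ContDiffOn ℝ ∞ (matrixInChart z₀) (chartAt (TwModel E) z₀).target := by
  rw [← contMDiffOn_iff_contDiffOn]
  exact (contMDiffOn_matrix z₀).comp
    (contMDiffOn_chart_symm (I := 𝓘(ℝ, TwModel E)) (n := ∞) (x := z₀))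
    fun y hy => (chartAt (TwModel E) z₀).map_target hy

theorem contDiffOn_connInChart : ContDiffOn ℝ ∞ (connInChart z₀ p) (overChart z₀ p) := by
  rw [← contMDiffOn_iff_contDiffOn]
  exact ((frameAt z₀).contMDiffOn_conn_ofChart p).comp
    ((contMDiffOn_base_symm z₀).mono Set.inter_subset_left)
    fun y hy => ⟨base_mem_dom ((chartAt (TwModel E) z₀).map_target hy.1), hy.2⟩

theorem contDiffOn_verticalInChart :
    ContDiffOn ℝ ∞ (verticalInChart z₀ p) (overChart z₀ p) := by
  have hmatrix : ContDiffOn ℝ ∞ (matrixInChart z₀) (overChart z₀ p) :=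
    (contDiffOn_matrixInChart z₀).mono Set.inter_subset_left
  let L := ContinuousLinearMap.compL ℝ (Std (halfDim E)) (Std (halfDim E)) (Std (halfDim E))
  have hbracket : ContDiffOn ℝ ∞
      (fun y => L.flip (matrixInChart z₀ y) - L (matrixInChart z₀ y)) (overChart z₀ p) :=
    (contDiffOn_const.clm_apply hmatrix).sub (contDiffOn_const.clm_apply hmatrix)
  exact (hmatrix.fderiv_of_isOpen (isOpen_overChart z₀ p) (by simp)).add
    (hbracket.clm_comp
      ((contDiffOn_connInChart z₀ p).clm_comp (contDiffOn_fderiv_baseInChart z₀ p)))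

variable {z₀ p} {y : TwModel E} (hy : y ∈ overChart z₀ p)

include hy

theorem toChart_dProjL_ofChart (w : TwModel E) :
    toChart E p ((chartAt (TwModel E) z₀).symm y).base (dProjL ((chartAt (TwModel E) z₀).symm y)
      (ofChart (TwModel E) z₀ ((chartAt (TwModel E) z₀).symm y) w)) =
      fderiv ℝ (baseInChart z₀ p) y w := by
  have hderiv := toChart_comp_modelDeriv_comp_ofChart (f := TwistorSpace.base (g := g)) (p := z₀)
    (p' := p) ((chartAt (TwModel E) z₀).map_target hy.1) hy.2 (mdifferentiableAt_base _)
  rw [(chartAt (TwModel E) z₀).right_inv hy.1] at hderiv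
  exact DFunLike.congr_fun hderiv w

theorem vertical_ofChart (w : TwModel E) :
    (frameAt z₀).vertical ((chartAt (TwModel E) z₀).symm y)
      (ofChart (TwModel E) z₀ ((chartAt (TwModel E) z₀).symm y) w) = verticalInChart z₀ p y w := by
  have hz := (chartAt (TwModel E) z₀).map_target hy.1
  have hmatrix := modelDeriv_comp_ofChart hz (mdifferentiableAt_matrix hz)
  rw [(chartAt (TwModel E) z₀).right_inv hy.1, modelDeriv_eq_fderiv] at hmatrix
  have hconn : connInChart z₀ p y (fderiv ℝ (baseInChart z₀ p) y w) =
      (frameAt z₀).conn ((chartAt (TwModel E) z₀).symm y).base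
        (dProjL ((chartAt (TwModel E) z₀).symm y)
          (ofChart (TwModel E) z₀ ((chartAt (TwModel E) z₀).symm y) w)) := by
    rw [← toChart_dProjL_ofChart hy, connInChart, ContinuousLinearMap.comp_apply,
      ofChart_toChart hy.2]
  rw [OrthoFrame.vertical_apply, ← hconn]
  exact congrArg₂ (· + ·) (DFunLike.congr_fun hmatrix w) rfl

theorem formInChart_twistorFormL (t : ℝ) (w w' : TwModel E) :
    formInChart (twistorFormL t) z₀ y w w' =
      metricInChart g p (baseInChart z₀ p y) (fderiv ℝ (baseInChart z₀ p) y w)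
        (fderiv ℝ (baseInChart z₀ p) y w') +
      traceFormL (Std (halfDim E)) (verticalFactor E t) (verticalInChart z₀ p y w)
        (verticalInChart z₀ p y w') := by
  rw [formInChart_apply, twistorFormL_eq_vertical ((chartAt (TwModel E) z₀).map_target hy.1),
    vertical_ofChart hy, vertical_ofChart hy, ← toChart_dProjL_ofChart hy,
    ← toChart_dProjL_ofChart hy, baseInChart, metricInChart_toChart g hy.2]

omit hy

theorem contDiffOn_formInChart_twistorFormL (t : ℝ) (z₀ : TwistorSpace g) :
    ContDiffOn ℝ ∞ (formInChart (twistorFormL t) z₀) (chartAt (TwModel E) z₀).target := by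
  rw [← overChart_center z₀]
  set p := (frameAt z₀).center
  have hmetric : ContDiffOn ℝ ∞ (fun y => metricInChart g p (baseInChart z₀ p y))
      (overChart z₀ p) :=
    (contDiffOn_metricInChart g p).comp (contDiffOn_baseInChart z₀ p)
      fun y hy => (chartAt E p).map_source hy.2
  have hbase (w : TwModel E) :=
    (contDiffOn_fderiv_baseInChart z₀ p).clm_apply (contDiffOn_const (c := w))
  have hvertical (w : TwModel E) :=
    (contDiffOn_verticalInChart z₀ p).clm_apply (contDiffOn_const (c := w))
  refine contDiffOn_clm_apply.2 fun w => contDiffOn_clm_apply.2 fun w' => ?_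
  exact (((hmetric.clm_apply (hbase w)).clm_apply (hbase w')).add
    ((contDiffOn_const.clm_apply (hvertical w)).clm_apply (hvertical w'))).congr
    fun y hy => formInChart_twistorFormL hy t w w'

/-- The metric `h_t` of the twistor space. -/
def twistorMetric (g : RMetric E N) {t : ℝ} (ht : 0 < t) :
    RMetric (TwModel E) (TwistorSpace g) where
  inner z := twistorFormL t z
  symm z ξ η := twistorFormL_symm t z ξ η
  pos z _ hξ := twistorFormL_pos ht z hξ
  isVonNBounded z := isVonNBounded_of_isCoercive (b := twistorFormL t z)
    (isCoercive_of_pos fun _ => twistorFormL_pos ht z)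
  contMDiff := (contMDiff_form_iff (E := TwModel E) (M := TwistorSpace g) (twistorFormL t)).2
      (contDiffOn_formInChart_twistorFormL t)

end TwistorMetricInChart

/-! ### Sections of a submersion are immersions -/

section Immersion

variable {E : Type*} [NormedAddCommGroup E] [NormedSpace ℝ E]
  {G : Type*} [NormedAddCommGroup G] [NormedSpace ℝ G]

/-- The map `(x, y) ↦ (x, y - q x)` over the open set `V`; it flattens the graph of `q`. -/
def shear (q : E → G) {V : Set E} (hV : IsOpen V) (hq : ContinuousOn q V) :
    OpenPartialHomeomorph (E × G) (E × G) where
  toFun w := (w.1, w.2 - q w.1)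
  invFun w := (w.1, w.2 + q w.1)
  source := V ×ˢ Set.univ
  target := V ×ˢ Set.univ
  map_source' _ hw := ⟨hw.1, trivial⟩
  map_target' _ hw := ⟨hw.1, trivial⟩
  left_inv' _ _ := Prod.ext rfl (sub_add_cancel _ _)
  right_inv' _ _ := Prod.ext rfl (add_sub_cancel_right _ _)
  open_source := hV.prod isOpen_univ
  open_target := hV.prod isOpen_univ
  continuousOn_toFun := continuousOn_fst.prodMk
    (continuousOn_snd.sub (hq.comp continuousOn_fst fun _ hw => hw.1))
  continuousOn_invFun := continuousOn_fst.prodMk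
    (continuousOn_snd.add (hq.comp continuousOn_fst fun _ hw => hw.1))

theorem contDiffOn_shear {q : E → G} {V : Set E} (hV : IsOpen V) (hq : ContDiffOn ℝ ∞ q V) :
    ContDiffOn ℝ ∞ (shear q hV hq.continuousOn) (V ×ˢ Set.univ) :=
  contDiffOn_fst.prodMk (contDiffOn_snd.sub (hq.comp contDiffOn_fst fun _ hw => hw.1))

theorem contDiffOn_shear_symm {q : E → G} {V : Set E} (hV : IsOpen V)
    (hq : ContDiffOn ℝ ∞ q V) :
    ContDiffOn ℝ ∞ (shear q hV hq.continuousOn).symm (V ×ˢ Set.univ) :=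
  contDiffOn_fst.prodMk (contDiffOn_snd.add (hq.comp contDiffOn_fst fun _ hw => hw.1))

theorem chart_trans_mem_maximalAtlas {M : Type*} [TopologicalSpace M] [ChartedSpace E M]
    [IsManifold 𝓘(ℝ, E) ∞ M] (p : M) {S : OpenPartialHomeomorph E E}
    (hS : ContDiffOn ℝ ∞ S S.source) (hS' : ContDiffOn ℝ ∞ S.symm S.target) :
    (chartAt E p).trans S ∈ IsManifold.maximalAtlas 𝓘(ℝ, E) ∞ M :=
  OpenPartialHomeomorph.mem_maximalAtlas_of_contMDiffOn _
    (hS.contMDiffOn.comp ((contMDiffOn_chart (I := 𝓘(ℝ, E)) (x := p)).mono Set.inter_subset_left)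
      fun _ hy => hy.2)
    ((contMDiffOn_chart_symm (I := 𝓘(ℝ, E)) (x := p)).comp
      (hS'.contMDiffOn.mono Set.inter_subset_left) fun _ hy => hy.2)

theorem chart_restrOpen_mem_maximalAtlas {M : Type*} [TopologicalSpace M] [ChartedSpace E M]
    [IsManifold 𝓘(ℝ, E) ∞ M] (p : M) {U : Set M} (hU : IsOpen U) :
    (chartAt E p).restrOpen U hU ∈ IsManifold.maximalAtlas 𝓘(ℝ, E) ∞ M :=
  OpenPartialHomeomorph.mem_maximalAtlas_of_contMDiffOn _
    ((contMDiffOn_chart (I := 𝓘(ℝ, E)) (x := p)).mono Set.inter_subset_left)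
    ((contMDiffOn_chart_symm (I := 𝓘(ℝ, E)) (x := p)).mono Set.inter_subset_left)

variable {M : Type*} [TopologicalSpace M] [ChartedSpace E M] [IsManifold 𝓘(ℝ, E) ∞ M]
  {Z : Type*} [TopologicalSpace Z] [ChartedSpace (E × G) Z] [IsManifold 𝓘(ℝ, E × G) ∞ Z]

theorem isImmersionAt_of_graph {f : M → Z} (hf : ContMDiff 𝓘(ℝ, E) 𝓘(ℝ, E × G) ∞ f) {x p : M}
    {z : Z} (hx : x ∈ (chartAt E p).source) (hz : f x ∈ (chartAt (E × G) z).source)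
    (hfst : ∀ x ∈ (chartAt E p).source, f x ∈ (chartAt (E × G) z).source →
      (chartAt (E × G) z (f x)).1 = chartAt E p x) :
    Manifold.IsImmersionAtOfComplement G 𝓘(ℝ, E) 𝓘(ℝ, E × G) ∞ f x := by
  set φ := chartAt E p
  set ψ := chartAt (E × G) z
  have hU : IsOpen (f ⁻¹' ψ.source) := ψ.open_source.preimage hf.continuous
  have hV : IsOpen (φ.target ∩ φ.symm ⁻¹' (f ⁻¹' ψ.source)) := φ.isOpen_inter_preimage_symm hU
  let q : E → G := fun y => (ψ (f (φ.symm y))).2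
  have hq : ContDiffOn ℝ ∞ q (φ.target ∩ φ.symm ⁻¹' (f ⁻¹' ψ.source)) := by
    rw [← contMDiffOn_iff_contDiffOn]
    exact (contDiff_snd (n := ∞)).contMDiff.comp_contMDiffOn
      ((contMDiffOn_chart (I := 𝓘(ℝ, E × G)) (n := ∞) (x := z)).comp
        (hf.comp_contMDiffOn ((contMDiffOn_chart_symm (I := 𝓘(ℝ, E)) (n := ∞) (x := p)).mono
          Set.inter_subset_left)) fun y hy => hy.2)
  refine Manifold.IsImmersionAtOfComplement.mk_of_continuousAt hf.continuous.continuousAt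
    (ContinuousLinearEquiv.refl ℝ (E × G)) (φ.restrOpen _ hU)
    (ψ.trans (shear q hV hq.continuousOn)) ⟨hx, hz⟩ ⟨hz, ?_, trivial⟩
    (chart_restrOpen_mem_maximalAtlas p hU)
    (chart_trans_mem_maximalAtlas z (contDiffOn_shear hV hq) (contDiffOn_shear_symm hV hq)) ?_
  · change (ψ (f x)).1 ∈ _
    rw [hfst x hx hz]
    exact ⟨φ.map_source hx, by rwa [Set.mem_preimage, φ.left_inv hx]⟩
  · intro y hy
    have hmem : y ∈ φ.target ∧ f (φ.symm y) ∈ ψ.source := by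
      simpa [OpenPartialHomeomorph.extend, OpenPartialHomeomorph.restrOpen] using hy
    have hbase := hfst (φ.symm y) (φ.map_target hmem.1) hmem.2
    rw [φ.right_inv hmem.1] at hbase
    change ((ψ (f (φ.symm y))).1, (ψ (f (φ.symm y))).2 - q (ψ (f (φ.symm y))).1) = (y, 0)
    rw [hbase, sub_self]

end Immersion

/-! ### The section of the twistor space given by an almost Hermitian structure -/

section StructureSection

variable {E : Type*} [NormedAddCommGroup E] [NormedSpace ℝ E] [FiniteDimensional ℝ E]
  {N : Type*} [TopologicalSpace N] [ChartedSpace E N] [IsManifold 𝓘(ℝ, E) ∞ N]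
  {g : RMetric E N} {J : ∀ x : N, Tan E x →L[ℝ] Tan E x}

namespace IsAlmostHermitian

variable (hJ : IsAlmostHermitian g J)

omit [FiniteDimensional ℝ E] in
theorem contMDiffOn_matrix_toTwistor (F : OrthoFrame g) :
    ContMDiffOn 𝓘(ℝ, E) 𝓘(ℝ, Std (halfDim E) →L[ℝ] Std (halfDim E)) ∞
      (fun x => F.matrix (hJ.toTwistor x)) F.dom := by
  refine contMDiffOn_clm_of_apply fun u => contMDiffOn_of_inner fun v => ?_
  have hJF : ContMDiffOn 𝓘(ℝ, E) (𝓘(ℝ, E).prod 𝓘(ℝ, E)) ∞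
      (fun x => (⟨x, J x (F.frame x u)⟩ : TangentBundle 𝓘(ℝ, E) N)) F.dom :=
    ContMDiffOn.clm_bundle_apply (F₁ := E) (F₂ := E) hJ.smooth.contMDiffOn (F.smooth u)
  exact (contMDiffOn_inner g hJF (F.smooth v)).congr fun x hx => F.inner_frInv hx _ v

theorem eventually_mem_source (p : N) :
    ∀ᶠ x in 𝓝 p, hJ.toTwistor x ∈ (chartAt (TwModel E) (hJ.toTwistor p)).source := by
  have hp := mem_chart_source (TwModel E) (hJ.toTwistor p)
  set F := frameAt (hJ.toTwistor p)
  have hdom : F.dom ∈ 𝓝 p := F.isOpen_dom.mem_nhds hp.1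
  have hmatrix := (hJ.contMDiffOn_matrix_toTwistor F).continuousOn.continuousAt hdom
  have hcayley : ContinuousAt (fun x => 1 - stdJ (halfDim E) * F.matrix (hJ.toTwistor x)) p :=
    continuousAt_const.sub (continuousAt_const.mul hmatrix)
  filter_upwards [hdom, hcayley.eventually (Units.isOpen.mem_nhds hp.2)] with x hx hunit
    using ⟨hx, hunit⟩

theorem contMDiffAt_chart_toTwistor (p : N) :
    ContMDiffAt 𝓘(ℝ, E) 𝓘(ℝ, TwModel E) ∞
      (fun x => chartAt (TwModel E) (hJ.toTwistor p) (hJ.toTwistor x)) p := by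
  have hp := mem_chart_source (TwModel E) (hJ.toTwistor p)
  set F := frameAt (hJ.toTwistor p)
  have hmatrix : ContMDiffAt 𝓘(ℝ, E) 𝓘(ℝ, Std (halfDim E) →L[ℝ] Std (halfDim E)) ∞
      (fun x => F.matrix (hJ.toTwistor x)) p :=
    (hJ.contMDiffOn_matrix_toTwistor F).contMDiffAt (F.isOpen_dom.mem_nhds hp.1)
  have hproj : ContDiffAt ℝ ∞ (fun K => projF (halfDim E) (cayleyInv K))
      (F.matrix (hJ.toTwistor p)) :=
    (projF (halfDim E)).contDiff.contDiffAt.comp _ (contDiffAt_cayleyInv hp.2)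
  have hchart : ContMDiffAt 𝓘(ℝ, E) 𝓘(ℝ, E) ∞ (chartAt E F.center) p :=
    (contMDiffOn_chart (I := 𝓘(ℝ, E)) (n := ∞)).contMDiffAt
      ((chartAt E F.center).open_source.mem_nhds (F.dom_subset hp.1))
  exact hchart.prodMk_space
    (ContMDiffAt.comp p (g := fun K => projF (halfDim E) (cayleyInv K)) hproj.contMDiffAt hmatrix)

theorem contMDiff_toTwistor : ContMDiff 𝓘(ℝ, E) 𝓘(ℝ, TwModel E) ∞ hJ.toTwistor := by
  intro p
  have hsymm := (contMDiffOn_chart_symm (I := 𝓘(ℝ, TwModel E)) (n := ∞)).contMDiffAt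
    ((chartAt (TwModel E) (hJ.toTwistor p)).open_target.mem_nhds (mem_chart_target _ _))
  refine (hsymm.comp p (hJ.contMDiffAt_chart_toTwistor p)).congr_of_eventuallyEq ?_
  filter_upwards [hJ.eventually_mem_source p] with x hx
  exact ((chartAt (TwModel E) (hJ.toTwistor p)).left_inv hx).symm

theorem isSmoothEmbedding_toTwistor :
    Manifold.IsSmoothEmbedding 𝓘(ℝ, E) 𝓘(ℝ, TwModel E) ∞ hJ.toTwistor := by
  have himmersion : Manifold.IsImmersionOfComplement (FModel (halfDim E)) 𝓘(ℝ, E)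
      𝓘(ℝ, TwModel E) ∞ hJ.toTwistor := fun x => by
    have hx := mem_chart_source (TwModel E) (hJ.toTwistor x)
    exact isImmersionAt_of_graph hJ.contMDiff_toTwistor
      ((frameAt (hJ.toTwistor x)).dom_subset hx.1) hx fun _ _ _ => rfl
  exact ⟨himmersion.isImmersion, Function.LeftInverse.isEmbedding (f := TwistorSpace.base)
    (fun _ => rfl) contMDiff_base.continuous hJ.contMDiff_toTwistor.continuous⟩

theorem mdifferentiableAt_toTwistor (p : N) :
    MDifferentiableAt 𝓘(ℝ, E) 𝓘(ℝ, TwModel E) hJ.toTwistor p :=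
  (hJ.contMDiff_toTwistor p).mdifferentiableAt (by simp)

theorem dProjL_modelDeriv_toTwistor (p : N) (u : E) :
    dProjL (hJ.toTwistor p) (modelDeriv E (TwModel E) hJ.toTwistor p u) = u := by
  have hcomp := modelDeriv_comp (mdifferentiableAt_base (hJ.toTwistor p))
    (hJ.mdifferentiableAt_toTwistor p)
  have hid : modelDeriv E E (fun x => (hJ.toTwistor x).base) p = ContinuousLinearMap.id ℝ E :=
    mfderiv_id
  exact DFunLike.congr_fun (hcomp.symm.trans hid) u

end IsAlmostHermitian

theorem IsKaehler.verticalPartL_modelDeriv_toTwistor (hJ : IsKaehler g J) (p : N) (u : E) :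
    verticalPartL (hJ.toTwistor p) (modelDeriv E (TwModel E) hJ.toTwistor p u) = 0 := by
  have hp := mem_chart_source (TwModel E) (hJ.toTwistor p)
  have hcomp := DFunLike.congr_fun (modelDeriv_comp
    (OrthoFrame.mdifferentiableAt_strInChart (base_mem_dom hp) (mdifferentiableAt_matrix hp))
    (hJ.mdifferentiableAt_toTwistor p)) u
  rw [verticalPartL_apply, hJ.dProjL_modelDeriv_toTwistor, ← add_sub_assoc]
  refine Eq.trans ?_ (hJ.covDerivEnd_eq_zero p u)
  exact congrArg₂ (· - ·) (congrArg₂ (· + ·) hcomp.symm rfl) rfl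

end StructureSection

/-! ### The second fundamental form in charts -/

section SecondFundamentalForm

variable {E : Type*} [NormedAddCommGroup E] [NormedSpace ℝ E]
  {M : Type*} [TopologicalSpace M] [ChartedSpace E M]
  {E' : Type*} [NormedAddCommGroup E'] [NormedSpace ℝ E']
  {M' : Type*} [TopologicalSpace M'] [ChartedSpace E' M']

/-- The local expression of a map in the charts at `p` and at its image. -/
def inCharts (E E' : Type*) [NormedAddCommGroup E] [NormedSpace ℝ E] [NormedAddCommGroup E']
    [NormedSpace ℝ E'] {M M' : Type*} [TopologicalSpace M] [ChartedSpace E M]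
    [TopologicalSpace M'] [ChartedSpace E' M'] (f : M → M') (p : M) (y : E) : E' :=
  chartAt E' (f p) (f ((chartAt E p).symm y))

theorem inCharts_self (f : M → M') (p : M) :
    inCharts E E' f p (chartAt E p p) = chartAt E' (f p) (f p) := by
  rw [inCharts, (chartAt E p).left_inv (mem_chart_source E p)]

theorem chart_symm_inCharts {f : M → M'} {p : M} {y : E}
    (hy : f ((chartAt E p).symm y) ∈ (chartAt E' (f p)).source) :
    (chartAt E' (f p)).symm (inCharts E E' f p y) = f ((chartAt E p).symm y) :=
  (chartAt E' (f p)).left_inv hy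

variable [IsManifold 𝓘(ℝ, E) ∞ M] [IsManifold 𝓘(ℝ, E') ∞ M'] {f : M → M'}

theorem contDiffAt_inCharts (hf : ContMDiff 𝓘(ℝ, E) 𝓘(ℝ, E') ∞ f) (p : M) :
    ContDiffAt ℝ ∞ (inCharts E E' f p) (chartAt E p p) := by
  rw [← contMDiffAt_iff_contDiffAt]
  refine ContMDiffAt.comp (I' := 𝓘(ℝ, E')) (chartAt E p p) (g := chartAt E' (f p)) ?_
    (contMDiffAt_comp_chart_symm (mem_chart_source E p) (hf p))
  rw [(chartAt E p).left_inv (mem_chart_source E p)]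
  exact (contMDiffOn_chart (I := 𝓘(ℝ, E')) (n := ∞)).contMDiffAt
    ((chartAt E' (f p)).open_source.mem_nhds (mem_chart_source E' (f p)))

theorem fderiv_inCharts {p x : M} (hx : x ∈ (chartAt E p).source)
    (hfx : f x ∈ (chartAt E' (f p)).source)
    (hf : MDifferentiableAt 𝓘(ℝ, E) 𝓘(ℝ, E') f x) (u : E) :
    fderiv ℝ (inCharts E E' f p) (chartAt E p x) u =
      toChart E' (f p) (f x) (modelDeriv E E' f x (ofChart E p x u)) :=
  (DFunLike.congr_fun (toChart_comp_modelDeriv_comp_ofChart hx hfx hf) u).symm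

theorem fderiv_inCharts_self {p : M}
    (hf : MDifferentiableAt 𝓘(ℝ, E) 𝓘(ℝ, E') f p) (u : E) :
    fderiv ℝ (inCharts E E' f p) (chartAt E p p) u = modelDeriv E E' f p u := by
  rw [fderiv_inCharts (mem_chart_source E p) (mem_chart_source E' (f p)) hf, toChart_self,
    ofChart_self]

theorem toChart_modelDeriv_eventuallyEq (hf : ContMDiff 𝓘(ℝ, E) 𝓘(ℝ, E') ∞ f) (p : M)
    (Y : M → E) :
    (fun x => toChart E' (f p) (f x) (modelDeriv E E' f x (Y x))) =ᶠ[𝓝 p]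
      fun x => (fun y => fderiv ℝ (inCharts E E' f p) y
        (toChart E p ((chartAt E p).symm y) (Y ((chartAt E p).symm y)))) (chartAt E p x) := by
  filter_upwards [(chartAt E p).open_source.mem_nhds (mem_chart_source E p),
    hf.continuous.continuousAt.eventually ((chartAt E' (f p)).open_source.mem_nhds
      (mem_chart_source E' (f p)))] with x hx hfx
  simp only [(chartAt E p).left_inv hx]
  rw [fderiv_inCharts hx hfx ((hf x).mdifferentiableAt (by simp)), ofChart_toChart hx]

theorem modelDeriv_toChart_modelDeriv (hf : ContMDiff 𝓘(ℝ, E) 𝓘(ℝ, E') ∞ f) {p : M} {Y : M → E}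
    (hY : SmoothFieldAt (M := M) Y p) (X : E) :
    modelDeriv E E' (fun x => toChart E' (f p) (f x) (modelDeriv E E' f x (Y x))) p X =
      fderiv ℝ (inCharts E E' f p) (chartAt E p p)
        (modelDeriv E E (fun x => toChart E p x (Y x)) p X) +
      fderiv ℝ (fderiv ℝ (inCharts E E' f p)) (chartAt E p p) X (Y p) := by
  have hp := mem_chart_source E p
  have hYd : MDifferentiableAt 𝓘(ℝ, E) 𝓘(ℝ, E) (fun x => toChart E p x (Y x)) p :=
    SmoothFieldAt.mdifferentiableAt_toChart hY
  have hfd : DifferentiableAt ℝ (fderiv ℝ (inCharts E E' f p)) (chartAt E p p) :=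
    ((contDiffAt_inCharts hf p).fderiv_right (m := ∞) (by simp)).differentiableAt (by simp)
  have hderiv := hfd.hasFDerivAt.clm_apply (differentiableAt_comp_chart_symm hp hYd).hasFDerivAt
  rw [modelDeriv_congr (toChart_modelDeriv_eventuallyEq hf p Y),
    modelDeriv_comp hderiv.differentiableAt.mdifferentiableAt (mdifferentiableAt_chartAt hp),
    modelDeriv_eq_fderiv, hderiv.fderiv, ← toChart_eq_modelDeriv hp,
    modelDeriv_eq_fderiv_chart hYd]
  simp only [ContinuousLinearMap.comp_apply, add_apply, ContinuousLinearMap.flip_apply,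
    (chartAt E p).left_inv hp, toChart_self]

theorem secondFundamentalForm_eq (g : RMetric E M) (g' : RMetric E' M')
    (hf : ContMDiff 𝓘(ℝ, E) 𝓘(ℝ, E') ∞ f) (p : M) (X : E) (Y : M → E)
    (hY : SmoothFieldAt (M := M) Y p) :
    secondFundamentalForm g g' f p X Y =
      (fderiv ℝ (fderiv ℝ (inCharts E E' f p)) (chartAt E p p) X (Y p) +
        christoffel g' (f p) (fderiv ℝ (inCharts E E' f p) (chartAt E p p) X)
          (fderiv ℝ (inCharts E E' f p) (chartAt E p p) (Y p)) -
        fderiv ℝ (inCharts E E' f p) (chartAt E p p) (christoffel g p X (Y p)) : E') := by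
  have hid : modelDeriv E E (id : M → M) p = ContinuousLinearMap.id ℝ E := mfderiv_id
  have hdef : secondFundamentalForm g g' f p X Y =
      (modelDeriv E E' (fun x => toChart E' (f p) (f x) (modelDeriv E E' f x (Y x))) p X +
        christoffel g' (f p) (modelDeriv E E' f p X) (modelDeriv E E' f p (Y p)) -
        modelDeriv E E' f p (modelDeriv E E (fun x => toChart E p x (Y x)) p X +
          christoffel g p (modelDeriv E E (id : M → M) p X) (Y p)) : E') := rfl
  rw [hdef, modelDeriv_toChart_modelDeriv hf hY, hid, ContinuousLinearMap.id_apply]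
  simp only [fderiv_inCharts_self ((hf p).mdifferentiableAt (by simp)), map_add]
  abel

end SecondFundamentalForm

/-! ### Kähler structures are totally geodesic isometric sections -/

section TotallyGeodesic

variable {E : Type*} [NormedAddCommGroup E] [NormedSpace ℝ E] [FiniteDimensional ℝ E]
  {N : Type*} [TopologicalSpace N] [ChartedSpace E N] [IsManifold 𝓘(ℝ, E) ∞ N]
  {g : RMetric E N} {J : ∀ x : N, Tan E x →L[ℝ] Tan E x}

theorem IsAlmostHermitian.eventually_mem_chart_source (hJ : IsAlmostHermitian g J) (p : N) :
    ∀ᶠ y in 𝓝 (chartAt E p p), y ∈ (chartAt E p).target ∧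
      hJ.toTwistor ((chartAt E p).symm y) ∈ (chartAt (TwModel E) (hJ.toTwistor p)).source :=
  (Filter.eventually_of_mem ((chartAt E p).open_target.mem_nhds (mem_chart_target E p))
    fun _ hy => hy).and
    (((chartAt E p).tendsto_symm (mem_chart_source E p)).eventually (hJ.eventually_mem_source p))

section

variable {p : N} {y : E} (hy : y ∈ (chartAt E p).target)

include hy

theorem IsAlmostHermitian.inCharts_toTwistor_mem_overChart (hJ : IsAlmostHermitian g J)
    (hz : hJ.toTwistor ((chartAt E p).symm y) ∈ (chartAt (TwModel E) (hJ.toTwistor p)).source) :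
    inCharts E (TwModel E) hJ.toTwistor p y ∈ overChart (hJ.toTwistor p) p := by
  refine ⟨(chartAt (TwModel E) (hJ.toTwistor p)).map_source hz, ?_⟩
  rw [Set.mem_preimage, chart_symm_inCharts hz]
  exact (chartAt E p).map_target hy

theorem IsAlmostHermitian.baseInChart_inCharts_toTwistor (hJ : IsAlmostHermitian g J)
    (hz : hJ.toTwistor ((chartAt E p).symm y) ∈ (chartAt (TwModel E) (hJ.toTwistor p)).source) :
    baseInChart (hJ.toTwistor p) p (inCharts E (TwModel E) hJ.toTwistor p y) = y := by
  rw [baseInChart, chart_symm_inCharts hz]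
  exact (chartAt E p).right_inv hy

theorem IsKaehler.verticalInChart_fderiv_inCharts_toTwistor (hJ : IsKaehler g J)
    (hz : hJ.toTwistor ((chartAt E p).symm y) ∈ (chartAt (TwModel E) (hJ.toTwistor p)).source)
    (u : E) :
    verticalInChart (hJ.toTwistor p) p (inCharts E (TwModel E) hJ.toTwistor p y)
      (fderiv ℝ (inCharts E (TwModel E) hJ.toTwistor p) y u) = 0 := by
  have hderiv := fderiv_inCharts ((chartAt E p).map_target hy) hz
    (hJ.mdifferentiableAt_toTwistor _) u
  rw [(chartAt E p).right_inv hy] at hderiv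
  rw [← vertical_ofChart (hJ.inCharts_toTwistor_mem_overChart hy hz), chart_symm_inCharts hz,
    hderiv, ofChart_toChart hz, OrthoFrame.vertical_apply,
    ← OrthoFrame.frInv_verticalPartL_fr (base_mem_dom hz) (mdifferentiableAt_matrix hz),
    hJ.verticalPartL_modelDeriv_toTwistor, ContinuousLinearMap.zero_comp,
    ContinuousLinearMap.comp_zero]

end

theorem IsKaehler.isTotallyGeodesic_toTwistor (hJ : IsKaehler g J) {t : ℝ} (ht : 0 < t) :
    IsTotallyGeodesic g (twistorMetric g ht) hJ.toTwistor := by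
  intro p X Y hY
  have hself := inCharts_self (E := E) (E' := TwModel E) hJ.toTwistor p
  have hnear := hJ.eventually_mem_chart_source p
  have hover := (isOpen_overChart (hJ.toTwistor p) p).mem_nhds
    (hJ.inCharts_toTwistor_mem_overChart hnear.self_of_nhds.1 hnear.self_of_nhds.2)
  have hmetric := contDiffAt_metricInChart (twistorMetric g ht) (hJ.toTwistor p)
  rw [← hself] at hmetric
  have horth := secondFundamentalForm_eq_zero_of_horizontal
    ((contDiffAt_inCharts hJ.contMDiff_toTwistor p).of_le ENat.LEInfty.out)
    (((contDiffOn_baseInChart (hJ.toTwistor p) p).contDiffAt hover).of_le ENat.LEInfty.out)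
    ((contDiffAt_metricInChart g p).differentiableAt (by simp)) (metricInChart_symm g p _)
    (((contDiffOn_verticalInChart (hJ.toTwistor p) p).contDiffAt hover).differentiableAt (by simp))
    (hnear.mono fun y hy => hJ.baseInChart_inCharts_toTwistor hy.1 hy.2)
    (Filter.eventually_of_mem hover fun y hy => formInChart_twistorFormL hy t)
    (hmetric.differentiableAt (by simp))
    (hnear.mono fun y hy => hJ.verticalInChart_fderiv_inCharts_toTwistor hy.1 hy.2)
    (Γg := fun u v => christoffel g p u v) (inner_christoffel g p)
    (Γh := fun u v => christoffel (twistorMetric g ht) (hJ.toTwistor p) u v)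
    (by rw [hself]; exact inner_christoffel (twistorMetric g ht) (hJ.toTwistor p)) X (Y p)
  refine (secondFundamentalForm_eq g (twistorMetric g ht) hJ.contMDiff_toTwistor p X Y hY).trans ?_
  by_contra hne
  have hpos := metricAt_pos (twistorMetric g ht) (hJ.toTwistor p) hne
  rw [← metricInChart_self, ← hself] at hpos
  exact hpos.ne' (horth _)

theorem IsKaehler.twistorFormL_modelDeriv_toTwistor (hJ : IsKaehler g J) (t : ℝ) (p : N)
    (u v : E) :
    twistorFormL t (hJ.toTwistor p) (modelDeriv E (TwModel E) hJ.toTwistor p u)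
      (modelDeriv E (TwModel E) hJ.toTwistor p v) = metricAt g p u v := by
  rw [twistorFormL_apply, hJ.verticalPartL_modelDeriv_toTwistor,
    hJ.verticalPartL_modelDeriv_toTwistor, hJ.dProjL_modelDeriv_toTwistor,
    hJ.dProjL_modelDeriv_toTwistor, map_zero, add_zero]
  rfl

theorem IsKaehler.isIsometricEmbedding_toTwistor (hJ : IsKaehler g J) {t : ℝ} (ht : 0 < t) :
    IsIsometricEmbedding g (twistorMetric g ht) hJ.toTwistor where
  isSmoothEmbedding := hJ.isSmoothEmbedding_toTwistor
  isometric p u v := hJ.twistorFormL_modelDeriv_toTwistor t p u v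

end TotallyGeodesic

end Twistor

end

theorem corollary1 {E : Type*} [NormedAddCommGroup E] [NormedSpace ℝ E] [FiniteDimensional ℝ E]
    {N : Type*} [TopologicalSpace N] [ChartedSpace E N] [IsManifold 𝓘(ℝ, E) ∞ N]
    (g : Twistor.RMetric E N)
    (J : ∀ x : N, Twistor.Tan E x →L[ℝ] Twistor.Tan E x)
    (hJ : Twistor.IsKaehler g J)
    (t : ℝ) (ht : 0 < t) :
    ∃ h : Twistor.RMetric (E × Twistor.FModel (Twistor.halfDim E)) (Twistor.TwistorSpace g),
      (∀ (z : Twistor.TwistorSpace g) (ξ η : Twistor.TanTw z),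
        h.inner z ξ η = Twistor.twistorForm t z ξ η) ∧
      Twistor.IsIsometricEmbedding g h hJ.toTwistor ∧
      Twistor.IsTotallyGeodesic g h hJ.toTwistor :=
  ⟨Twistor.twistorMetric g ht, fun z ξ η => Twistor.twistorFormL_eq_twistorForm t z ξ η,
    hJ.isIsometricEmbedding_toTwistor ht, hJ.isTotallyGeodesic_toTwistor ht⟩
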